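/- For $\beta\in\mathbb R$ consider the characteristic equation $$\frac12\int_0^1\Big[\cot\frac{\pi(\xi-x)}2+\beta\cot\frac{\pi(\xi+x)}2\Big]\phi(\xi)\,d\xi=f(x),\qquad 0<x<1,\tag{$*$}$$ where $f:[0,1]\to\mathbb R$ is Hölder continuous on $[0,1]$ and the integral (like the integrals in the formulas below) is a Cauchy principal value at $\xi=x$. The unknown $\phi:(0,1)\to\mathbb R$ is Hölder continuous on every closed subinterval of $(0,1)$; it is called a bounded solution if it satisfies $(*)$ and is bounded on $(0,1)$, and an almost bounded solution if it satisfies $(*)$ and $|\phi(x)|\le M(1+|\log x|+|\log(1-x)|)$ on $(0,1)$ for some constant $M$. (i) Let $\beta=1$. Then $(*)$ has a bounded solution if and only if $\int_0^1 f(\xi)\,d\xi=0$. In that case the bounded solution is unique and $$\phi(x)=-\frac12\int_0^1\Big[\cot\frac{\pi(\xi-x)}2-\cot\frac{\pi(\xi+x)}2\Big]f(\xi)\,d\xi,\qquad 0<x<1.$$ (ii) Let $\beta=-1$. Then, for every such $f$, equation $(*)$ has an almost bounded solution, and the almost bounded solutions are exactly the functions $$\phi(x)=-\frac12\int_0^1\Big[\cot\frac{\pi(\xi-x)}2+\cot\frac{\pi(\xi+x)}2\Big]f(\xi)\,d\xi+C,\qquad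 0<x<1,$$ with $C\in\mathbb R$ an arbitrary constant. A bounded solution exists if and only if $f(0)=f(1)=0$, and in that case the bounded solutions are exactly these same functions. -/

import Mathlib

open Set Filter Topology MeasureTheory

/-- `L` is the Cauchy principal value, with respect to the point `x`, of `∫₀¹ g(ξ) dξ`:
`g` is integrable over `(0, 1)` minus every symmetric neighbourhood `(x - ε, x + ε)`, and the
integrals over these sets converge to `L` as `ε → 0⁺`. -/
def HasPrincipalValue (g : ℝ → ℝ) (x L : ℝ) : Prop :=
  (∀ ε : ℝ, 0 < ε → IntegrableOn g (Ioo 0 1 \ Ioo (x - ε) (x + ε))) ∧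
    Tendsto (fun ε : ℝ => ∫ ξ in Ioo 0 1 \ Ioo (x - ε) (x + ε), g ξ) (𝓝[>] 0) (𝓝 L)

/-- The kernel `S(x, ξ) = ½ cot (π (ξ - x) / 2) + (β / 2) cot (π (ξ + x) / 2)`. -/
noncomputable def kernelS (β x ξ : ℝ) : ℝ :=
  1 / 2 * Real.cot (Real.pi * (ξ - x) / 2) + β / 2 * Real.cot (Real.pi * (ξ + x) / 2)

/-- `φ` satisfies the characteristic equation `∫₀¹ S(x, ξ) φ(ξ) dξ = f(x)` for `0 < x < 1`,
the integral being a principal value at `ξ = x`. -/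
def SatisfiesCharacteristicEq (β : ℝ) (f φ : ℝ → ℝ) : Prop :=
  ∀ x ∈ Ioo (0 : ℝ) 1, HasPrincipalValue (fun ξ => kernelS β x ξ * φ ξ) x (f x)

/-- The class `H[0,1]`: Hölder continuous on the closed interval, with some positive exponent. -/
def HolderClosed (f : ℝ → ℝ) : Prop :=
  ∃ K r : NNReal, 0 < r ∧ HolderOnWith K r f (Icc 0 1)

/-- The class `H(0,1)`: Hölder continuous on every closed subinterval of the open interval
`(0, 1)`. -/
def HolderOpen (φ : ℝ → ℝ) : Prop :=
  ∀ a b : ℝ, 0 < a → b < 1 → ∃ K r : NNReal, 0 < r ∧ HolderOnWith K r φ (Icc a b)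

/-- `φ` solves the characteristic equation in the class of functions Hölder continuous in `(0, 1)`
and bounded at the endpoints. -/
def IsBoundedSolution (β : ℝ) (f φ : ℝ → ℝ) : Prop :=
  HolderOpen φ ∧ (∃ M : ℝ, ∀ x ∈ Ioo (0 : ℝ) 1, |φ x| ≤ M) ∧ SatisfiesCharacteristicEq β f φ

/-- `φ` solves the characteristic equation in the class of functions Hölder continuous in `(0, 1)`
and almost bounded (at most of logarithmic growth) at the endpoints. -/
def IsAlmostBoundedSolution (β : ℝ) (f φ : ℝ → ℝ) : Prop :=
  HolderOpen φ ∧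
    (∃ M : ℝ, ∀ x ∈ Ioo (0 : ℝ) 1, |φ x| ≤ M * (1 + |Real.log x| + |Real.log (1 - x)|)) ∧
    SatisfiesCharacteristicEq β f φ

/-- On `(0, 1)`, the function `φ` is given by
`φ(x) = -½ ∫₀¹ [cot (π (ξ - x) / 2) - β cot (π (ξ + x) / 2)] f(ξ) dξ` (a principal value, which
in particular exists). -/
def IsHilbertInverse (β : ℝ) (f φ : ℝ → ℝ) : Prop :=
  ∀ x ∈ Ioo (0 : ℝ) 1, ∃ L : ℝ,
    HasPrincipalValue (fun ξ => (Real.cot (Real.pi * (ξ - x) / 2)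
      - β * Real.cot (Real.pi * (ξ + x) / 2)) * f ξ) x L ∧ φ x = -(1 / 2) * L

/-! Write K(x, ξ) = 1 / (cos πx - cos πξ) and let T be the principal value transform with kernel K.
The cotangent kernels factor: their half-difference is sin πx · K and their half-sum is sin πξ · K.
Hence (∗) reads T(sin πξ · φ) = f for β = 1 and sin πx · Tφ = f for β = -1, and the proposed
inverses are -sin πx · Tf and -T(sin πξ · f). Since the principal value of ∫ K(x, ξ) dξ is 0, Tu(x)
is the absolutely convergent integral of K(x, ξ)(u(ξ) - u(x)).

Two facts carry the argument. T is antisymmetric (`integral_pvTransform_mul_of_support`,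
`integral_pvTransform_mul`): truncate, apply Fubini, and use K(ξ, x) = -K(x, ξ). And T(cos nπξ) =
-sin nπx / sin πx (Glauert, `pvTransform_cos`), so T(sin πξ · sin (n+1)πξ) = cos (n+1)πx. Together
they convert (∗) into relations between sine coefficients and cosine coefficients
(`integral_sin_mul_pvTransform_mul_sin`, `integral_pvTransform_sin_mul_mul_cos`). Completeness of
the trigonometric systems gives uniqueness, up to a constant when β = -1; the degree-zero
coefficient gives the condition ∫ f = 0 when β = 1.

Existence rests on T(sin² · Tf) = -f + ∫ f. For smooth functions of cos πx it follows from the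
coefficient relations; duality extends it to Hölder f (`HolderClosed.pvTransform_sin_sq_mul`).
Applied to sin · f, and using that T commutes with multiplication by cos πx up to a constant, it
gives sin · T(T(sin · f)) = -f, the case β = -1.

Boundedness for β = -1 is read off from T(sin · f) = f · T(sin) + O(1), where T(sin) is explicit and
logarithmically infinite at both endpoints. -/

/-! ### The cosine kernel: elementary bounds and its relation to the cotangents. -/

/-- The kernel `1 / (cos πx - cos πξ)`. -/
noncomputable def cosKernel (x ξ : ℝ) : ℝ :=
  (Real.cos (Real.pi * x) - Real.cos (Real.pi * ξ))⁻¹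

/-- The regularised form of the principal value integral of `cosKernel x ξ * u ξ`. -/
noncomputable def pvTransform (u : ℝ → ℝ) (x : ℝ) : ℝ :=
  ∫ ξ in Ioo (0 : ℝ) 1, cosKernel x ξ * (u ξ - u x)

lemma cosKernel_self (x : ℝ) : cosKernel x x = 0 := by simp [cosKernel]

lemma cosKernel_swap (x ξ : ℝ) : cosKernel ξ x = -cosKernel x ξ := by
  rw [cosKernel, cosKernel, ← inv_neg, neg_sub]

lemma measurable_cosKernel : Measurable (fun p : ℝ × ℝ => cosKernel p.1 p.2) := by
  unfold cosKernel; fun_prop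

lemma measurable_cosKernel_right (x : ℝ) : Measurable (cosKernel x) := by
  unfold cosKernel; fun_prop

lemma cos_sub_cos_pi (x ξ : ℝ) : Real.cos (Real.pi * x) - Real.cos (Real.pi * ξ) =
    2 * Real.sin (Real.pi * (ξ + x) / 2) * Real.sin (Real.pi * (ξ - x) / 2) := by
  rw [Real.cos_sub_cos, show (Real.pi * x - Real.pi * ξ) / 2 = -(Real.pi * (ξ - x) / 2) by ring,
    Real.sin_neg, show (Real.pi * x + Real.pi * ξ) / 2 = Real.pi * (ξ + x) / 2 by ring]
  ring

lemma sin_pi_nonneg {x : ℝ} (hx : x ∈ Icc (0 : ℝ) 1) : 0 ≤ Real.sin (Real.pi * x) :=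
  Real.sin_nonneg_of_nonneg_of_le_pi (mul_nonneg Real.pi_pos.le hx.1)
    (mul_le_of_le_one_right Real.pi_pos.le hx.2)

lemma sin_pi_pos {x : ℝ} (hx : x ∈ Ioo (0 : ℝ) 1) : 0 < Real.sin (Real.pi * x) :=
  Real.sin_pos_of_pos_of_lt_pi (mul_pos Real.pi_pos hx.1)
    (mul_lt_of_lt_one_right Real.pi_pos hx.2)

lemma cos_pi_injOn : InjOn (fun x : ℝ => Real.cos (Real.pi * x)) (Icc 0 1) := by
  intro x hx y hy h
  have := Real.injOn_cos ⟨mul_nonneg Real.pi_pos.le hx.1, mul_le_of_le_one_right Real.pi_pos.le hx.2⟩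
    ⟨mul_nonneg Real.pi_pos.le hy.1, mul_le_of_le_one_right Real.pi_pos.le hy.2⟩ h
  exact mul_left_cancel₀ Real.pi_ne_zero this

lemma cos_sub_cos_ne {x ξ : ℝ} (hx : x ∈ Icc (0 : ℝ) 1) (hξ : ξ ∈ Icc (0 : ℝ) 1) (h : ξ ≠ x) :
    Real.cos (Real.pi * x) - Real.cos (Real.pi * ξ) ≠ 0 := fun h0 =>
  h (cos_pi_injOn hξ hx (sub_eq_zero.1 h0).symm)

lemma abs_le_sin_half {t : ℝ} (ht : |t| ≤ 1) : |t| ≤ |Real.sin (Real.pi * t / 2)| := by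
  wlog h : 0 ≤ t generalizing t
  · have := this (t := -t) (by rwa [abs_neg]) (by linarith)
    rwa [abs_neg, show Real.pi * -t / 2 = -(Real.pi * t / 2) by ring, Real.sin_neg, abs_neg] at this
  rw [abs_of_nonneg h] at *
  have h1 := Real.mul_le_sin (x := Real.pi * t / 2) (by positivity)
    (by nlinarith [Real.pi_pos])
  refine le_trans (le_of_eq ?_) (h1.trans (le_abs_self _))
  field_simp

/-- Midpoint concavity of the sine on [0, π]. -/
lemma half_sin_add_le {x ξ : ℝ} (hx : x ∈ Icc (0 : ℝ) 1) (hξ : ξ ∈ Icc (0 : ℝ) 1) :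
    (Real.sin (Real.pi * x) + Real.sin (Real.pi * ξ)) / 2 ≤ Real.sin (Real.pi * (ξ + x) / 2) := by
  have hm : ∀ {y : ℝ}, y ∈ Icc (0 : ℝ) 1 → Real.pi * y ∈ Icc 0 Real.pi := fun hy =>
    ⟨mul_nonneg Real.pi_pos.le hy.1, mul_le_of_le_one_right Real.pi_pos.le hy.2⟩
  have := strictConcaveOn_sin_Icc.concaveOn.2 (hm hx) (hm hξ) (by norm_num : (0 : ℝ) ≤ 1 / 2)
    (by norm_num : (0 : ℝ) ≤ 1 / 2) (by norm_num)
  simp only [smul_eq_mul] at this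
  rw [show Real.pi * (ξ + x) / 2 = 1 / 2 * (Real.pi * x) + 1 / 2 * (Real.pi * ξ) by ring]
  linarith

lemma sin_mul_abs_sub_le {x ξ : ℝ} (hx : x ∈ Icc (0 : ℝ) 1) (hξ : ξ ∈ Icc (0 : ℝ) 1) :
    (Real.sin (Real.pi * x) + Real.sin (Real.pi * ξ)) * |x - ξ| ≤
      |Real.cos (Real.pi * x) - Real.cos (Real.pi * ξ)| := by
  have h1 := half_sin_add_le hx hξ
  have h2 : |ξ - x| ≤ |Real.sin (Real.pi * (ξ - x) / 2)| :=
    abs_le_sin_half (abs_le.2 ⟨by linarith [hx.2, hξ.1], by linarith [hx.1, hξ.2]⟩)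
  have h3 := sin_pi_nonneg hx
  have h4 := sin_pi_nonneg hξ
  rw [cos_sub_cos_pi, abs_mul, abs_mul, abs_two, abs_sub_comm x ξ]
  have h5 := le_abs_self (Real.sin (Real.pi * (ξ + x) / 2))
  calc _ ≤ (2 * |Real.sin (Real.pi * (ξ + x) / 2)|) * |ξ - x| :=
        mul_le_mul_of_nonneg_right (by linarith) (abs_nonneg _)
    _ ≤ _ := mul_le_mul_of_nonneg_left h2 (by positivity)

/-- The kernel degenerates at the endpoints only when both variables approach the same one. With the
sum of the two sines as weight, a lower bound at either variable suffices, and either sine alone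
restores the plain Cauchy singularity: the left one for sin · Tf, the right one for T(sin · f). -/
lemma sin_add_mul_abs_cosKernel_le {x ξ : ℝ} (hx : x ∈ Icc (0 : ℝ) 1) (hξ : ξ ∈ Icc (0 : ℝ) 1) :
    (Real.sin (Real.pi * x) + Real.sin (Real.pi * ξ)) * |cosKernel x ξ| ≤ |x - ξ|⁻¹ := by
  rcases eq_or_ne ξ x with rfl | h
  · simp [cosKernel_self]
  have h0 : 0 < |x - ξ| := abs_pos.2 (sub_ne_zero.2 h.symm)
  have h1 : 0 < |Real.cos (Real.pi * x) - Real.cos (Real.pi * ξ)| :=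
    abs_pos.2 (cos_sub_cos_ne hx hξ h)
  rw [cosKernel, abs_inv, ← div_eq_mul_inv, div_le_iff₀ h1, ← div_eq_inv_mul, le_div_iff₀ h0]
  exact sin_mul_abs_sub_le hx hξ

lemma sin_left_mul_abs_cosKernel_le {x ξ : ℝ} (hx : x ∈ Icc (0 : ℝ) 1) (hξ : ξ ∈ Icc (0 : ℝ) 1) :
    Real.sin (Real.pi * x) * |cosKernel x ξ| ≤ |x - ξ|⁻¹ :=
  (mul_le_mul_of_nonneg_right (by linarith [sin_pi_nonneg hξ]) (abs_nonneg _)).trans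
    (sin_add_mul_abs_cosKernel_le hx hξ)

lemma sin_right_mul_abs_cosKernel_le {x ξ : ℝ} (hx : x ∈ Icc (0 : ℝ) 1) (hξ : ξ ∈ Icc (0 : ℝ) 1) :
    Real.sin (Real.pi * ξ) * |cosKernel x ξ| ≤ |x - ξ|⁻¹ :=
  (mul_le_mul_of_nonneg_right (by linarith [sin_pi_nonneg hx]) (abs_nonneg _)).trans
    (sin_add_mul_abs_cosKernel_le hx hξ)

lemma exists_le_sin_pi {a b : ℝ} (ha : 0 < a) (hb : b < 1) :
    ∃ c : ℝ, 0 < c ∧ ∀ x ∈ Icc a b, c ≤ Real.sin (Real.pi * x) := by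
  rcases (Icc a b).eq_empty_or_nonempty with h | h
  · exact ⟨1, one_pos, by simp [h]⟩
  obtain ⟨y, hy, hm⟩ := isCompact_Icc.exists_isMinOn h
    (f := fun x => Real.sin (Real.pi * x)) (by fun_prop)
  exact ⟨_, sin_pi_pos ⟨ha.trans_le hy.1, hy.2.trans_lt hb⟩, fun x hx => hm hx⟩

lemma abs_cosKernel_le_of_le_sin {c x ξ : ℝ} (hc : 0 < c) (hx : x ∈ Icc (0 : ℝ) 1)
    (hξ : ξ ∈ Icc (0 : ℝ) 1) (h : c ≤ Real.sin (Real.pi * x) + Real.sin (Real.pi * ξ)) :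
    |cosKernel x ξ| ≤ c⁻¹ * |x - ξ|⁻¹ := by
  rw [← div_eq_inv_mul, le_div_iff₀' hc]
  exact (mul_le_mul_of_nonneg_right h (abs_nonneg _)).trans (sin_add_mul_abs_cosKernel_le hx hξ)

/-- Both sine factors of the denominator are at least ε, because |ξ - x| is at most ξ + x and at
most 2 - (ξ + x). The bound is therefore uniform up to the endpoints. -/
lemma abs_cosKernel_le_of_le_abs_sub {ε x ξ : ℝ} (hε : 0 < ε) (hx : x ∈ Icc (0 : ℝ) 1)
    (hξ : ξ ∈ Icc (0 : ℝ) 1) (h : ε ≤ |x - ξ|) : |cosKernel x ξ| ≤ (2 * ε ^ 2)⁻¹ := by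
  have h1 : ε ≤ |Real.sin (Real.pi * (ξ - x) / 2)| := by
    rw [abs_sub_comm] at h
    exact h.trans (abs_le_sin_half (abs_le.2 ⟨by linarith [hx.2, hξ.1], by linarith [hx.1, hξ.2]⟩))
  have h2 : ε ≤ |Real.sin (Real.pi * (ξ + x) / 2)| := by
    rcases le_total (ξ + x) 1 with h3 | h3
    · have := abs_le_sin_half (t := ξ + x)
        (abs_le.2 ⟨by linarith [hx.1, hξ.1], h3⟩)
      refine le_trans (h.trans ?_) this
      rw [abs_of_nonneg (by linarith [hx.1, hξ.1] : 0 ≤ ξ + x)]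
      exact abs_le.2 ⟨by linarith [hx.1], by linarith [hξ.1]⟩
    · have := abs_le_sin_half (t := 2 - (ξ + x))
        (abs_le.2 ⟨by linarith [hx.2, hξ.2], by linarith⟩)
      rw [show Real.pi * (2 - (ξ + x)) / 2 = Real.pi - Real.pi * (ξ + x) / 2 by ring,
        Real.sin_pi_sub] at this
      refine le_trans (h.trans ?_) this
      rw [abs_of_nonneg (by linarith [hx.2, hξ.2] : 0 ≤ 2 - (ξ + x))]
      exact abs_le.2 ⟨by linarith [hξ.2], by linarith [hx.2]⟩
  rw [cosKernel, abs_inv, cos_sub_cos_pi, abs_mul, abs_mul, abs_two]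
  have : 2 * ε ^ 2 = 2 * ε * ε := by ring
  rw [this]
  gcongr

/-- Addition formula for the sine at the two half-angles. This identity and `kernel_cot_add` turn
the two equations into sin · Tφ = f and T(sin · φ) = f. -/
lemma kernel_cot_sub {x ξ : ℝ} (hx : x ∈ Ioo (0 : ℝ) 1) (hξ : ξ ∈ Ioo (0 : ℝ) 1) (h : ξ ≠ x) :
    Real.cot (Real.pi * (ξ - x) / 2) - Real.cot (Real.pi * (ξ + x) / 2) =
      2 * (Real.sin (Real.pi * x) * cosKernel x ξ) := by
  have h0 := cos_sub_cos_ne (Ioo_subset_Icc_self hx) (Ioo_subset_Icc_self hξ) h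
  rw [cosKernel]
  rw [cos_sub_cos_pi] at *
  have ha : Real.sin (Real.pi * (ξ - x) / 2) ≠ 0 := right_ne_zero_of_mul h0
  have hb : Real.sin (Real.pi * (ξ + x) / 2) ≠ 0 := right_ne_zero_of_mul (left_ne_zero_of_mul h0)
  rw [Real.cot_eq_cos_div_sin, Real.cot_eq_cos_div_sin,
    show Real.pi * x = Real.pi * (ξ + x) / 2 - Real.pi * (ξ - x) / 2 by ring, Real.sin_sub]
  field_simp

lemma kernel_cot_add {x ξ : ℝ} (hx : x ∈ Ioo (0 : ℝ) 1) (hξ : ξ ∈ Ioo (0 : ℝ) 1) (h : ξ ≠ x) :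
    Real.cot (Real.pi * (ξ - x) / 2) + Real.cot (Real.pi * (ξ + x) / 2) =
      2 * (Real.sin (Real.pi * ξ) * cosKernel x ξ) := by
  have h0 := cos_sub_cos_ne (Ioo_subset_Icc_self hx) (Ioo_subset_Icc_self hξ) h
  rw [cosKernel]
  rw [cos_sub_cos_pi] at *
  have ha : Real.sin (Real.pi * (ξ - x) / 2) ≠ 0 := right_ne_zero_of_mul h0
  have hb : Real.sin (Real.pi * (ξ + x) / 2) ≠ 0 := right_ne_zero_of_mul (left_ne_zero_of_mul h0)
  rw [Real.cot_eq_cos_div_sin, Real.cot_eq_cos_div_sin,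
    show Real.pi * ξ = Real.pi * (ξ + x) / 2 + Real.pi * (ξ - x) / 2 by ring, Real.sin_add]
  field_simp

/-! ### Weakly singular integrals and truncated integrals of the kernel. -/

lemma intervalIntegral_abs_sub_rpow {r : ℝ} (hr : 0 < r) (x : ℝ) {ε : ℝ} (hε : 0 < ε) :
    IntervalIntegrable (fun ξ => |x - ξ| ^ (r - 1)) volume (x - ε) (x + ε) ∧
      ∫ ξ in (x - ε)..(x + ε), |x - ξ| ^ (r - 1) = 2 * ε ^ r / r := by
  have h0 : IntervalIntegrable (fun t : ℝ => t ^ (r - 1)) volume 0 ε :=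
    intervalIntegral.intervalIntegrable_rpow' (by linarith)
  have hv : ∫ t in (0 : ℝ)..ε, t ^ (r - 1) = ε ^ r / r := by
    rw [integral_rpow (Or.inl (by linarith))]
    simp [Real.zero_rpow hr.ne']
  have hl : EqOn (fun ξ => (x - ξ) ^ (r - 1)) (fun ξ => |x - ξ| ^ (r - 1)) (uIcc (x - ε) x) := by
    intro ξ hξ
    rw [uIcc_of_le (by linarith)] at hξ
    simp only
    rw [abs_of_nonneg (by linarith [hξ.2])]
  have hr' : EqOn (fun ξ => (ξ - x) ^ (r - 1)) (fun ξ => |x - ξ| ^ (r - 1)) (uIcc x (x + ε)) := by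
    intro ξ hξ
    rw [uIcc_of_le (by linarith)] at hξ
    simp only
    rw [abs_sub_comm, abs_of_nonneg (by linarith [hξ.1])]
  have i1 : IntervalIntegrable (fun ξ => |x - ξ| ^ (r - 1)) volume (x - ε) x := by
    have := (h0.comp_sub_left x).symm
    rw [sub_zero] at this
    exact this.congr (hl.mono uIoc_subset_uIcc)
  have i2 : IntervalIntegrable (fun ξ => |x - ξ| ^ (r - 1)) volume x (x + ε) := by
    have := h0.comp_sub_right x
    rw [zero_add, add_comm] at this
    exact this.congr (hr'.mono uIoc_subset_uIcc)
  refine ⟨i1.trans i2, ?_⟩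
  rw [← intervalIntegral.integral_add_adjacent_intervals i1 i2,
    ← intervalIntegral.integral_congr hl, ← intervalIntegral.integral_congr hr',
    intervalIntegral.integral_comp_sub_left (fun t => t ^ (r - 1)),
    intervalIntegral.integral_comp_sub_right (fun t => t ^ (r - 1))]
  simp only [sub_self, sub_sub_cancel, add_sub_cancel_left, hv]
  ring

lemma integrableOn_abs_sub_rpow_ball {r : ℝ} (hr : 0 < r) (x : ℝ) {ε : ℝ} (hε : 0 < ε) :
    IntegrableOn (fun ξ => |x - ξ| ^ (r - 1)) (Ioo (x - ε) (x + ε)) := by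
  have := (intervalIntegral_abs_sub_rpow hr x hε).1
  rw [intervalIntegrable_iff_integrableOn_Ioo_of_le (by linarith)] at this
  exact this

lemma setIntegral_abs_sub_rpow_ball {r : ℝ} (hr : 0 < r) (x : ℝ) {ε : ℝ} (hε : 0 < ε) :
    ∫ ξ in Ioo (x - ε) (x + ε), |x - ξ| ^ (r - 1) = 2 * ε ^ r / r := by
  rw [← (intervalIntegral_abs_sub_rpow hr x hε).2, intervalIntegral.integral_of_le (by linarith),
    integral_Ioc_eq_integral_Ioo]

lemma unitInterval_subset_ball {x : ℝ} (hx : x ∈ Icc (0 : ℝ) 1) :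
    Ioo (0 : ℝ) 1 ⊆ Ioo (x - 1) (x + 1) := fun _ h =>
  ⟨by linarith [hx.2, h.1], by linarith [hx.1, h.2]⟩

lemma integrableOn_abs_sub_rpow {r : ℝ} (hr : 0 < r) {x : ℝ} (hx : x ∈ Icc (0 : ℝ) 1) :
    IntegrableOn (fun ξ => |x - ξ| ^ (r - 1)) (Ioo 0 1) :=
  (integrableOn_abs_sub_rpow_ball hr x one_pos).mono_set (unitInterval_subset_ball hx)

lemma setIntegral_abs_sub_rpow_le {r : ℝ} (hr : 0 < r) {x : ℝ} (hx : x ∈ Icc (0 : ℝ) 1) :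
    ∫ ξ in Ioo (0 : ℝ) 1, |x - ξ| ^ (r - 1) ≤ 2 / r := by
  have := setIntegral_mono_set (integrableOn_abs_sub_rpow_ball hr x one_pos)
    (ae_of_all _ fun ξ => Real.rpow_nonneg (abs_nonneg (x - ξ)) _)
    (unitInterval_subset_ball hx).eventuallyLE
  rwa [setIntegral_abs_sub_rpow_ball hr x one_pos, Real.one_rpow, mul_one] at this

/-- The antiderivative is π⁻¹ log |sin|. As `Real.log` ignores signs, it is enough that the sine
does not vanish. -/
lemma integral_half_cot {p q c : ℝ}
    (h : ∀ ξ ∈ uIcc p q, Real.sin (Real.pi * (ξ + c) / 2) ≠ 0) :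
    IntervalIntegrable (fun ξ => 1 / 2 * Real.cot (Real.pi * (ξ + c) / 2)) volume p q ∧
    ∫ ξ in p..q, 1 / 2 * Real.cot (Real.pi * (ξ + c) / 2) =
      Real.pi⁻¹ * (Real.log (Real.sin (Real.pi * (q + c) / 2)) -
        Real.log (Real.sin (Real.pi * (p + c) / 2))) := by
  have hd : ∀ ξ ∈ uIcc p q, HasDerivAt
      (fun ξ => Real.pi⁻¹ * Real.log (Real.sin (Real.pi * (ξ + c) / 2)))
      (1 / 2 * Real.cot (Real.pi * (ξ + c) / 2)) ξ := by
    intro ξ hξ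
    have h1 : HasDerivAt (fun ξ : ℝ => Real.pi * (ξ + c) / 2) (Real.pi * 1 / 2) ξ :=
      (((hasDerivAt_id ξ).add_const c).const_mul Real.pi).div_const 2
    have h2 := ((h1.sin).log (h ξ hξ)).const_mul Real.pi⁻¹
    refine h2.congr_deriv ?_
    rw [Real.cot_eq_cos_div_sin]
    have := Real.pi_ne_zero
    field_simp
  have hi : IntervalIntegrable (fun ξ => 1 / 2 * Real.cot (Real.pi * (ξ + c) / 2)) volume p q := by
    apply ContinuousOn.intervalIntegrable
    simp only [Real.cot_eq_cos_div_sin]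
    exact continuousOn_const.mul (ContinuousOn.div (by fun_prop) (by fun_prop) h)
  refine ⟨hi, ?_⟩
  rw [intervalIntegral.integral_eq_sub_of_hasDerivAt hd hi]
  ring

lemma setIntegral_truncated {g : ℝ → ℝ} {x ε : ℝ} (hε : 0 < ε) (hx0 : ε < x) (hx1 : x + ε < 1)
    (h1 : IntervalIntegrable g volume 0 (x - ε)) (h2 : IntervalIntegrable g volume (x + ε) 1) :
    ∫ ξ in Ioo 0 1 \ Ioo (x - ε) (x + ε), g ξ =
      (∫ ξ in (0 : ℝ)..(x - ε), g ξ) + ∫ ξ in (x + ε)..1, g ξ := by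
  have hs : Ioo 0 1 \ Ioo (x - ε) (x + ε) = Ioc 0 (x - ε) ∪ Ico (x + ε) 1 := by
    ext ξ
    simp only [Set.mem_sdiff, mem_Ioo, mem_union, mem_Ioc, mem_Ico, not_and, not_lt]
    constructor
    · rintro ⟨⟨ha, hb⟩, hc⟩
      rcases le_or_gt ξ (x - ε) with h | h
      · exact Or.inl ⟨ha, h⟩
      · exact Or.inr ⟨hc h, hb⟩
    · rintro (⟨ha, hb⟩ | ⟨ha, hb⟩)
      · exact ⟨⟨ha, by linarith⟩, fun h => absurd h (by linarith)⟩
      · exact ⟨⟨by linarith, hb⟩, fun _ => ha⟩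
  rw [intervalIntegrable_iff_integrableOn_Ioc_of_le (by linarith)] at h1
  rw [intervalIntegrable_iff_integrableOn_Ico_of_le (by linarith)] at h2
  rw [hs, setIntegral_union _ measurableSet_Ico h1 h2,
    intervalIntegral.integral_of_le (by linarith), intervalIntegral.integral_of_le (by linarith),
    integral_Ico_eq_integral_Ioo, integral_Ioc_eq_integral_Ioo (x := x + ε)]
  rw [Set.disjoint_left]
  rintro ξ ⟨_, h⟩ ⟨h', _⟩
  linarith

lemma sin_half_ne_zero {t : ℝ} (h0 : 0 < t) (h2 : t < 2) : Real.sin (Real.pi * t / 2) ≠ 0 :=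
  (Real.sin_pos_of_pos_of_lt_pi (by positivity) (by nlinarith [Real.pi_pos])).ne'

lemma sin_half_ne_zero_of_neg {t : ℝ} (h0 : t < 0) (h2 : -2 < t) :
    Real.sin (Real.pi * t / 2) ≠ 0 := by
  have := sin_half_ne_zero (t := -t) (by linarith) (by linarith)
  rwa [show Real.pi * -t / 2 = -(Real.pi * t / 2) by ring, Real.sin_neg, neg_ne_zero] at this

/-- The truncated integral of the kernel, in closed form. -/
lemma truncated_integral_cosKernel {x ε : ℝ} (hε : 0 < ε) (hx0 : ε < x) (hx1 : x + ε < 1) :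
    Real.sin (Real.pi * x) * ∫ ξ in Ioo 0 1 \ Ioo (x - ε) (x + ε), cosKernel x ξ =
      Real.pi⁻¹ * (Real.log (Real.sin (Real.pi * (x + ε / 2))) -
        Real.log (Real.sin (Real.pi * (x - ε / 2)))) := by
  have hx : x ∈ Ioo (0 : ℝ) 1 := ⟨by linarith, by linarith⟩
  have a1 := integral_half_cot (p := 0) (q := x - ε) (c := -x) (fun ξ hξ => by
    rw [uIcc_of_le (by linarith)] at hξ
    exact sin_half_ne_zero_of_neg (by linarith [hξ.2]) (by linarith [hξ.1]))
  have a2 := integral_half_cot (p := x + ε) (q := 1) (c := -x) (fun ξ hξ => by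
    rw [uIcc_of_le (by linarith)] at hξ
    exact sin_half_ne_zero (by linarith [hξ.1]) (by linarith [hξ.2]))
  have b1 := integral_half_cot (p := 0) (q := x - ε) (c := x) (fun ξ hξ => by
    rw [uIcc_of_le (by linarith)] at hξ
    exact sin_half_ne_zero (by linarith [hξ.1]) (by linarith [hξ.2]))
  have b2 := integral_half_cot (p := x + ε) (q := 1) (c := x) (fun ξ hξ => by
    rw [uIcc_of_le (by linarith)] at hξ
    exact sin_half_ne_zero (by linarith [hξ.1]) (by linarith [hξ.2]))
  have hcongr : ∫ ξ in Ioo 0 1 \ Ioo (x - ε) (x + ε), Real.sin (Real.pi * x) * cosKernel x ξ =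
      ∫ ξ in Ioo 0 1 \ Ioo (x - ε) (x + ε), (1 / 2 * Real.cot (Real.pi * (ξ + -x) / 2) -
        1 / 2 * Real.cot (Real.pi * (ξ + x) / 2)) := by
    refine setIntegral_congr_fun (measurableSet_Ioo.diff measurableSet_Ioo) fun ξ hξ => ?_
    have hne : ξ ≠ x := by
      rintro rfl
      exact hξ.2 ⟨by linarith, by linarith⟩
    have := kernel_cot_sub hx hξ.1 hne
    simp only [← sub_eq_add_neg]
    linarith
  rw [← integral_const_mul, hcongr,
    setIntegral_truncated hε hx0 hx1 (a1.1.sub b1.1) (a2.1.sub b2.1),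
    intervalIntegral.integral_sub a1.1 b1.1, intervalIntegral.integral_sub a2.1 b2.1,
    a1.2, a2.2, b1.2, b2.2]
  -- `Real.log` is even, so the divergent boundary terms at x - ε and x + ε cancel exactly, as do
  -- the terms at 0 and at 1. Only the regular terms at x ± ε/2 remain.
  have e1 : Real.log (Real.sin (Real.pi * (x - ε + -x) / 2)) =
      Real.log (Real.sin (Real.pi * (x + ε + -x) / 2)) := by
    rw [show Real.pi * (x - ε + -x) / 2 = -(Real.pi * (x + ε + -x) / 2) by ring, Real.sin_neg,
      Real.log_neg_eq_log]
  have e2 : Real.log (Real.sin (Real.pi * (0 + -x) / 2)) =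
      Real.log (Real.sin (Real.pi * (0 + x) / 2)) := by
    rw [show Real.pi * (0 + -x) / 2 = -(Real.pi * (0 + x) / 2) by ring, Real.sin_neg,
      Real.log_neg_eq_log]
  have e3 : Real.sin (Real.pi * (1 + -x) / 2) = Real.sin (Real.pi * (1 + x) / 2) := by
    rw [show Real.pi * (1 + -x) / 2 = Real.pi - Real.pi * (1 + x) / 2 by ring, Real.sin_pi_sub]
  rw [e1, e2, e3, show Real.pi * (x - ε + x) / 2 = Real.pi * (x - ε / 2) by ring,
    show Real.pi * (x + ε + x) / 2 = Real.pi * (x + ε / 2) by ring]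
  ring

/-- The vanishing of this principal value is what lets `pvTransform` subtract u(x) without a
correction term. -/
lemma tendsto_truncated_integral_cosKernel {x : ℝ} (hx : x ∈ Ioo (0 : ℝ) 1) :
    Tendsto (fun ε => ∫ ξ in Ioo 0 1 \ Ioo (x - ε) (x + ε), cosKernel x ξ) (𝓝[>] 0) (𝓝 0) := by
  have hs := (sin_pi_pos hx).ne'
  have hc : Tendsto (fun ε : ℝ => (Real.sin (Real.pi * x))⁻¹ *
      (Real.pi⁻¹ * (Real.log (Real.sin (Real.pi * (x + ε / 2))) -
        Real.log (Real.sin (Real.pi * (x - ε / 2)))))) (𝓝 0) (𝓝 0) := by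
    have h1 : ContinuousAt (fun ε : ℝ => Real.log (Real.sin (Real.pi * (x + ε / 2)))) 0 :=
      ContinuousAt.log (by fun_prop) (by simpa using hs)
    have h2 : ContinuousAt (fun ε : ℝ => Real.log (Real.sin (Real.pi * (x - ε / 2)))) 0 :=
      ContinuousAt.log (by fun_prop) (by simpa using hs)
    have h3 := ((h1.sub h2).const_mul Real.pi⁻¹).const_mul (Real.sin (Real.pi * x))⁻¹
    have h4 := h3.tendsto
    simpa using h4
  refine (hc.mono_left nhdsWithin_le_nhds).congr' ?_
  filter_upwards [Ioo_mem_nhdsGT (lt_min hx.1 (sub_pos.2 hx.2))] with ε hε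
  rw [← truncated_integral_cosKernel hε.1 (hε.2.trans_le (min_le_left _ _))
    (by linarith [hε.2.trans_le (min_le_right _ _)]), inv_mul_cancel_left₀ hs]

lemma exists_truncated_integral_cosKernel_le {a b : ℝ} (ha : 0 < a) (hb : b < 1) :
    ∃ C ε₀ : ℝ, 0 < ε₀ ∧ ∀ x ∈ Icc a b, ∀ ε ∈ Ioo 0 ε₀,
      |∫ ξ in Ioo 0 1 \ Ioo (x - ε) (x + ε), cosKernel x ξ| ≤ C := by
  obtain ⟨c, hc, hle⟩ := exists_le_sin_pi (a := a / 2) (b := (1 + b) / 2) (by linarith)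
    (by linarith)
  -- For ε below this threshold the points x ± ε/2 stay in [a/2, (1+b)/2], where the sine is at
  -- least c, so each logarithm is at most |log c| in absolute value.
  refine ⟨c⁻¹ * (Real.pi⁻¹ * (2 * |Real.log c|)), min a (1 - b), lt_min ha (by linarith), ?_⟩
  intro x hx ε hε
  have h1 := hε.2.trans_le (min_le_left _ _)
  have h2 := hε.2.trans_le (min_le_right _ _)
  have hε0 := hε.1
  have hlog : ∀ y ∈ Icc (a / 2) ((1 + b) / 2),
      |Real.log (Real.sin (Real.pi * y))| ≤ |Real.log c| := by
    intro y hy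
    have := hle y hy
    have h1 : Real.log (Real.sin (Real.pi * y)) ≤ 0 :=
      Real.log_nonpos (hc.le.trans this) (Real.sin_le_one _)
    rw [abs_of_nonpos h1]
    have h2 := Real.log_le_log hc this
    have := neg_le_abs (Real.log c)
    linarith
  have hsx : c ≤ Real.sin (Real.pi * x) := hle x ⟨by linarith [hx.1], by linarith [hx.2]⟩
  have hk := truncated_integral_cosKernel hε0 (x := x) (by linarith [hx.1]) (by linarith [hx.2])
  have l1 := hlog (x + ε / 2) ⟨by linarith [hx.1], by linarith [hx.2]⟩
  have l2 := hlog (x - ε / 2) ⟨by linarith [hx.1], by linarith [hx.2]⟩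
  set I := ∫ ξ in Ioo 0 1 \ Ioo (x - ε) (x + ε), cosKernel x ξ
  have h3 : c * |I| ≤ Real.pi⁻¹ * (2 * |Real.log c|) := by
    calc c * |I| ≤ |Real.sin (Real.pi * x) * I| := by
          rw [abs_mul]
          exact mul_le_mul_of_nonneg_right (hsx.trans (le_abs_self _)) (abs_nonneg _)
      _ ≤ _ := by
          rw [hk, abs_mul, abs_of_pos (inv_pos.2 Real.pi_pos)]
          refine mul_le_mul_of_nonneg_left ?_ (inv_pos.2 Real.pi_pos).le
          refine (abs_sub _ _).trans ?_
          linarith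
  rw [← div_eq_inv_mul, le_div_iff₀' hc]
  exact h3

/-! ### Calculus of the Hölder classes. -/

/-- Hölder condition with constant `C` and exponent `r`, in terms of absolute values. -/
def HolderIneq (C r : ℝ) (φ : ℝ → ℝ) (s : Set ℝ) : Prop :=
  ∀ x ∈ s, ∀ y ∈ s, |φ x - φ y| ≤ C * |x - y| ^ r

lemma holderOnWith_iff_holderIneq {K r : NNReal} {φ : ℝ → ℝ} {s : Set ℝ} :
    HolderOnWith K r φ s ↔ HolderIneq K r φ s := by
  unfold HolderOnWith HolderIneq
  refine forall₂_congr fun x _ => forall₂_congr fun y _ => ?_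
  have h : (K : ENNReal) * edist x y ^ (r : ℝ) = ENNReal.ofReal (K * |x - y| ^ (r : ℝ)) := by
    rw [edist_dist, Real.dist_eq, ENNReal.ofReal_rpow_of_nonneg (abs_nonneg _) r.coe_nonneg,
      ← ENNReal.ofReal_coe_nnreal (p := K), ← ENNReal.ofReal_mul K.coe_nonneg]
  rw [h, edist_dist, Real.dist_eq, ENNReal.ofReal_le_ofReal_iff]
  exact mul_nonneg K.2 (Real.rpow_nonneg (abs_nonneg _) _)

/-- Distances in [0, 1] are at most 1. This brings two functions to a common exponent and allows the
exponent to be assumed at most 1. -/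
lemma HolderIneq.of_exponent_le {C r r' : ℝ} {φ : ℝ → ℝ} {s : Set ℝ} (h : HolderIneq C r φ s)
    (hs : s ⊆ Icc 0 1) (hC : 0 ≤ C) (hr : r' ≤ r) : HolderIneq C r' φ s := by
  intro x hx y hy
  rcases eq_or_ne x y with rfl | hne
  · simpa using mul_nonneg hC (Real.rpow_nonneg le_rfl _)
  refine (h x hx y hy).trans (mul_le_mul_of_nonneg_left ?_ hC)
  refine Real.rpow_le_rpow_of_exponent_ge (abs_pos.2 (sub_ne_zero.2 hne)) ?_ hr
  exact abs_le.2 ⟨by linarith [(hs hx).1, (hs hy).2], by linarith [(hs hx).2, (hs hy).1]⟩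

lemma HolderIneq.mono {C C' r : ℝ} {φ : ℝ → ℝ} {s t : Set ℝ} (h : HolderIneq C r φ s)
    (hC : C ≤ C') (hs : t ⊆ s) : HolderIneq C' r φ t := fun x hx y hy =>
  (h x (hs hx) y (hs hy)).trans
    (mul_le_mul_of_nonneg_right hC (Real.rpow_nonneg (abs_nonneg _) _))

lemma HolderIneq.continuousOn {C r : ℝ} {φ : ℝ → ℝ} {s : Set ℝ} (h : HolderIneq C r φ s)
    (hC : 0 ≤ C) (hr : 0 < r) : ContinuousOn φ s := by
  have := (holderOnWith_iff_holderIneq (K := ⟨C, hC⟩) (r := ⟨r, hr.le⟩)).2 h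
  exact this.continuousOn hr

lemma exists_holderIneq_of_holderOnWith {φ : ℝ → ℝ} {s : Set ℝ} (hs : s ⊆ Icc 0 1) :
    (∃ K r : NNReal, 0 < r ∧ HolderOnWith K r φ s) ↔
      ∃ C r : ℝ, 0 ≤ C ∧ 0 < r ∧ r ≤ 1 ∧ HolderIneq C r φ s := by
  constructor
  · rintro ⟨K, r, hr, h⟩
    exact ⟨K, min r 1, K.2, lt_min hr one_pos, min_le_right _ _,
      (holderOnWith_iff_holderIneq.1 h).of_exponent_le hs K.2 (min_le_left _ _)⟩
  · rintro ⟨C, r, hC, hr, -, h⟩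
    exact ⟨⟨C, hC⟩, ⟨r, hr.le⟩, hr, holderOnWith_iff_holderIneq.2 h⟩

lemma Icc_subset_unit {a b : ℝ} (ha : 0 < a) (hb : b < 1) : Icc a b ⊆ Icc 0 1 :=
  Icc_subset_Icc ha.le hb.le

lemma holderOpen_iff {φ : ℝ → ℝ} : HolderOpen φ ↔ ∀ a b : ℝ, 0 < a → b < 1 →
    ∃ C r : ℝ, 0 ≤ C ∧ 0 < r ∧ r ≤ 1 ∧ HolderIneq C r φ (Icc a b) :=
  forall₂_congr fun _ _ => forall₂_congr fun ha hb =>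
    exists_holderIneq_of_holderOnWith (Icc_subset_unit ha hb)

lemma holderClosed_iff {f : ℝ → ℝ} : HolderClosed f ↔
    ∃ C r : ℝ, 0 ≤ C ∧ 0 < r ∧ r ≤ 1 ∧ HolderIneq C r f (Icc 0 1) :=
  exists_holderIneq_of_holderOnWith Subset.rfl

lemma HolderClosed.holderOpen {f : ℝ → ℝ} (h : HolderClosed f) : HolderOpen f := by
  rw [holderClosed_iff] at h
  obtain ⟨C, r, hC, hr, hr1, h⟩ := h
  exact holderOpen_iff.2 fun a b ha hb => ⟨C, r, hC, hr, hr1, h.mono le_rfl (Icc_subset_unit ha hb)⟩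

lemma HolderClosed.continuousOn {f : ℝ → ℝ} (h : HolderClosed f) : ContinuousOn f (Icc 0 1) := by
  obtain ⟨K, r, hr, h⟩ := h
  exact h.continuousOn hr

lemma HolderClosed.integrableOn {f : ℝ → ℝ} (h : HolderClosed f) : IntegrableOn f (Ioo 0 1) :=
  h.continuousOn.integrableOn_Icc.mono_set Ioo_subset_Icc_self

lemma HolderOpen.continuousOn {f : ℝ → ℝ} (h : HolderOpen f) : ContinuousOn f (Ioo 0 1) := by
  intro x hx
  obtain ⟨K, r, hr, h⟩ := h (x / 2) ((1 + x) / 2) (by linarith [hx.1]) (by linarith [hx.2])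
  exact ((h.continuousOn hr).continuousAt
    (Icc_mem_nhds (by linarith [hx.1]) (by linarith [hx.2]))).continuousWithinAt

lemma HolderIneq.add {C D r : ℝ} {φ ψ : ℝ → ℝ} {s : Set ℝ} (h : HolderIneq C r φ s)
    (h' : HolderIneq D r ψ s) : HolderIneq (C + D) r (fun x => φ x + ψ x) s := by
  intro x hx y hy
  have e : φ x + ψ x - (φ y + ψ y) = (φ x - φ y) + (ψ x - ψ y) := by ring
  simp only [e]
  refine (abs_add_le _ _).trans ?_
  rw [add_mul]
  exact add_le_add (h x hx y hy) (h' x hx y hy)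

lemma HolderIneq.mul {C D M N r : ℝ} {φ ψ : ℝ → ℝ} {s : Set ℝ} (h : HolderIneq C r φ s)
    (h' : HolderIneq D r ψ s) (hM : ∀ x ∈ s, |φ x| ≤ M) (hN : ∀ x ∈ s, |ψ x| ≤ N) :
    HolderIneq (M * D + N * C) r (fun x => φ x * ψ x) s := by
  intro x hx y hy
  have e : φ x * ψ x - φ y * ψ y = φ x * (ψ x - ψ y) + ψ y * (φ x - φ y) := by ring
  simp only [e]
  refine (abs_add_le _ _).trans ?_
  rw [add_mul, abs_mul, abs_mul, mul_assoc, mul_assoc]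
  exact add_le_add
    (mul_le_mul (hM x hx) (h' x hx y hy) (abs_nonneg _) ((abs_nonneg _).trans (hM x hx)))
    (mul_le_mul (hN y hy) (h x hx y hy) (abs_nonneg _) ((abs_nonneg _).trans (hN y hy)))

lemma exists_holder_mul {φ ψ : ℝ → ℝ} {a b : ℝ} (hs : Icc a b ⊆ Icc 0 1)
    (h1 : ∃ C r : ℝ, 0 ≤ C ∧ 0 < r ∧ r ≤ 1 ∧ HolderIneq C r φ (Icc a b))
    (h2 : ∃ C r : ℝ, 0 ≤ C ∧ 0 < r ∧ r ≤ 1 ∧ HolderIneq C r ψ (Icc a b)) :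
    ∃ C r : ℝ, 0 ≤ C ∧ 0 < r ∧ r ≤ 1 ∧ HolderIneq C r (fun x => φ x * ψ x) (Icc a b) := by
  obtain ⟨C, r, hC, hr, hr1, h⟩ := h1
  obtain ⟨D, r', hD, hr', hr1', h'⟩ := h2
  obtain ⟨M, hM⟩ := isCompact_Icc.exists_bound_of_continuousOn (h.continuousOn hC hr)
  obtain ⟨N, hN⟩ := isCompact_Icc.exists_bound_of_continuousOn (h'.continuousOn hD hr')
  refine ⟨|M| * D + |N| * C, min r r', by positivity, lt_min hr hr', (min_le_left _ _).trans hr1,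
    HolderIneq.mul (h.of_exponent_le hs hC (min_le_left _ _))
      (h'.of_exponent_le hs hD (min_le_right _ _)) (fun x hx => (hM x hx).trans (le_abs_self _))
      (fun x hx => (hN x hx).trans (le_abs_self _))⟩

lemma exists_holder_add {φ ψ : ℝ → ℝ} {a b : ℝ} (hs : Icc a b ⊆ Icc 0 1)
    (h1 : ∃ C r : ℝ, 0 ≤ C ∧ 0 < r ∧ r ≤ 1 ∧ HolderIneq C r φ (Icc a b))
    (h2 : ∃ C r : ℝ, 0 ≤ C ∧ 0 < r ∧ r ≤ 1 ∧ HolderIneq C r ψ (Icc a b)) :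
    ∃ C r : ℝ, 0 ≤ C ∧ 0 < r ∧ r ≤ 1 ∧ HolderIneq C r (fun x => φ x + ψ x) (Icc a b) := by
  obtain ⟨C, r, hC, hr, hr1, h⟩ := h1
  obtain ⟨D, r', hD, hr', hr1', h'⟩ := h2
  exact ⟨C + D, min r r', by positivity, lt_min hr hr', (min_le_left _ _).trans hr1,
    HolderIneq.add (h.of_exponent_le hs hC (min_le_left _ _))
      (h'.of_exponent_le hs hD (min_le_right _ _))⟩

lemma HolderOpen.mul {φ ψ : ℝ → ℝ} (h : HolderOpen φ) (h' : HolderOpen ψ) :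
    HolderOpen (fun x => φ x * ψ x) :=
  holderOpen_iff.2 fun a b ha hb => exists_holder_mul (Icc_subset_unit ha hb)
    (holderOpen_iff.1 h a b ha hb) (holderOpen_iff.1 h' a b ha hb)

lemma HolderOpen.add {φ ψ : ℝ → ℝ} (h : HolderOpen φ) (h' : HolderOpen ψ) :
    HolderOpen (fun x => φ x + ψ x) :=
  holderOpen_iff.2 fun a b ha hb => exists_holder_add (Icc_subset_unit ha hb)
    (holderOpen_iff.1 h a b ha hb) (holderOpen_iff.1 h' a b ha hb)

lemma HolderClosed.mul {φ ψ : ℝ → ℝ} (h : HolderClosed φ) (h' : HolderClosed ψ) :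
    HolderClosed (fun x => φ x * ψ x) :=
  holderClosed_iff.2 (exists_holder_mul Subset.rfl (holderClosed_iff.1 h) (holderClosed_iff.1 h'))

lemma holderClosed_const (c : ℝ) : HolderClosed (fun _ => c) :=
  holderClosed_iff.2 ⟨0, 1, le_rfl, one_pos, le_rfl, fun x _ y _ => by simp⟩

lemma holderClosed_sin : HolderClosed (fun x => Real.sin (Real.pi * x)) := by
  refine holderClosed_iff.2 ⟨Real.pi, 1, Real.pi_pos.le, one_pos, le_rfl, fun x _ y _ => ?_⟩
  have := Real.lipschitzWith_sin.dist_le_mul (Real.pi * x) (Real.pi * y)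
  simp only [Real.dist_eq, ← mul_sub, abs_mul, NNReal.coe_one, one_mul,
    abs_of_pos Real.pi_pos] at this
  simpa using this

lemma HolderOpen.congr {φ ψ : ℝ → ℝ} (h : HolderOpen φ) (he : EqOn ψ φ (Ioo 0 1)) :
    HolderOpen ψ := by
  intro a b ha hb
  obtain ⟨K, r, hr, h⟩ := h a b ha hb
  refine ⟨K, r, hr, fun x hx y hy => ?_⟩
  rw [he ⟨ha.trans_le hx.1, hx.2.trans_lt hb⟩, he ⟨ha.trans_le hy.1, hy.2.trans_lt hb⟩]
  exact h x hx y hy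

/-! ### The principal value as a regularised integral. -/

lemma inv_abs_mul_rpow_le (t r : ℝ) : |t|⁻¹ * |t| ^ r ≤ |t| ^ (r - 1) := by
  rcases eq_or_ne t 0 with rfl | h
  · simpa using Real.rpow_nonneg le_rfl _
  · rw [Real.rpow_sub_one (abs_ne_zero.2 h), div_eq_inv_mul]

lemma abs_cosKernel_mul_le {c C r x ξ d : ℝ} (hc : 0 < c) (hC : 0 ≤ C) (hx : x ∈ Icc (0 : ℝ) 1)
    (hξ : ξ ∈ Icc (0 : ℝ) 1) (h : c ≤ Real.sin (Real.pi * x) + Real.sin (Real.pi * ξ))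
    (hd : |d| ≤ C * |x - ξ| ^ r) : |cosKernel x ξ * d| ≤ c⁻¹ * C * |x - ξ| ^ (r - 1) := by
  rw [abs_mul]
  calc _ ≤ (c⁻¹ * |x - ξ|⁻¹) * (C * |x - ξ| ^ r) :=
        mul_le_mul (abs_cosKernel_le_of_le_sin hc hx hξ h) hd (abs_nonneg _) (by positivity)
    _ = c⁻¹ * C * (|x - ξ|⁻¹ * |x - ξ| ^ r) := by ring
    _ ≤ _ := mul_le_mul_of_nonneg_left (inv_abs_mul_rpow_le _ _) (by positivity)

lemma le_abs_sub_of_notMem_ball {x ξ ε : ℝ} (h : ξ ∉ Ioo (x - ε) (x + ε)) : ε ≤ |x - ξ| := by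
  by_contra! hlt
  rw [abs_lt] at hlt
  exact h ⟨by linarith, by linarith⟩

lemma measurableSet_truncated (x ε : ℝ) :
    MeasurableSet (Ioo (0 : ℝ) 1 \ Ioo (x - ε) (x + ε)) := measurableSet_Ioo.diff measurableSet_Ioo

lemma integrableOn_truncated {u : ℝ → ℝ} (hu : IntegrableOn u (Ioo 0 1)) {x ε : ℝ}
    (hx : x ∈ Icc (0 : ℝ) 1) (hε : 0 < ε) :
    IntegrableOn (fun ξ => cosKernel x ξ * u ξ) (Ioo 0 1 \ Ioo (x - ε) (x + ε)) := by
  refine Integrable.bdd_mul (c := (2 * ε ^ 2)⁻¹) (hu.mono_set sdiff_subset)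
    (measurable_cosKernel_right x).aestronglyMeasurable ?_
  refine (ae_restrict_iff' (measurableSet_truncated x ε)).2 (ae_of_all _ fun ξ hξ => ?_)
  exact abs_cosKernel_le_of_le_abs_sub hε hx (Ioo_subset_Icc_self hξ.1)
    (le_abs_sub_of_notMem_ball hξ.2)

lemma integrableOn_unit_const (c : ℝ) : IntegrableOn (fun _ : ℝ => c) (Ioo (0 : ℝ) 1) := by
  simp

/-- Near x the Hölder condition weakens the pole to |x - ξ| ^ (r - 1); away from x the kernel is
bounded and u is integrable. -/
lemma integrableOn_pvTransform {u : ℝ → ℝ} (hu : HolderOpen u) (hi : IntegrableOn u (Ioo 0 1))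
    {x : ℝ} (hx : x ∈ Ioo (0 : ℝ) 1) :
    IntegrableOn (fun ξ => cosKernel x ξ * (u ξ - u x)) (Ioo 0 1) := by
  obtain ⟨c, hc, hcs⟩ := exists_le_sin_pi (a := x / 2) (b := (1 + x) / 2) (by linarith [hx.1])
    (by linarith [hx.2])
  obtain ⟨C, r, hC, hr, -, h⟩ := holderOpen_iff.1 hu (x / 2) ((1 + x) / 2) (by linarith [hx.1])
    (by linarith [hx.2])
  set δ := min (x / 2) ((1 - x) / 2) with hδ
  have hδ0 : 0 < δ := lt_min (by linarith [hx.1]) (by linarith [hx.2])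
  have hδ1 : δ ≤ x / 2 := min_le_left _ _
  have hδ2 : δ ≤ (1 - x) / 2 := min_le_right _ _
  have hxi : x ∈ Icc (x / 2) ((1 + x) / 2) := ⟨by linarith [hx.1], by linarith [hx.2]⟩
  have hd : IntegrableOn (fun ξ => u ξ - u x) (Ioo 0 1) := hi.sub (integrableOn_unit_const _)
  have h1 : IntegrableOn (fun ξ => cosKernel x ξ * (u ξ - u x)) (Ioo (x - δ) (x + δ)) := by
    have hsub : Ioo (x - δ) (x + δ) ⊆ Ioo 0 1 := fun ξ hξ =>
      ⟨by linarith [hξ.1, hx.1], by linarith [hξ.2, hx.2]⟩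
    refine Integrable.mono' ((integrableOn_abs_sub_rpow_ball hr x hδ0).const_mul (c⁻¹ * C))
      (((measurable_cosKernel_right x).aestronglyMeasurable).mul (hd.mono_set hsub).1) ?_
    refine (ae_restrict_iff' measurableSet_Ioo).2 (ae_of_all _ fun ξ hξ => ?_)
    have hξi : ξ ∈ Icc (x / 2) ((1 + x) / 2) := ⟨by linarith [hξ.1], by linarith [hξ.2]⟩
    refine abs_cosKernel_mul_le hc hC (Ioo_subset_Icc_self hx) (Ioo_subset_Icc_self (hsub hξ)) ?_ ?_
    · have := sin_pi_nonneg (Ioo_subset_Icc_self (hsub hξ))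
      linarith [hcs x hxi]
    · rw [abs_sub_comm]
      exact h x hxi ξ hξi
  refine (h1.union (integrableOn_truncated hd (Ioo_subset_Icc_self hx) hδ0)).mono_set fun ξ hξ => ?_
  by_cases hm : ξ ∈ Ioo (x - δ) (x + δ)
  · exact Or.inl hm
  · exact Or.inr ⟨hξ, hm⟩

lemma tendsto_setIntegral_truncated {h : ℝ → ℝ} (hh : IntegrableOn h (Ioo 0 1)) (x : ℝ) :
    Tendsto (fun ε => ∫ ξ in Ioo 0 1 \ Ioo (x - ε) (x + ε), h ξ) (𝓝[>] 0)
      (𝓝 (∫ ξ in Ioo 0 1, h ξ)) := by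
  have heq : ∀ ε : ℝ, ∫ ξ in Ioo 0 1 \ Ioo (x - ε) (x + ε), h ξ =
      ∫ ξ in Ioo 0 1, (Ioo (x - ε) (x + ε))ᶜ.indicator h ξ := fun ε => by
    rw [setIntegral_indicator measurableSet_Ioo.compl, Set.sdiff_eq]
  simp only [heq]
  refine tendsto_integral_filter_of_dominated_convergence (fun ξ => ‖h ξ‖)
    (Eventually.of_forall fun ε => hh.1.indicator measurableSet_Ioo.compl)
    (Eventually.of_forall fun ε => ae_of_all _ fun ξ => norm_indicator_le_norm_self _ _) hh.norm ?_
  have hne : ∀ᵐ ξ ∂(volume.restrict (Ioo (0 : ℝ) 1)), ξ ≠ x :=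
    ae_restrict_of_ae (measure_singleton x |> compl_mem_ae_iff.2)
  filter_upwards [hne] with ξ hξ
  refine tendsto_const_nhds.congr' ?_
  filter_upwards [Ioo_mem_nhdsGT (abs_pos.2 (sub_ne_zero.2 hξ))] with ε hε
  rw [indicator_of_mem]
  intro hm
  have : |ξ - x| < ε := abs_lt.2 ⟨by linarith [hm.1], by linarith [hm.2]⟩
  linarith [hε.2]

theorem hasPrincipalValue_cosKernel_mul {u : ℝ → ℝ} (hu : HolderOpen u)
    (hi : IntegrableOn u (Ioo 0 1)) {x : ℝ} (hx : x ∈ Ioo (0 : ℝ) 1) :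
    HasPrincipalValue (fun ξ => cosKernel x ξ * u ξ) x (pvTransform u x) := by
  have hx' := Ioo_subset_Icc_self hx
  refine ⟨fun ε hε => integrableOn_truncated hi hx' hε, ?_⟩
  have h1 := tendsto_setIntegral_truncated (integrableOn_pvTransform hu hi hx) x
  -- Split u(ξ) = (u(ξ) - u(x)) + u(x): the constant part contributes nothing in the limit.
  have h2 := (tendsto_truncated_integral_cosKernel hx).const_mul (u x)
  have h3 := h1.add h2
  rw [mul_zero, add_zero] at h3
  refine h3.congr' ?_
  filter_upwards [self_mem_nhdsWithin] with ε hε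
  have i1 : IntegrableOn (fun ξ => cosKernel x ξ * (u ξ - u x)) (Ioo 0 1 \ Ioo (x - ε) (x + ε)) :=
    integrableOn_truncated (hi.sub (integrableOn_unit_const (u x))) hx' hε
  have i2 := integrableOn_truncated (integrableOn_unit_const (u x)) hx' hε
  have : u x * ∫ ξ in Ioo 0 1 \ Ioo (x - ε) (x + ε), cosKernel x ξ =
      ∫ ξ in Ioo 0 1 \ Ioo (x - ε) (x + ε), cosKernel x ξ * u x := by
    rw [integral_mul_const, mul_comm]
  rw [this, ← integral_add i1 i2]
  refine integral_congr_ae (ae_of_all _ fun ξ => ?_)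
  simp only
  ring

/-! ### Interior Hölder continuity of the transform. -/

lemma abs_cos_pi_sub_le (x y : ℝ) :
    |Real.cos (Real.pi * x) - Real.cos (Real.pi * y)| ≤ Real.pi * |x - y| := by
  have := Real.lipschitzWith_cos.dist_le_mul (Real.pi * x) (Real.pi * y)
  simpa only [Real.dist_eq, ← mul_sub, abs_mul, NNReal.coe_one, one_mul,
    abs_of_pos Real.pi_pos] using this

lemma abs_cosKernel_sub_le {ε x y ξ : ℝ} (hε : 0 < ε) (hx : x ∈ Icc (0 : ℝ) 1)
    (hy : y ∈ Icc (0 : ℝ) 1) (hξ : ξ ∈ Icc (0 : ℝ) 1) (hxξ : ε ≤ |x - ξ|) (hyξ : ε ≤ |y - ξ|) :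
    |cosKernel x ξ - cosKernel y ξ| ≤ Real.pi * |x - y| * (2 * ε ^ 2)⁻¹ ^ 2 := by
  have hx0 : Real.cos (Real.pi * x) - Real.cos (Real.pi * ξ) ≠ 0 :=
    cos_sub_cos_ne hx hξ (by rintro rfl; simp at hxξ; linarith)
  have hy0 : Real.cos (Real.pi * y) - Real.cos (Real.pi * ξ) ≠ 0 :=
    cos_sub_cos_ne hy hξ (by rintro rfl; simp at hyξ; linarith)
  have e : cosKernel x ξ - cosKernel y ξ =
      (Real.cos (Real.pi * y) - Real.cos (Real.pi * x)) * (cosKernel x ξ * cosKernel y ξ) := by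
    unfold cosKernel
    field_simp
    ring
  have h1 := abs_cosKernel_le_of_le_abs_sub hε hx hξ hxξ
  have h2 := abs_cosKernel_le_of_le_abs_sub hε hy hξ hyξ
  rw [e, abs_mul, abs_mul, pow_two]
  refine mul_le_mul ?_ (mul_le_mul h1 h2 (abs_nonneg _) (by positivity)) (by positivity)
    (by positivity)
  rw [abs_sub_comm]
  exact abs_cos_pi_sub_le x y

lemma setIntegral_indicator_ball_le {r D ρ x : ℝ} (hr : 0 < r) (hD : 0 ≤ D) (hρ : 0 < ρ) :
    Integrable ((Ioo (x - ρ) (x + ρ)).indicator fun ξ => D * |x - ξ| ^ (r - 1))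
        (volume.restrict (Ioo 0 1)) ∧
      ∫ ξ in Ioo (0 : ℝ) 1, (Ioo (x - ρ) (x + ρ)).indicator (fun ξ => D * |x - ξ| ^ (r - 1)) ξ ≤
        D * (2 * ρ ^ r / r) := by
  have h0 := (integrableOn_abs_sub_rpow_ball hr x hρ).const_mul D
  have h1 : Integrable ((Ioo (x - ρ) (x + ρ)).indicator fun ξ => D * |x - ξ| ^ (r - 1)) :=
    (integrable_indicator_iff measurableSet_Ioo).2 h0
  refine ⟨h1.integrableOn, ?_⟩
  rw [← setIntegral_abs_sub_rpow_ball hr x hρ, ← integral_const_mul,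
    ← integral_indicator (s := Ioo (x - ρ) (x + ρ)) measurableSet_Ioo]
  refine setIntegral_le_integral h1 (ae_of_all _ fun ξ => ?_)
  exact indicator_nonneg (fun ξ _ => mul_nonneg hD (Real.rpow_nonneg (abs_nonneg _) _)) ξ

/-- Split according to whether ξ is within ε of x or y. In the near zone each of the two integrals
is estimated separately by its weak singularity. In the far zone K(x, ξ) - K(y, ξ) is of order |x -
y| ε⁻⁴, and the change of the subtracted constant costs ε⁻² |x - y| ^ r. -/
lemma abs_pvTransform_sub_le {u : ℝ → ℝ} (hu : HolderOpen u) (hi : IntegrableOn u (Ioo 0 1))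
    {α β c C r M : ℝ} (hα : 0 < α) (hβ : β < 1) (hc : 0 < c)
    (hs : ∀ x ∈ Icc α β, c ≤ Real.sin (Real.pi * x)) (hC : 0 ≤ C) (hr : 0 < r)
    (hH : HolderIneq C r u (Icc α β)) (hM : ∀ x ∈ Icc α β, |u x| ≤ M)
    {x y ε : ℝ} (hε : 0 < ε) (hx : x ∈ Icc (α + ε) (β - ε)) (hy : y ∈ Icc (α + ε) (β - ε)) :
    |pvTransform u x - pvTransform u y| ≤ 2 * (c⁻¹ * C * (2 * (ε + |x - y|) ^ r / r)) +
      (Real.pi * |x - y| * (2 * ε ^ 2)⁻¹ ^ 2 * ((∫ ξ in Ioo 0 1, |u ξ|) + M) +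
        (2 * ε ^ 2)⁻¹ * (C * |x - y| ^ r)) := by
  have hsub : Icc α β ⊆ Ioo 0 1 := fun t ht => ⟨hα.trans_le ht.1, ht.2.trans_lt hβ⟩
  have hxm : x ∈ Icc α β := ⟨by linarith [hx.1], by linarith [hx.2]⟩
  have hym : y ∈ Icc α β := ⟨by linarith [hy.1], by linarith [hy.2]⟩
  -- A point within ε of one of x, y is within ρ of both, so balls of radius ρ cover the near zone
  -- around either centre.
  set ρ := ε + |x - y| with hρ
  have hρ0 : 0 < ρ := add_pos_of_pos_of_nonneg hε (abs_nonneg _)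
  have hD : 0 ≤ c⁻¹ * C := by positivity
  obtain ⟨ix, bx⟩ := setIntegral_indicator_ball_le (x := x) hr hD hρ0
  obtain ⟨iy, byy⟩ := setIntegral_indicator_ball_le (x := y) hr hD hρ0
  set gx := (Ioo (x - ρ) (x + ρ)).indicator fun ξ => c⁻¹ * C * |x - ξ| ^ (r - 1) with hgx
  set gy := (Ioo (y - ρ) (y + ρ)).indicator fun ξ => c⁻¹ * C * |y - ξ| ^ (r - 1) with hgy
  have hgx0 : ∀ ξ, 0 ≤ gx ξ := fun ξ =>
    indicator_nonneg (fun ξ _ => mul_nonneg hD (Real.rpow_nonneg (abs_nonneg _) _)) ξ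
  have hgy0 : ∀ ξ, 0 ≤ gy ξ := fun ξ =>
    indicator_nonneg (fun ξ _ => mul_nonneg hD (Real.rpow_nonneg (abs_nonneg _) _)) ξ
  set P := Real.pi * |x - y| * (2 * ε ^ 2)⁻¹ ^ 2 with hP
  have hP0 : 0 ≤ P := by positivity
  set Q := (2 * ε ^ 2)⁻¹ * (C * |x - y| ^ r) with hQ
  have hQ0 : 0 ≤ Q := by positivity
  have hM0 : 0 ≤ M := (abs_nonneg _).trans (hM x hxm)
  have iabs : IntegrableOn (fun ξ => |u ξ|) (Ioo 0 1) := hi.norm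
  have iuM : IntegrableOn (fun ξ => |u ξ| + M) (Ioo 0 1) := iabs.add (integrableOn_unit_const M)
  have ixy : IntegrableOn (fun ξ => gx ξ + gy ξ) (Ioo 0 1) := ix.add iy
  have iu : IntegrableOn (fun ξ => P * (|u ξ| + M) + Q) (Ioo 0 1) :=
    (iuM.const_mul P).add (integrableOn_unit_const Q)
  have kx := integrableOn_pvTransform hu hi (hsub hxm)
  have ky := integrableOn_pvTransform hu hi (hsub hym)
  have hval : ∫ ξ in Ioo (0 : ℝ) 1, (P * (|u ξ| + M) + Q) =
      P * ((∫ ξ in Ioo 0 1, |u ξ|) + M) + Q := by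
    rw [integral_add (iuM.const_mul P) (integrableOn_unit_const Q), integral_const_mul,
      integral_add iabs (integrableOn_unit_const M)]
    simp
  unfold pvTransform
  rw [← integral_sub kx ky, ← Real.norm_eq_abs]
  have key : ‖∫ ξ in Ioo (0 : ℝ) 1, (cosKernel x ξ * (u ξ - u x) - cosKernel y ξ * (u ξ - u y))‖ ≤
      ∫ ξ in Ioo (0 : ℝ) 1, ((gx ξ + gy ξ) + (P * (|u ξ| + M) + Q)) := by
    refine norm_integral_le_of_norm_le (ixy.add iu) ?_
    refine (ae_restrict_iff' measurableSet_Ioo).2 (ae_of_all _ fun ξ hξ => ?_)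
    have hξ' := Ioo_subset_Icc_self hξ
    by_cases hnear : |x - ξ| < ε ∨ |y - ξ| < ε
    · have hξm : ξ ∈ Icc α β := by
        rcases hnear with h | h <;> rw [abs_lt] at h
        · exact ⟨by linarith [hx.1], by linarith [hx.2]⟩
        · exact ⟨by linarith [hy.1], by linarith [hy.2]⟩
      have hxρ : |x - ξ| < ρ := by
        rcases hnear with h | h
        · linarith [abs_nonneg (x - y)]
        · linarith [abs_sub_le x y ξ]
      have hyρ : |y - ξ| < ρ := by
        rcases hnear with h | h
        · linarith [abs_sub_le y x ξ, abs_sub_comm x y]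
        · linarith [abs_nonneg (x - y)]
      have b1 : |cosKernel x ξ * (u ξ - u x)| ≤ gx ξ := by
        rw [hgx, indicator_of_mem (by rw [abs_lt] at hxρ; exact ⟨by linarith, by linarith⟩)]
        refine abs_cosKernel_mul_le hc hC (Ioo_subset_Icc_self (hsub hxm)) hξ' ?_ ?_
        · linarith [hs x hxm, sin_pi_nonneg hξ']
        · rw [abs_sub_comm]; exact hH x hxm ξ hξm
      have b2 : |cosKernel y ξ * (u ξ - u y)| ≤ gy ξ := by
        rw [hgy, indicator_of_mem (by rw [abs_lt] at hyρ; exact ⟨by linarith, by linarith⟩)]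
        refine abs_cosKernel_mul_le hc hC (Ioo_subset_Icc_self (hsub hym)) hξ' ?_ ?_
        · linarith [hs y hym, sin_pi_nonneg hξ']
        · rw [abs_sub_comm]; exact hH y hym ξ hξm
      rw [Real.norm_eq_abs]
      have h3 := abs_sub (cosKernel x ξ * (u ξ - u x)) (cosKernel y ξ * (u ξ - u y))
      have h4 : 0 ≤ P * (|u ξ| + M) := by positivity
      linarith
    · push Not at hnear
      have e : cosKernel x ξ * (u ξ - u x) - cosKernel y ξ * (u ξ - u y) =
          (cosKernel x ξ - cosKernel y ξ) * (u ξ - u x) + cosKernel y ξ * (u y - u x) := by ring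
      have b1 := abs_cosKernel_sub_le hε (Ioo_subset_Icc_self (hsub hxm))
        (Ioo_subset_Icc_self (hsub hym)) hξ' hnear.1 hnear.2
      have b2 := abs_cosKernel_le_of_le_abs_sub hε (Ioo_subset_Icc_self (hsub hym)) hξ' hnear.2
      have b3 : |u ξ - u x| ≤ |u ξ| + M := (abs_sub _ _).trans (by linarith [hM x hxm])
      have b4 : |u y - u x| ≤ C * |x - y| ^ r := by rw [abs_sub_comm]; exact hH x hxm y hym
      have h5 : |(cosKernel x ξ - cosKernel y ξ) * (u ξ - u x)| ≤ P * (|u ξ| + M) := by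
        rw [abs_mul]; exact mul_le_mul b1 b3 (abs_nonneg _) hP0
      have h6 : |cosKernel y ξ * (u y - u x)| ≤ Q := by
        rw [abs_mul]; exact mul_le_mul b2 b4 (abs_nonneg _) (by positivity)
      rw [Real.norm_eq_abs, e]
      have h7 := abs_add_le ((cosKernel x ξ - cosKernel y ξ) * (u ξ - u x))
        (cosKernel y ξ * (u y - u x))
      have := hgx0 ξ
      have := hgy0 ξ
      linarith
  refine key.trans ?_
  rw [integral_add ixy iu, integral_add ix iy, hval]
  linarith

/-- A weak form of Privalov's theorem: the transform of a function that is Hölder continuous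
inside `(0, 1)` is again Hölder continuous inside `(0, 1)`. -/
theorem holderOpen_pvTransform {u : ℝ → ℝ} (hu : HolderOpen u) (hi : IntegrableOn u (Ioo 0 1)) :
    HolderOpen (pvTransform u) := by
  refine holderOpen_iff.2 fun a b ha hb => ?_
  obtain ⟨c, hc, hs⟩ := exists_le_sin_pi (a := a / 2) (b := (1 + b) / 2) (by linarith)
    (by linarith)
  obtain ⟨C, r, hC, hr, hr1, hH⟩ := holderOpen_iff.1 hu (a / 2) ((1 + b) / 2) (by linarith)
    (by linarith)
  obtain ⟨M, hM⟩ := isCompact_Icc.exists_bound_of_continuousOn (hH.continuousOn hC hr)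
  set d := min 1 (min (a / 2) ((1 - b) / 2)) with hd
  have hd0 : 0 < d := lt_min one_pos (lt_min (by linarith) (by linarith))
  have hd1 : d ≤ 1 := min_le_left _ _
  have hda : d ≤ a / 2 := (min_le_right _ _).trans (min_le_left _ _)
  have hdb : d ≤ (1 - b) / 2 := (min_le_right _ _).trans (min_le_right _ _)
  set I := ∫ ξ in Ioo (0 : ℝ) 1, |u ξ| with hI
  have hI0 : 0 ≤ I := integral_nonneg fun _ => abs_nonneg _
  refine ⟨2 * (c⁻¹ * C * (2 * 2 / r)) + (Real.pi * ((2 * d ^ 2)⁻¹ ^ 2) * (I + |M|) +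
    (2 * d ^ 2)⁻¹ * C), r / 5 * r, by positivity, by positivity, by nlinarith, ?_⟩
  intro x hx y hy
  rcases eq_or_ne x y with rfl | hne
  · simpa using by positivity
  set δ := |x - y| with hδ
  have hδ0 : 0 < δ := abs_pos.2 (sub_ne_zero.2 hne)
  have hδ1 : δ ≤ 1 := abs_le.2 ⟨by linarith [hx.1, hy.2], by linarith [hx.2, hy.1]⟩
  -- With ε = d η the near part is O(η ^ r). Since δ ≤ δ ^ r = η ^ 5, the far parts δ ε⁻⁴ and δ ^ r
  -- ε⁻² are O(η) and O(η ^ 3). All are O(η ^ r), whence the exponent r²/5.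
  set η := δ ^ (r / 5) with hη
  have hη0 : 0 < η := Real.rpow_pos_of_pos hδ0 _
  have hη1 : η ≤ 1 := Real.rpow_le_one hδ0.le hδ1 (by positivity)
  have hη5 : η ^ 5 = δ ^ r := by
    rw [hη, ← Real.rpow_natCast, ← Real.rpow_mul hδ0.le]
    norm_num
  have hδη : δ ≤ η ^ 5 := by
    rw [hη5]
    simpa using Real.rpow_le_rpow_of_exponent_ge hδ0 hδ1 hr1
  have hηr : η ≤ η ^ r := by
    simpa using Real.rpow_le_rpow_of_exponent_ge hη0 hη1 hr1
  have hηr' : η ^ r = δ ^ (r / 5 * r) := by rw [hη, ← Real.rpow_mul hδ0.le]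
  have hε : 0 < d * η := by positivity
  have hεd : d * η ≤ d := mul_le_of_le_one_right hd0.le hη1
  have key := abs_pvTransform_sub_le hu hi (α := a / 2) (β := (1 + b) / 2) (by linarith)
    (by linarith) hc hs hC hr hH (M := |M|) (fun t ht => (hM t ht).trans (le_abs_self _)) hε
    (x := x) (y := y)
    ⟨by linarith [hx.1], by linarith [hx.2]⟩ ⟨by linarith [hy.1], by linarith [hy.2]⟩
  refine key.trans ?_
  rw [← hηr', add_mul, add_mul]
  have hη5le : η ^ 5 ≤ η := pow_le_of_le_one hη0.le hη1 (by norm_num)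
  have t1 : (d * η + δ) ^ r ≤ 2 * η ^ r := by
    calc (d * η + δ) ^ r ≤ (2 * η) ^ r := by
          refine Real.rpow_le_rpow (by positivity) ?_ hr.le
          have := mul_le_of_le_one_left hη0.le hd1
          linarith
      _ = 2 ^ r * η ^ r := Real.mul_rpow (by norm_num) hη0.le
      _ ≤ 2 * η ^ r := by
          refine mul_le_mul_of_nonneg_right ?_ (by positivity)
          simpa using Real.rpow_le_rpow_of_exponent_le (one_le_two) hr1
  have t2 : δ * (2 * (d * η) ^ 2)⁻¹ ^ 2 ≤ (2 * d ^ 2)⁻¹ ^ 2 * η ^ r := by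
    calc δ * (2 * (d * η) ^ 2)⁻¹ ^ 2 ≤ η ^ 5 * (2 * (d * η) ^ 2)⁻¹ ^ 2 := by gcongr
      _ = (2 * d ^ 2)⁻¹ ^ 2 * η := by field_simp
      _ ≤ _ := by gcongr
  have t3 : (2 * (d * η) ^ 2)⁻¹ * δ ^ r ≤ (2 * d ^ 2)⁻¹ * η ^ r := by
    calc (2 * (d * η) ^ 2)⁻¹ * δ ^ r = (2 * d ^ 2)⁻¹ * η ^ 3 := by rw [← hη5]; field_simp
      _ ≤ (2 * d ^ 2)⁻¹ * η := by
          gcongr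
          exact pow_le_of_le_one hη0.le hη1 (by norm_num)
      _ ≤ _ := by gcongr
  refine add_le_add ?_ (add_le_add ?_ ?_)
  · calc 2 * (c⁻¹ * C * (2 * (d * η + δ) ^ r / r)) ≤ 2 * (c⁻¹ * C * (2 * (2 * η ^ r) / r)) := by
          gcongr
      _ = _ := by ring
  · calc Real.pi * δ * (2 * (d * η) ^ 2)⁻¹ ^ 2 * (I + |M|)
        = Real.pi * (I + |M|) * (δ * (2 * (d * η) ^ 2)⁻¹ ^ 2) := by ring
      _ ≤ Real.pi * (I + |M|) * ((2 * d ^ 2)⁻¹ ^ 2 * η ^ r) := by gcongr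
      _ = _ := by ring
  · calc (2 * (d * η) ^ 2)⁻¹ * (C * δ ^ r) = C * ((2 * (d * η) ^ 2)⁻¹ * δ ^ r) := by ring
      _ ≤ C * ((2 * d ^ 2)⁻¹ * η ^ r) := by gcongr
      _ = _ := by ring

/-! ### Functions that are Lipschitz in cos πx, and the commutator with multiplication. -/

/-- `v` is Lipschitz, with constant `L`, as a function of `cos πx` on `[0, 1]`. -/
def CosLipschitz (L : ℝ) (v : ℝ → ℝ) : Prop :=
  ∀ x ∈ Icc (0 : ℝ) 1, ∀ y ∈ Icc (0 : ℝ) 1,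
    |v x - v y| ≤ L * |Real.cos (Real.pi * x) - Real.cos (Real.pi * y)|

namespace CosLipschitz

lemma nonneg {L : ℝ} {v : ℝ → ℝ} (h : CosLipschitz L v) : 0 ≤ L := by
  have h1 := (abs_nonneg _).trans (h 0 (by simp) 1 (by simp))
  rw [mul_zero, mul_one, Real.cos_zero, Real.cos_pi] at h1
  norm_num at h1
  exact h1

lemma abs_sub_le {L : ℝ} {v : ℝ → ℝ} (h : CosLipschitz L v) {x y : ℝ} (hx : x ∈ Icc (0 : ℝ) 1)
    (hy : y ∈ Icc (0 : ℝ) 1) : |v x - v y| ≤ L * Real.pi * |x - y| := by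
  refine (h x hx y hy).trans ?_
  rw [mul_assoc]
  exact mul_le_mul_of_nonneg_left (abs_cos_pi_sub_le x y) h.nonneg

lemma holderClosed {L : ℝ} {v : ℝ → ℝ} (h : CosLipschitz L v) : HolderClosed v :=
  holderClosed_iff.2 ⟨L * Real.pi, 1, mul_nonneg h.nonneg Real.pi_pos.le, one_pos, le_rfl,
    fun x hx y hy => by simpa using h.abs_sub_le hx hy⟩

lemma const_mul {L : ℝ} {v : ℝ → ℝ} (h : CosLipschitz L v) (c : ℝ) :
    CosLipschitz (|c| * L) (fun x => c * v x) := by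
  intro x hx y hy
  simp only [← mul_sub]
  rw [abs_mul, mul_assoc]
  exact mul_le_mul_of_nonneg_left (h x hx y hy) (abs_nonneg _)

lemma sub {L M : ℝ} {v w : ℝ → ℝ} (h : CosLipschitz L v) (h' : CosLipschitz M w) :
    CosLipschitz (L + M) (fun x => v x - w x) := by
  intro x hx y hy
  have e : v x - w x - (v y - w y) = (v x - v y) - (w x - w y) := by ring
  simp only [e]
  refine (abs_sub _ _).trans ?_
  rw [add_mul]
  exact add_le_add (h x hx y hy) (h' x hx y hy)

lemma mul {L M A B : ℝ} {v w : ℝ → ℝ} (h : CosLipschitz L v) (h' : CosLipschitz M w)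
    (hA : ∀ x ∈ Icc (0 : ℝ) 1, |v x| ≤ A) (hB : ∀ x ∈ Icc (0 : ℝ) 1, |w x| ≤ B) :
    CosLipschitz (A * M + B * L) (fun x => v x * w x) := by
  intro x hx y hy
  have e : v x * w x - v y * w y = v x * (w x - w y) + w y * (v x - v y) := by ring
  simp only [e]
  refine (abs_add_le _ _).trans ?_
  rw [add_mul, abs_mul, abs_mul, mul_assoc, mul_assoc]
  exact add_le_add
    (mul_le_mul (hA x hx) (h' x hx y hy) (abs_nonneg _) ((abs_nonneg _).trans (hA x hx)))
    (mul_le_mul (hB y hy) (h x hx y hy) (abs_nonneg _) ((abs_nonneg _).trans (hB y hy)))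

/-- The pole cancels completely, uniformly up to the endpoints. This is the reason for measuring
increments in cos πx rather than in x. -/
lemma abs_cosKernel_mul_le {L : ℝ} {v : ℝ → ℝ} (h : CosLipschitz L v) {x ξ : ℝ}
    (hx : x ∈ Icc (0 : ℝ) 1) (hξ : ξ ∈ Icc (0 : ℝ) 1) : |cosKernel x ξ * (v ξ - v x)| ≤ L := by
  rcases eq_or_ne ξ x with rfl | hne
  · simpa using h.nonneg
  have h0 := abs_pos.2 (cos_sub_cos_ne hx hξ hne)
  rw [cosKernel, abs_mul, abs_inv, ← div_eq_inv_mul, div_le_iff₀ h0, abs_sub_comm]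
  exact h x hx ξ hξ

lemma abs_pvTransform_le {L : ℝ} {v : ℝ → ℝ} (h : CosLipschitz L v) {x : ℝ}
    (hx : x ∈ Icc (0 : ℝ) 1) : |pvTransform v x| ≤ L := by
  have := norm_setIntegral_le_of_norm_le_const (μ := volume) (s := Ioo (0 : ℝ) 1)
    (f := fun ξ => cosKernel x ξ * (v ξ - v x)) (C := L) (by simp)
    (fun ξ hξ => h.abs_cosKernel_mul_le hx (Ioo_subset_Icc_self hξ))
  simpa [pvTransform] using this

lemma aestronglyMeasurable {L : ℝ} {v : ℝ → ℝ} (h : CosLipschitz L v) :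
    AEStronglyMeasurable v (volume.restrict (Ioo 0 1)) :=
  h.holderClosed.integrableOn.1

end CosLipschitz

lemma HolderOpen.aestronglyMeasurable {v : ℝ → ℝ} (h : HolderOpen v) :
    AEStronglyMeasurable v (volume.restrict (Ioo 0 1)) :=
  h.continuousOn.aestronglyMeasurable measurableSet_Ioo

lemma integrableOn_cosKernel_mul_sub {L : ℝ} {u v : ℝ → ℝ} (hi : IntegrableOn u (Ioo 0 1))
    (hv : CosLipschitz L v) {x : ℝ} (hx : x ∈ Icc (0 : ℝ) 1) :
    IntegrableOn (fun ξ => cosKernel x ξ * (v x - v ξ) * u ξ) (Ioo 0 1) := by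
  refine Integrable.bdd_mul (c := L) hi ((measurable_cosKernel_right x).aestronglyMeasurable.mul
    (aestronglyMeasurable_const.sub hv.aestronglyMeasurable)) ?_
  refine (ae_restrict_iff' measurableSet_Ioo).2 (ae_of_all _ fun ξ hξ => ?_)
  have := hv.abs_cosKernel_mul_le hx (Ioo_subset_Icc_self hξ)
  rwa [Real.norm_eq_abs, ← abs_neg, ← mul_neg, neg_sub]

/-- The commutator of the transform with a multiplication operator. -/
lemma pvTransform_mul {L : ℝ} {u v : ℝ → ℝ} (hu : HolderOpen u) (hi : IntegrableOn u (Ioo 0 1))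
    (hv : CosLipschitz L v) {x : ℝ} (hx : x ∈ Ioo (0 : ℝ) 1) :
    pvTransform (fun ξ => u ξ * v ξ) x = pvTransform u x * v x -
      ∫ ξ in Ioo (0 : ℝ) 1, cosKernel x ξ * (v x - v ξ) * u ξ := by
  unfold pvTransform
  rw [← integral_mul_const, ← integral_sub ((integrableOn_pvTransform hu hi hx).mul_const _)
    (integrableOn_cosKernel_mul_sub hi hv (Ioo_subset_Icc_self hx))]
  refine integral_congr_ae (ae_of_all _ fun ξ => ?_)
  simp only
  ring

/-! ### Antisymmetry of the transform. -/

/-- The kernel, set to zero near the diagonal. -/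
noncomputable def truncKernel (ε x ξ : ℝ) : ℝ :=
  {p : ℝ × ℝ | ε ≤ |p.1 - p.2|}.indicator (fun p => cosKernel p.1 p.2) (x, ξ)

lemma measurable_truncKernel (ε : ℝ) : Measurable fun p : ℝ × ℝ => truncKernel ε p.1 p.2 := by
  unfold truncKernel
  exact measurable_cosKernel.indicator (measurableSet_le measurable_const (by fun_prop))

lemma truncKernel_swap (ε x ξ : ℝ) : truncKernel ε ξ x = -truncKernel ε x ξ := by
  unfold truncKernel
  by_cases h : ε ≤ |x - ξ|
  · rw [indicator_of_mem (show (ξ, x) ∈ _ from (abs_sub_comm x ξ ▸ h : ε ≤ |ξ - x|)),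
      indicator_of_mem (show (x, ξ) ∈ _ from h), cosKernel_swap]
  · rw [indicator_of_notMem (show (ξ, x) ∉ _ from (abs_sub_comm x ξ ▸ h : ¬ ε ≤ |ξ - x|)),
      indicator_of_notMem (show (x, ξ) ∉ _ from h), neg_zero]

lemma abs_truncKernel_le {ε x ξ : ℝ} (hε : 0 < ε) (hx : x ∈ Icc (0 : ℝ) 1)
    (hξ : ξ ∈ Icc (0 : ℝ) 1) : |truncKernel ε x ξ| ≤ (2 * ε ^ 2)⁻¹ := by
  unfold truncKernel
  by_cases h : ε ≤ |x - ξ|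
  · rw [indicator_of_mem (show (x, ξ) ∈ _ from h)]
    exact abs_cosKernel_le_of_le_abs_sub hε hx hξ h
  · rw [indicator_of_notMem (show (x, ξ) ∉ _ from h), abs_zero]
    positivity

lemma setIntegral_truncKernel (g : ℝ → ℝ) (ε x : ℝ) :
    ∫ ξ in Ioo (0 : ℝ) 1, truncKernel ε x ξ * g ξ =
      ∫ ξ in Ioo 0 1 \ Ioo (x - ε) (x + ε), cosKernel x ξ * g ξ := by
  rw [Set.sdiff_eq, ← setIntegral_indicator measurableSet_Ioo.compl]
  refine integral_congr_ae (ae_of_all _ fun ξ => ?_)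
  simp only [truncKernel]
  by_cases h : ξ ∈ Ioo (x - ε) (x + ε)
  · have : |x - ξ| < ε := abs_lt.2 ⟨by linarith [h.2], by linarith [h.1]⟩
    rw [indicator_of_notMem (show (x, ξ) ∉ _ from (not_le.2 this : ¬ ε ≤ |x - ξ|)),
      indicator_of_notMem (show ξ ∉ (Ioo (x - ε) (x + ε))ᶜ from not_not_intro h), zero_mul]
  · rw [indicator_of_mem (show (x, ξ) ∈ _ from le_abs_sub_of_notMem_ball h),
      indicator_of_mem (show ξ ∈ (Ioo (x - ε) (x + ε))ᶜ from h)]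

lemma ae_prod_unit {p : ℝ × ℝ → Prop}
    (h : ∀ x ∈ Ioo (0 : ℝ) 1, ∀ ξ ∈ Ioo (0 : ℝ) 1, p (x, ξ)) :
    ∀ᵐ q ∂((volume.restrict (Ioo (0 : ℝ) 1)).prod (volume.restrict (Ioo (0 : ℝ) 1))), p q := by
  rw [Measure.prod_restrict]
  exact (ae_restrict_iff' (measurableSet_Ioo.prod measurableSet_Ioo)).2
    (ae_of_all _ fun q hq => h q.1 hq.1 q.2 hq.2)

lemma integrable_truncKernel_mul {w : ℝ → ℝ} (hw : IntegrableOn w (Ioo 0 1)) {ε : ℝ}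
    (hε : 0 < ε) : Integrable (fun p : ℝ × ℝ => truncKernel ε p.1 p.2 * w p.2)
      ((volume.restrict (Ioo (0 : ℝ) 1)).prod (volume.restrict (Ioo (0 : ℝ) 1))) := by
  refine Integrable.bdd_mul (c := (2 * ε ^ 2)⁻¹) (hw.comp_snd _)
    (measurable_truncKernel ε).aestronglyMeasurable ?_
  exact ae_prod_unit fun x hx ξ hξ =>
    abs_truncKernel_le hε (Ioo_subset_Icc_self hx) (Ioo_subset_Icc_self hξ)

/-- Fubini is allowed because the truncated kernel is bounded. By antisymmetry of the kernel the
inner integral no longer involves w. -/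
lemma integral_truncated_swap {w : ℝ → ℝ} (hw : IntegrableOn w (Ioo 0 1)) {ε : ℝ} (hε : 0 < ε) :
    ∫ x in Ioo (0 : ℝ) 1, (∫ ξ in Ioo (0 : ℝ) 1, truncKernel ε x ξ * w ξ) =
      -∫ ξ in Ioo (0 : ℝ) 1, w ξ * ∫ x in Ioo 0 1 \ Ioo (ξ - ε) (ξ + ε), cosKernel ξ x := by
  rw [integral_integral_swap (integrable_truncKernel_mul hw hε), ← integral_neg]
  refine integral_congr_ae (ae_of_all _ fun ξ => ?_)
  have h := setIntegral_truncKernel (fun _ => 1) ε ξ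
  simp only [mul_one] at h
  simp only [← h, truncKernel_swap ε ξ]
  rw [integral_mul_const, integral_neg]
  ring

/-- After truncation and `integral_truncated_swap`, w is integrated against truncated integrals of
the kernel alone, which tend to 0. The compact support supplies the uniform bounds needed for
dominated convergence on both sides. -/
lemma integral_pvTransform_eq_zero {w : ℝ → ℝ} (hw : HolderClosed w) {a b : ℝ} (ha : 0 < a)
    (hb : b < 1) (hsupp : ∀ x ∈ Icc (0 : ℝ) 1, x ∉ Icc a b → w x = 0) :
    ∫ x in Ioo (0 : ℝ) 1, pvTransform w x = 0 := by
  obtain ⟨C, r, hC, hr, -, hH⟩ := holderClosed_iff.1 hw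
  obtain ⟨c, hc, hs⟩ := exists_le_sin_pi ha hb
  obtain ⟨D, ε₀, hε₀, hD⟩ := exists_truncated_integral_cosKernel_le ha hb
  obtain ⟨M, hM⟩ := isCompact_Icc.exists_bound_of_continuousOn hw.continuousOn
  have hi := hw.integrableOn
  have hev : ∀ᶠ ε in 𝓝[>] (0 : ℝ), ε ∈ Ioo 0 ε₀ := Ioo_mem_nhdsGT hε₀
  have hprod : ∀ x ∈ Icc (0 : ℝ) 1, ∀ ε ∈ Ioo 0 ε₀,
      |w x * ∫ ξ in Ioo 0 1 \ Ioo (x - ε) (x + ε), cosKernel x ξ| ≤ |M| * |D| := by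
    intro x hx ε hε
    by_cases hxm : x ∈ Icc a b
    · rw [abs_mul]
      exact mul_le_mul ((hM x hx).trans (le_abs_self _)) ((hD x hxm ε hε).trans (le_abs_self _))
        (abs_nonneg _) (abs_nonneg _)
    · rw [hsupp x hx hxm, zero_mul, abs_zero]
      positivity
  have hker : ∀ x ∈ Ioo (0 : ℝ) 1, ∀ ξ ∈ Ioo (0 : ℝ) 1,
      |cosKernel x ξ * (w ξ - w x)| ≤ c⁻¹ * C * |x - ξ| ^ (r - 1) := by
    intro x hx ξ hξ
    have hx' := Ioo_subset_Icc_self hx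
    have hξ' := Ioo_subset_Icc_self hξ
    -- If either point lies in [a, b], the sum of the sines is at least c; otherwise both values of
    -- w vanish.
    by_cases h : x ∈ Icc a b ∨ ξ ∈ Icc a b
    · refine abs_cosKernel_mul_le hc hC hx' hξ' ?_ (abs_sub_comm (w x) (w ξ) ▸ hH x hx' ξ hξ')
      rcases h with h | h
      · linarith [hs x h, sin_pi_nonneg hξ']
      · linarith [hs ξ h, sin_pi_nonneg hx']
    · push Not at h
      rw [hsupp x hx' h.1, hsupp ξ hξ' h.2, sub_zero, mul_zero, abs_zero]
      have := Real.rpow_nonneg (abs_nonneg (x - ξ)) (r - 1)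
      positivity
  have lim1 : Tendsto (fun ε => ∫ x in Ioo (0 : ℝ) 1,
      (∫ ξ in Ioo (0 : ℝ) 1, truncKernel ε x ξ * w ξ)) (𝓝[>] 0)
      (𝓝 (∫ x in Ioo (0 : ℝ) 1, pvTransform w x)) := by
    refine tendsto_integral_filter_of_dominated_convergence
      (fun _ => c⁻¹ * C * (2 / r) + |M| * |D|) ?_ ?_ (integrableOn_unit_const _) ?_
    · filter_upwards [hev] with ε hε
      exact (integrable_truncKernel_mul hi hε.1).integral_prod_left.1
    · filter_upwards [hev] with ε hε
      refine (ae_restrict_iff' measurableSet_Ioo).2 (ae_of_all _ fun x hx => ?_)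
      have hx' := Ioo_subset_Icc_self hx
      have i1 : IntegrableOn (fun ξ => cosKernel x ξ * (w ξ - w x))
          (Ioo 0 1 \ Ioo (x - ε) (x + ε)) :=
        (integrableOn_pvTransform hw.holderOpen hi hx).mono_set sdiff_subset
      have i2 := integrableOn_truncated (integrableOn_unit_const (w x)) hx' hε.1
      have e : ∫ ξ in Ioo 0 1 \ Ioo (x - ε) (x + ε), cosKernel x ξ * w ξ =
          (∫ ξ in Ioo 0 1 \ Ioo (x - ε) (x + ε), cosKernel x ξ * (w ξ - w x)) +
            w x * ∫ ξ in Ioo 0 1 \ Ioo (x - ε) (x + ε), cosKernel x ξ := by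
        rw [mul_comm (w x), ← integral_mul_const, ← integral_add i1 i2]
        refine integral_congr_ae (ae_of_all _ fun ξ => ?_)
        simp only
        ring
      rw [setIntegral_truncKernel, e, Real.norm_eq_abs]
      refine (abs_add_le _ _).trans (add_le_add ?_ (hprod x hx' ε hε))
      have i3 := (integrableOn_abs_sub_rpow hr hx').const_mul (c⁻¹ * C)
      rw [← Real.norm_eq_abs]
      calc _ ≤ ∫ ξ in Ioo 0 1 \ Ioo (x - ε) (x + ε), c⁻¹ * C * |x - ξ| ^ (r - 1) := by
            refine norm_integral_le_of_norm_le (IntegrableOn.mono_set i3 sdiff_subset) ?_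
            exact (ae_restrict_iff' (measurableSet_truncated x ε)).2
              (ae_of_all _ fun ξ hξ => hker x hx ξ hξ.1)
        _ ≤ ∫ ξ in Ioo 0 1, c⁻¹ * C * |x - ξ| ^ (r - 1) := by
            refine setIntegral_mono_set i3 (ae_of_all _ fun ξ => ?_) sdiff_subset.eventuallyLE
            have := Real.rpow_nonneg (abs_nonneg (x - ξ)) (r - 1)
            simp only [Pi.zero_apply]
            positivity
        _ ≤ _ := by
            rw [integral_const_mul]
            exact mul_le_mul_of_nonneg_left (setIntegral_abs_sub_rpow_le hr hx') (by positivity)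
    · refine (ae_restrict_iff' measurableSet_Ioo).2 (ae_of_all _ fun x hx => ?_)
      simp only [setIntegral_truncKernel]
      exact (hasPrincipalValue_cosKernel_mul hw.holderOpen hi hx).2
  have lim2 : Tendsto (fun ε => ∫ ξ in Ioo (0 : ℝ) 1,
      w ξ * ∫ x in Ioo 0 1 \ Ioo (ξ - ε) (ξ + ε), cosKernel ξ x) (𝓝[>] 0)
      (𝓝 (∫ _ in Ioo (0 : ℝ) 1, (0 : ℝ))) := by
    refine tendsto_integral_filter_of_dominated_convergence
      (fun _ => |M| * |D|) ?_ ?_ (integrableOn_unit_const _) ?_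
    · refine Eventually.of_forall fun ε => hi.1.mul ?_
      have h := StronglyMeasurable.integral_prod_right (f := fun x ξ => truncKernel ε x ξ)
        (measurable_truncKernel ε).stronglyMeasurable (ν := volume.restrict (Ioo (0 : ℝ) 1))
      refine h.aestronglyMeasurable.congr (ae_of_all _ fun ξ => ?_)
      simpa using setIntegral_truncKernel (fun _ => 1) ε ξ
    · filter_upwards [hev] with ε hε
      exact (ae_restrict_iff' measurableSet_Ioo).2
        (ae_of_all _ fun x hx => hprod x (Ioo_subset_Icc_self hx) ε hε)
    · refine (ae_restrict_iff' measurableSet_Ioo).2 (ae_of_all _ fun x hx => ?_)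
      simpa using (tendsto_truncated_integral_cosKernel hx).const_mul (w x)
  have lim3 := lim2.neg
  rw [integral_zero, neg_zero] at lim3
  refine tendsto_nhds_unique (lim1.congr' ?_) lim3
  filter_upwards [hev] with ε hε
  exact integral_truncated_swap hi hε.1

lemma setIntegral_unit_congr {g h : ℝ → ℝ} (e : ∀ x ∈ Ioo (0 : ℝ) 1, g x = h x) :
    ∫ x in Ioo (0 : ℝ) 1, g x = ∫ x in Ioo (0 : ℝ) 1, h x :=
  setIntegral_congr_fun measurableSet_Ioo e

lemma pvTransform_congr {u v : ℝ → ℝ} (e : ∀ x ∈ Ioo (0 : ℝ) 1, u x = v x) {x : ℝ}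
    (hx : x ∈ Ioo (0 : ℝ) 1) : pvTransform u x = pvTransform v x :=
  setIntegral_unit_congr fun ξ hξ => by rw [e ξ hξ, e x hx]

lemma abs_clamp_sub_le (a b x y : ℝ) : |max a (min b x) - max a (min b y)| ≤ |x - y| := by
  refine (abs_max_sub_max_le_max _ _ _ _).trans ?_
  rw [sub_self, abs_zero, max_eq_right (abs_nonneg _)]
  refine (abs_min_sub_min_le_max _ _ _ _).trans ?_
  rw [sub_self, abs_zero, max_eq_right (abs_nonneg _)]

/-- Extend by constants outside [a, b]: clamping is 1-Lipschitz. -/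
lemma HolderOpen.exists_holderClosed_eqOn {u : ℝ → ℝ} (hu : HolderOpen u) {a b : ℝ} (ha : 0 < a)
    (hab : a ≤ b) (hb : b < 1) : ∃ w, HolderClosed w ∧ EqOn w u (Icc a b) := by
  obtain ⟨C, r, hC, hr, hr1, hH⟩ := holderOpen_iff.1 hu a b ha hb
  refine ⟨fun x => u (max a (min b x)), holderClosed_iff.2 ⟨C, r, hC, hr, hr1, ?_⟩, ?_⟩
  · intro x _ y _
    have hm : ∀ t : ℝ, max a (min b t) ∈ Icc a b := fun t =>
      ⟨le_max_left _ _, max_le hab (min_le_left _ _)⟩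
    refine (hH _ (hm x) _ (hm y)).trans (mul_le_mul_of_nonneg_left ?_ hC)
    exact Real.rpow_le_rpow (abs_nonneg _) (abs_clamp_sub_le a b x y) hr.le
  · intro x hx
    simp only
    rw [min_eq_right hx.2, max_eq_right hx.1]

lemma integrableOn_mul_of_support {g v : ℝ → ℝ} (hg : ContinuousOn g (Ioo 0 1))
    (hv : ContinuousOn v (Icc 0 1)) {a b : ℝ} (ha : 0 < a) (hb : b < 1)
    (hsupp : ∀ x ∈ Icc (0 : ℝ) 1, x ∉ Icc a b → v x = 0) :
    IntegrableOn (fun x => g x * v x) (Ioo 0 1) := by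
  have hsub : Icc a b ⊆ Ioo 0 1 := fun t ht => ⟨ha.trans_le ht.1, ht.2.trans_lt hb⟩
  have h1 : IntegrableOn (fun x => g x * v x) (Icc a b) :=
    ((hg.mono hsub).mul (hv.mono (hsub.trans Ioo_subset_Icc_self))).integrableOn_Icc
  refine h1.of_forall_sdiff_eq_zero measurableSet_Ioo fun x hx => ?_
  rw [hsupp x (Ioo_subset_Icc_self hx.1) hx.2, mul_zero]

/-- The transform is antisymmetric, when tested against compactly supported functions. -/
theorem integral_pvTransform_mul_of_support {L : ℝ} {u v : ℝ → ℝ} (hu : HolderOpen u)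
    (hi : IntegrableOn u (Ioo 0 1)) (hv : CosLipschitz L v) {a b : ℝ} (ha : 0 < a) (hab : a ≤ b)
    (hb : b < 1) (hsupp : ∀ x ∈ Icc (0 : ℝ) 1, x ∉ Icc a b → v x = 0) :
    ∫ x in Ioo (0 : ℝ) 1, pvTransform u x * v x = -∫ x in Ioo (0 : ℝ) 1, u x * pvTransform v x := by
  obtain ⟨u', hu', he⟩ := hu.exists_holderClosed_eqOn ha hab hb
  -- Only u on the support of v matters, so u may be replaced by a function Hölder on the closed
  -- interval. The commutator formula then rewrites this vanishing integral as ∫ Tu · v minus a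
  -- double integral.
  have h0 : ∫ x in Ioo (0 : ℝ) 1, pvTransform (fun ξ => u ξ * v ξ) x = 0 := by
    refine Eq.trans (setIntegral_unit_congr fun x hx => pvTransform_congr (fun y hy => ?_) hx)
      (integral_pvTransform_eq_zero (hu'.mul hv.holderClosed) ha hb
        (fun x hx hxm => by rw [hsupp x hx hxm, mul_zero]))
    by_cases hym : y ∈ Icc a b
    · rw [he hym]
    · rw [hsupp y (Ioo_subset_Icc_self hy) hym, mul_zero, mul_zero]
  have iTv : IntegrableOn (fun x => pvTransform u x * v x) (Ioo 0 1) :=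
    integrableOn_mul_of_support (holderOpen_pvTransform hu hi).continuousOn
      hv.holderClosed.continuousOn ha hb hsupp
  -- The factor multiplying u is bounded by L, so Fubini applies; integrating first in x yields -Tv.
  have iprod : Integrable (fun p : ℝ × ℝ => cosKernel p.1 p.2 * (v p.1 - v p.2) * u p.2)
      ((volume.restrict (Ioo (0 : ℝ) 1)).prod (volume.restrict (Ioo (0 : ℝ) 1))) := by
    refine Integrable.bdd_mul (c := L) (hi.comp_snd _)
      (measurable_cosKernel.aestronglyMeasurable.mul
        (hv.aestronglyMeasurable.comp_fst.sub hv.aestronglyMeasurable.comp_snd)) ?_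
    refine ae_prod_unit fun x hx ξ hξ => ?_
    have := hv.abs_cosKernel_mul_le (Ioo_subset_Icc_self hx) (Ioo_subset_Icc_self hξ)
    rwa [Real.norm_eq_abs, ← abs_neg, ← mul_neg, neg_sub]
  have h1 : ∫ x in Ioo (0 : ℝ) 1, pvTransform (fun ξ => u ξ * v ξ) x =
      (∫ x in Ioo (0 : ℝ) 1, pvTransform u x * v x) -
        ∫ x in Ioo (0 : ℝ) 1, ∫ ξ in Ioo (0 : ℝ) 1, cosKernel x ξ * (v x - v ξ) * u ξ := by
    rw [← integral_sub iTv iprod.integral_prod_left]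
    exact setIntegral_unit_congr fun x hx => pvTransform_mul hu hi hv hx
  rw [h0, integral_integral_swap iprod] at h1
  rw [sub_eq_zero.1 h1.symm, ← integral_neg]
  refine integral_congr_ae (ae_of_all _ fun ξ => ?_)
  simp only [pvTransform]
  rw [integral_mul_const, mul_comm, ← mul_neg, ← integral_neg]
  congr 1
  refine integral_congr_ae (ae_of_all _ fun x => ?_)
  simp only [cosKernel_swap ξ x]
  ring

/-- Soft thresholding at level `δ`. -/
noncomputable def softThreshold (δ t : ℝ) : ℝ := t - max (-δ) (min δ t)

lemma softThreshold_eq_zero {δ t : ℝ} (h : |t| ≤ δ) : softThreshold δ t = 0 := by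
  rw [abs_le] at h
  rw [softThreshold, min_eq_right h.2, max_eq_right h.1, sub_self]

lemma abs_softThreshold_sub_le {δ : ℝ} (hδ : 0 ≤ δ) (t : ℝ) : |softThreshold δ t - t| ≤ δ := by
  rw [softThreshold, sub_sub_cancel_left, abs_neg, abs_le]
  exact ⟨le_max_left _ _, max_le (by linarith) (min_le_left _ _)⟩

lemma abs_softThreshold_sub_softThreshold_le (δ s t : ℝ) :
    |softThreshold δ s - softThreshold δ t| ≤ 2 * |s - t| := by
  have h := abs_clamp_sub_le (-δ) δ s t
  have e : softThreshold δ s - softThreshold δ t =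
      (s - t) - (max (-δ) (min δ s) - max (-δ) (min δ t)) := by unfold softThreshold; ring
  rw [e]
  exact (abs_sub _ _).trans (by linarith)

lemma abs_softThreshold_le {δ : ℝ} (hδ : 0 ≤ δ) (t : ℝ) : |softThreshold δ t| ≤ 2 * |t| := by
  have := abs_softThreshold_sub_softThreshold_le δ t 0
  rwa [softThreshold_eq_zero (t := 0) (by simpa using hδ), sub_zero, sub_zero] at this

lemma CosLipschitz.softThreshold {L : ℝ} {v : ℝ → ℝ} (hv : CosLipschitz L v) (δ : ℝ) :
    CosLipschitz (2 * L) (fun x => softThreshold δ (v x)) := fun x hx y hy => by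
  refine (abs_softThreshold_sub_softThreshold_le _ _ _).trans ?_
  rw [mul_assoc]
  exact mul_le_mul_of_nonneg_left (hv x hx y hy) (by norm_num)

/-- The transform is antisymmetric, when tested against functions that vanish at the endpoints. -/
theorem integral_pvTransform_mul {L : ℝ} {u v : ℝ → ℝ} (hu : HolderOpen u)
    (hi : IntegrableOn u (Ioo 0 1)) (hv : CosLipschitz L v) (h0 : v 0 = 0) (h1 : v 1 = 0)
    (hint : IntegrableOn (fun x => pvTransform u x * v x) (Ioo 0 1)) :
    ∫ x in Ioo (0 : ℝ) 1, pvTransform u x * v x = -∫ x in Ioo (0 : ℝ) 1, u x * pvTransform v x := by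
  -- Soft thresholding produces compact support in (0, 1) while keeping the Lipschitz constant below
  -- 2L and |V n| below 2|v|, which gives the dominating functions for both limits.
  set V : ℕ → ℝ → ℝ := fun n x => softThreshold (1 / ((n : ℝ) + 1)) (v x) with hV
  have hδ : ∀ n : ℕ, 0 < 1 / ((n : ℝ) + 1) := fun n => by positivity
  have hVL : ∀ n, CosLipschitz (2 * L) (V n) := fun n => hv.softThreshold _
  have hVlim : ∀ x, Tendsto (fun n => V n x) atTop (𝓝 (v x)) := fun x => by
    rw [tendsto_iff_norm_sub_tendsto_zero]
    exact squeeze_zero (fun _ => norm_nonneg _)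
      (fun n => abs_softThreshold_sub_le (hδ n).le (v x)) tendsto_one_div_add_atTop_nhds_zero_nat
  have heq : ∀ n, ∫ x in Ioo (0 : ℝ) 1, pvTransform u x * V n x =
      -∫ x in Ioo (0 : ℝ) 1, u x * pvTransform (V n) x := by
    intro n
    have hLp : 0 < L * Real.pi + 1 := by have := hv.nonneg; positivity
    -- In x, v has Lipschitz constant Lπ and vanishes at 0 and 1, so it stays below the threshold
    -- within distance d of the endpoints. The added 1 covers L = 0, and the bound 1/2 ensures d ≤ 1
    -- - d.
    set d := min (1 / ((n : ℝ) + 1) / (L * Real.pi + 1)) (1 / 2) with hd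
    have hd0 : 0 < d := lt_min (div_pos (hδ n) hLp) (by norm_num)
    have hd2 : d ≤ 1 / 2 := min_le_right _ _
    have hdle : (L * Real.pi) * d ≤ 1 / ((n : ℝ) + 1) := by
      have h2 : d ≤ 1 / ((n : ℝ) + 1) / (L * Real.pi + 1) := min_le_left _ _
      rw [le_div_iff₀ hLp] at h2
      nlinarith
    refine integral_pvTransform_mul_of_support hu hi (hVL n) hd0 (b := 1 - d) (by linarith)
      (by linarith) fun x hx hxm => softThreshold_eq_zero ?_
    have hLp' : 0 ≤ L * Real.pi := mul_nonneg hv.nonneg Real.pi_pos.le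
    rcases lt_or_ge x d with h | h
    · have h3 := hv.abs_sub_le hx (y := 0) (by simp)
      rw [h0, sub_zero, sub_zero, abs_of_nonneg hx.1] at h3
      exact h3.trans ((mul_le_mul_of_nonneg_left h.le hLp').trans hdle)
    · have h4 : 1 - d < x := by
        by_contra! h5
        exact hxm ⟨h, h5⟩
      have h3 := hv.abs_sub_le hx (y := 1) (by simp)
      rw [h1, sub_zero, abs_sub_comm x 1, abs_of_nonneg (by linarith [hx.2] : 0 ≤ 1 - x)] at h3
      exact h3.trans ((mul_le_mul_of_nonneg_left (by linarith) hLp').trans hdle)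
  have hTu := (holderOpen_pvTransform hu hi).aestronglyMeasurable
  have lim1 : Tendsto (fun n => ∫ x in Ioo (0 : ℝ) 1, pvTransform u x * V n x) atTop
      (𝓝 (∫ x in Ioo (0 : ℝ) 1, pvTransform u x * v x)) := by
    refine tendsto_integral_of_dominated_convergence (fun x => 2 * ‖pvTransform u x * v x‖)
      (fun n => hTu.mul (hVL n).aestronglyMeasurable) (hint.norm.const_mul 2)
      (fun n => ae_of_all _ fun x => ?_) (ae_of_all _ fun x => (hVlim x).const_mul _)
    rw [norm_mul, norm_mul, mul_left_comm]
    exact mul_le_mul_of_nonneg_left (abs_softThreshold_le (hδ n).le _) (norm_nonneg _)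
  have limT : ∀ x ∈ Ioo (0 : ℝ) 1,
      Tendsto (fun n => pvTransform (V n) x) atTop (𝓝 (pvTransform v x)) := by
    intro x hx
    refine tendsto_integral_of_dominated_convergence (fun _ => 2 * L)
      (fun n => (measurable_cosKernel_right x).aestronglyMeasurable.mul
        ((hVL n).aestronglyMeasurable.sub aestronglyMeasurable_const)) (integrableOn_unit_const _)
      (fun n => ?_) (ae_of_all _ fun ξ => ((hVlim ξ).sub (hVlim x)).const_mul _)
    exact (ae_restrict_iff' measurableSet_Ioo).2 (ae_of_all _ fun ξ hξ =>
      (hVL n).abs_cosKernel_mul_le (Ioo_subset_Icc_self hx) (Ioo_subset_Icc_self hξ))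
  have lim2 : Tendsto (fun n => ∫ x in Ioo (0 : ℝ) 1, u x * pvTransform (V n) x) atTop
      (𝓝 (∫ x in Ioo (0 : ℝ) 1, u x * pvTransform v x)) := by
    refine tendsto_integral_of_dominated_convergence (fun x => ‖u x‖ * (2 * L))
      (fun n => hi.1.mul (holderOpen_pvTransform (hVL n).holderClosed.holderOpen
        (hVL n).holderClosed.integrableOn).aestronglyMeasurable) (hi.norm.mul_const _)
      (fun n => ?_) ?_
    · refine (ae_restrict_iff' measurableSet_Ioo).2 (ae_of_all _ fun x hx => ?_)
      rw [norm_mul]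
      exact mul_le_mul_of_nonneg_left ((hVL n).abs_pvTransform_le (Ioo_subset_Icc_self hx))
        (norm_nonneg _)
    · exact (ae_restrict_iff' measurableSet_Ioo).2 (ae_of_all _ fun x hx =>
        (limT x hx).const_mul _)
  simp only [heq] at lim1
  exact tendsto_nhds_unique lim1 lim2.neg

/-! ### Glauert's integral and the exchange of sine and cosine coefficients. -/

lemma pvTransform_const_mul (c : ℝ) (u : ℝ → ℝ) (x : ℝ) :
    pvTransform (fun ξ => c * u ξ) x = c * pvTransform u x := by
  unfold pvTransform
  rw [← integral_const_mul]
  refine integral_congr_ae (ae_of_all _ fun ξ => ?_)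
  simp only
  ring

lemma pvTransform_const (c x : ℝ) : pvTransform (fun _ => c) x = 0 := by
  simp [pvTransform]

lemma pvTransform_add {u v : ℝ → ℝ} (hu : HolderOpen u) (hui : IntegrableOn u (Ioo 0 1))
    (hv : HolderOpen v) (hvi : IntegrableOn v (Ioo 0 1)) {x : ℝ} (hx : x ∈ Ioo (0 : ℝ) 1) :
    pvTransform (fun ξ => u ξ + v ξ) x = pvTransform u x + pvTransform v x := by
  unfold pvTransform
  rw [← integral_add (integrableOn_pvTransform hu hui hx) (integrableOn_pvTransform hv hvi hx)]
  refine integral_congr_ae (ae_of_all _ fun ξ => ?_)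
  simp only
  ring

lemma pvTransform_sub {u v : ℝ → ℝ} (hu : HolderOpen u) (hui : IntegrableOn u (Ioo 0 1))
    (hv : HolderOpen v) (hvi : IntegrableOn v (Ioo 0 1)) {x : ℝ} (hx : x ∈ Ioo (0 : ℝ) 1) :
    pvTransform (fun ξ => u ξ - v ξ) x = pvTransform u x - pvTransform v x := by
  unfold pvTransform
  rw [← integral_sub (integrableOn_pvTransform hu hui hx) (integrableOn_pvTransform hv hvi hx)]
  refine integral_congr_ae (ae_of_all _ fun ξ => ?_)
  simp only
  ring

lemma ae_unit_ne (x : ℝ) : ∀ᵐ ξ ∂(volume.restrict (Ioo (0 : ℝ) 1)), ξ ≠ x :=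
  ae_restrict_of_ae (compl_mem_ae_iff.2 (measure_singleton x))

lemma cosLipschitz_cos_pi : CosLipschitz 1 (fun x => Real.cos (Real.pi * x)) :=
  fun x _ y _ => by rw [one_mul]

lemma cosLipschitz_const (c : ℝ) : CosLipschitz 0 (fun _ => c) :=
  fun x _ y _ => by simp

lemma setIntegral_cosKernel_mul_cos_sub (u : ℝ → ℝ) {x : ℝ} (hx : x ∈ Ioo (0 : ℝ) 1) :
    ∫ ξ in Ioo (0 : ℝ) 1,
      cosKernel x ξ * (Real.cos (Real.pi * x) - Real.cos (Real.pi * ξ)) * u ξ =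
      ∫ ξ in Ioo (0 : ℝ) 1, u ξ := by
  refine integral_congr_ae ?_
  filter_upwards [ae_unit_ne x, ae_restrict_mem measurableSet_Ioo] with ξ hne hξ
  rw [cosKernel, inv_mul_cancel₀
    (cos_sub_cos_ne (Ioo_subset_Icc_self hx) (Ioo_subset_Icc_self hξ) hne), one_mul]

/-- The factor cos πx - cos πξ of the commutator cancels the kernel exactly, leaving a constant.
This drives both the recurrence for Glauert's integral and the inversion for β = -1. -/
lemma pvTransform_mul_cos {u : ℝ → ℝ} (hu : HolderOpen u) (hi : IntegrableOn u (Ioo 0 1))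
    {x : ℝ} (hx : x ∈ Ioo (0 : ℝ) 1) :
    pvTransform (fun ξ => u ξ * Real.cos (Real.pi * ξ)) x =
      pvTransform u x * Real.cos (Real.pi * x) - ∫ ξ in Ioo (0 : ℝ) 1, u ξ := by
  rw [pvTransform_mul hu hi cosLipschitz_cos_pi hx, setIntegral_cosKernel_mul_cos_sub u hx]

lemma cos_add_two_mul (n : ℕ) (t : ℝ) : Real.cos (((n + 2 : ℕ) : ℝ) * t) =
    2 * (Real.cos (((n + 1 : ℕ) : ℝ) * t) * Real.cos t) - Real.cos ((n : ℝ) * t) := by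
  push_cast
  rw [show ((n : ℝ) + 2) * t = ((n : ℝ) + 1) * t + t by ring,
    show (n : ℝ) * t = ((n : ℝ) + 1) * t - t by ring, Real.cos_add, Real.cos_sub]
  ring

lemma sin_add_two_mul (n : ℕ) (t : ℝ) : Real.sin (((n + 2 : ℕ) : ℝ) * t) =
    2 * (Real.sin (((n + 1 : ℕ) : ℝ) * t) * Real.cos t) - Real.sin ((n : ℝ) * t) := by
  push_cast
  rw [show ((n : ℝ) + 2) * t = ((n : ℝ) + 1) * t + t by ring,
    show (n : ℝ) * t = ((n : ℝ) + 1) * t - t by ring, Real.sin_add, Real.sin_sub]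
  ring

/-- Chebyshev recurrence: cos nπx is a polynomial in cos πx. -/
lemma exists_cosLipschitz_cos (n : ℕ) :
    ∃ L, CosLipschitz L (fun x => Real.cos ((n : ℝ) * (Real.pi * x))) := by
  induction n using Nat.twoStepInduction with
  | zero => exact ⟨0, by simpa using cosLipschitz_const 1⟩
  | one => exact ⟨1, by simpa using cosLipschitz_cos_pi⟩
  | more n h0 h1 =>
    obtain ⟨L, hL⟩ := h0
    obtain ⟨M, hM⟩ := h1
    have := ((hM.mul cosLipschitz_cos_pi (A := 1) (B := 1) (fun x _ => Real.abs_cos_le_one _)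
      (fun x _ => Real.abs_cos_le_one _)).const_mul 2).sub hL
    simp only [← cos_add_two_mul] at this
    exact ⟨_, this⟩

lemma holderClosed_cos (n : ℕ) : HolderClosed (fun x => Real.cos ((n : ℝ) * (Real.pi * x))) :=
  (exists_cosLipschitz_cos n).choose_spec.holderClosed

lemma setIntegral_cos_eq_zero (n : ℕ) :
    ∫ x in Ioo (0 : ℝ) 1, Real.cos (((n + 1 : ℕ) : ℝ) * (Real.pi * x)) = 0 := by
  have hm : ((n + 1 : ℕ) : ℝ) * Real.pi ≠ 0 := by positivity
  rw [← integral_Ioc_eq_integral_Ioo, ← intervalIntegral.integral_of_le zero_le_one]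
  have hd : ∀ x ∈ uIcc (0 : ℝ) 1, HasDerivAt
      (fun x => Real.sin (((n + 1 : ℕ) : ℝ) * Real.pi * x) / (((n + 1 : ℕ) : ℝ) * Real.pi))
      (Real.cos (((n + 1 : ℕ) : ℝ) * (Real.pi * x))) x := by
    intro x _
    have h1 : HasDerivAt (fun x : ℝ => ((n + 1 : ℕ) : ℝ) * Real.pi * x)
        (((n + 1 : ℕ) : ℝ) * Real.pi * 1) x := (hasDerivAt_id x).const_mul _
    refine (h1.sin.div_const (((n + 1 : ℕ) : ℝ) * Real.pi)).congr_deriv ?_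
    rw [mul_one, mul_div_cancel_right₀ _ hm, mul_assoc]
  rw [intervalIntegral.integral_eq_sub_of_hasDerivAt hd
    (Continuous.intervalIntegrable (by fun_prop) _ _), mul_one, Real.sin_nat_mul_pi]
  simp

/-- Glauert's integral. -/
lemma pvTransform_cos (n : ℕ) {x : ℝ} (hx : x ∈ Ioo (0 : ℝ) 1) :
    pvTransform (fun ξ => Real.cos ((n : ℝ) * (Real.pi * ξ))) x =
      -(Real.sin ((n : ℝ) * (Real.pi * x)) / Real.sin (Real.pi * x)) := by
  have hs := (sin_pi_pos hx).ne'
  induction n using Nat.twoStepInduction with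
  | zero => simpa using pvTransform_const 1 x
  | one =>
    have h := setIntegral_cosKernel_mul_cos_sub (fun _ => -1) hx
    have : pvTransform (fun ξ => Real.cos (Real.pi * ξ)) x = -1 := by
      calc pvTransform (fun ξ => Real.cos (Real.pi * ξ)) x = ∫ ξ in Ioo (0 : ℝ) 1,
            cosKernel x ξ * (Real.cos (Real.pi * x) - Real.cos (Real.pi * ξ)) * -1 :=
            integral_congr_ae (ae_of_all _ fun ξ => by simp only; ring)
        _ = -1 := by rw [h]; simp
    simpa [hs] using this
  | more n h0 h1 =>
    have hc := holderClosed_cos n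
    have hc1 := holderClosed_cos (n + 1)
    have hc2 := hc1.mul cosLipschitz_cos_pi.holderClosed
    have hc3 := (holderClosed_const 2).mul hc2
    -- The Chebyshev recurrence passes through the transform, since cos (n+1)πξ has mean zero and
    -- the constant term drops out. The sines obey the same recurrence.
    simp only [cos_add_two_mul]
    rw [pvTransform_sub hc3.holderOpen hc3.integrableOn hc.holderOpen hc.integrableOn hx,
      pvTransform_const_mul, pvTransform_mul_cos hc1.holderOpen hc1.integrableOn hx, h0, h1,
      setIntegral_cos_eq_zero, sin_add_two_mul]
    field_simp
    ring

lemma sin_mul_sin_succ (n : ℕ) (t : ℝ) : Real.sin t * Real.sin (((n + 1 : ℕ) : ℝ) * t) =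
    1 / 2 * (Real.cos ((n : ℝ) * t) - Real.cos (((n + 2 : ℕ) : ℝ) * t)) := by
  push_cast
  rw [show (n : ℝ) * t = ((n : ℝ) + 1) * t - t by ring,
    show ((n : ℝ) + 2) * t = ((n : ℝ) + 1) * t + t by ring, Real.cos_add, Real.cos_sub]
  ring

lemma sin_mul_cos_succ (n : ℕ) (t : ℝ) : Real.sin t * Real.cos (((n + 1 : ℕ) : ℝ) * t) =
    1 / 2 * (Real.sin (((n + 2 : ℕ) : ℝ) * t) - Real.sin ((n : ℝ) * t)) := by
  push_cast
  rw [show (n : ℝ) * t = ((n : ℝ) + 1) * t - t by ring,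
    show ((n : ℝ) + 2) * t = ((n : ℝ) + 1) * t + t by ring, Real.sin_add, Real.sin_sub]
  ring

/-- As half a difference of two cosines, the product is Lipschitz in cos πx. It also vanishes at 0
and 1, so it is admissible in `integral_pvTransform_mul`. -/
lemma exists_cosLipschitz_sin_mul_sin (n : ℕ) : ∃ L, CosLipschitz L
    (fun x => Real.sin (Real.pi * x) * Real.sin (((n + 1 : ℕ) : ℝ) * (Real.pi * x))) := by
  obtain ⟨L, hL⟩ := exists_cosLipschitz_cos n
  obtain ⟨M, hM⟩ := exists_cosLipschitz_cos (n + 2)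
  simp only [sin_mul_sin_succ]
  exact ⟨_, (hL.sub hM).const_mul (1 / 2)⟩

lemma pvTransform_sin_mul_sin (n : ℕ) {x : ℝ} (hx : x ∈ Ioo (0 : ℝ) 1) :
    pvTransform (fun ξ => Real.sin (Real.pi * ξ) *
      Real.sin (((n + 1 : ℕ) : ℝ) * (Real.pi * ξ))) x =
      Real.cos (((n + 1 : ℕ) : ℝ) * (Real.pi * x)) := by
  have hs := (sin_pi_pos hx).ne'
  have hc := holderClosed_cos n
  have hc2 := holderClosed_cos (n + 2)
  simp only [sin_mul_sin_succ]
  rw [pvTransform_const_mul, pvTransform_sub hc.holderOpen hc.integrableOn hc2.holderOpen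
    hc2.integrableOn hx, pvTransform_cos n hx, pvTransform_cos (n + 2) hx]
  rw [← mul_div_cancel_left₀ (Real.cos (((n + 1 : ℕ) : ℝ) * (Real.pi * x))) hs,
    sin_mul_cos_succ n (Real.pi * x)]
  ring

lemma integrableOn_mul_bounded {g h : ℝ → ℝ} (hg : IntegrableOn g (Ioo 0 1)) (hh : Continuous h)
    (hb : ∀ x, |h x| ≤ 1) : IntegrableOn (fun x => g x * h x) (Ioo 0 1) :=
  Integrable.mul_bdd (c := 1) hg hh.aestronglyMeasurable (ae_of_all _ hb)

/-- Testing the transform against `sin πx · sin (n + 1)πx`. -/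
lemma integral_pvTransform_mul_sin_mul_sin {u : ℝ → ℝ} (hu : HolderOpen u)
    (hi : IntegrableOn u (Ioo 0 1)) (n : ℕ)
    (hint : IntegrableOn (fun x => pvTransform u x * (Real.sin (Real.pi * x) *
      Real.sin (((n + 1 : ℕ) : ℝ) * (Real.pi * x)))) (Ioo 0 1)) :
    ∫ x in Ioo (0 : ℝ) 1, pvTransform u x * (Real.sin (Real.pi * x) *
      Real.sin (((n + 1 : ℕ) : ℝ) * (Real.pi * x))) =
      -∫ x in Ioo (0 : ℝ) 1, u x * Real.cos (((n + 1 : ℕ) : ℝ) * (Real.pi * x)) := by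
  obtain ⟨L, hL⟩ := exists_cosLipschitz_sin_mul_sin n
  rw [integral_pvTransform_mul hu hi hL (by simp) (by simp) hint]
  congr 1
  exact setIntegral_unit_congr fun x hx => by rw [pvTransform_sin_mul_sin n hx]

/-- Sine coefficients of `sin πx · T φ`. -/
theorem integral_sin_mul_pvTransform_mul_sin {φ : ℝ → ℝ} (hφ : HolderOpen φ)
    (hi : IntegrableOn φ (Ioo 0 1))
    (hg : IntegrableOn (fun x => Real.sin (Real.pi * x) * pvTransform φ x) (Ioo 0 1)) (n : ℕ) :
    ∫ x in Ioo (0 : ℝ) 1, Real.sin (Real.pi * x) * pvTransform φ x *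
      Real.sin (((n + 1 : ℕ) : ℝ) * (Real.pi * x)) =
      -∫ x in Ioo (0 : ℝ) 1, φ x * Real.cos (((n + 1 : ℕ) : ℝ) * (Real.pi * x)) := by
  have e : ∀ x, Real.sin (Real.pi * x) * pvTransform φ x *
      Real.sin (((n + 1 : ℕ) : ℝ) * (Real.pi * x)) = pvTransform φ x * (Real.sin (Real.pi * x) *
      Real.sin (((n + 1 : ℕ) : ℝ) * (Real.pi * x))) := fun x => by ring
  have hint := integrableOn_mul_bounded hg
    (h := fun x => Real.sin (((n + 1 : ℕ) : ℝ) * (Real.pi * x))) (by fun_prop)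
    (fun x => Real.abs_sin_le_one _)
  simp only [e] at hint ⊢
  exact integral_pvTransform_mul_sin_mul_sin hφ hi n hint

lemma tendsto_setIntegral_exp {g : ℝ → ℝ} :
    Tendsto (fun n : ℕ => ∫ x in Ioo (0 : ℝ) 1,
      Complex.exp (-((n : ℂ) * (Real.pi * x)) * Complex.I) * (g x : ℂ)) atTop (𝓝 0) := by
  have h := Real.tendsto_integral_exp_smul_cocompact
    ((Ioo (0 : ℝ) 1).indicator fun x => (g x : ℂ))
  -- The Fourier character already contains the factor 2π, so frequency nπ corresponds to n/2.
  have hn : Tendsto (fun n : ℕ => (n : ℝ) / 2) atTop (cocompact ℝ) :=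
    (tendsto_natCast_atTop_atTop.atTop_div_const (by norm_num)).mono_right atTop_le_cocompact
  refine (h.comp hn).congr fun n => ?_
  simp only [Function.comp]
  rw [← integral_indicator measurableSet_Ioo]
  refine integral_congr_ae (ae_of_all _ fun x => ?_)
  by_cases hx : x ∈ Ioo (0 : ℝ) 1
  · simp only [indicator_of_mem hx, Circle.smul_def, Real.fourierChar_apply, smul_eq_mul]
    congr 2
    push_cast
    ring
  · simp [indicator_of_notMem hx]

lemma tendsto_setIntegral_mul_cos {g : ℝ → ℝ} (hg : IntegrableOn g (Ioo 0 1)) :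
    Tendsto (fun n : ℕ => ∫ x in Ioo (0 : ℝ) 1, g x * Real.cos ((n : ℝ) * (Real.pi * x)))
      atTop (𝓝 0) := by
  have h := (Complex.continuous_re.tendsto 0).comp (tendsto_setIntegral_exp (g := g))
  rw [Complex.zero_re] at h
  refine h.congr fun n => ?_
  have hi : IntegrableOn
      (fun x : ℝ => Complex.exp (-((n : ℂ) * (Real.pi * x)) * Complex.I) * (g x : ℂ)) (Ioo 0 1) :=
    Integrable.bdd_mul (c := 1) hg.ofReal (by fun_prop) (ae_of_all _ fun x => by
      rw [Complex.norm_exp]; simp)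
  simp only [Function.comp]
  have := integral_re hi
  simp only [RCLike.re_eq_complex_re] at this
  rw [← this]
  refine integral_congr_ae (ae_of_all _ fun x => ?_)
  have e : (-((n : ℂ) * (Real.pi * x)) * Complex.I) =
      ((-((n : ℝ) * (Real.pi * x)) : ℝ) : ℂ) * Complex.I := by push_cast; ring
  simp only [e, Complex.re_mul_ofReal, Complex.exp_ofReal_mul_I_re, Real.cos_neg]
  ring

lemma tendsto_setIntegral_mul_sin {g : ℝ → ℝ} (hg : IntegrableOn g (Ioo 0 1)) :
    Tendsto (fun n : ℕ => ∫ x in Ioo (0 : ℝ) 1, g x * Real.sin ((n : ℝ) * (Real.pi * x)))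
      atTop (𝓝 0) := by
  have h := ((Complex.continuous_im.tendsto 0).comp (tendsto_setIntegral_exp (g := g))).neg
  rw [Complex.zero_im, neg_zero] at h
  refine h.congr fun n => ?_
  have hi : IntegrableOn
      (fun x : ℝ => Complex.exp (-((n : ℂ) * (Real.pi * x)) * Complex.I) * (g x : ℂ)) (Ioo 0 1) :=
    Integrable.bdd_mul (c := 1) hg.ofReal (by fun_prop) (ae_of_all _ fun x => by
      rw [Complex.norm_exp]; simp)
  simp only [Function.comp]
  have := integral_im hi
  simp only [RCLike.im_eq_complex_im] at this
  rw [← this, ← integral_neg]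
  refine integral_congr_ae (ae_of_all _ fun x => ?_)
  have e : (-((n : ℂ) * (Real.pi * x)) * Complex.I) =
      ((-((n : ℝ) * (Real.pi * x)) : ℝ) : ℂ) * Complex.I := by push_cast; ring
  simp only [e, Complex.im_mul_ofReal, Complex.exp_ofReal_mul_I_im, Real.sin_neg]
  ring

/-- Cosine coefficients of `T (sin πx · φ)`. -/
theorem integral_pvTransform_sin_mul_mul_cos {φ : ℝ → ℝ} (hφ : HolderOpen φ)
    (hi : IntegrableOn φ (Ioo 0 1))
    (hg : IntegrableOn (pvTransform fun ξ => Real.sin (Real.pi * ξ) * φ ξ) (Ioo 0 1)) (n : ℕ) :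
    ∫ x in Ioo (0 : ℝ) 1, pvTransform (fun ξ => Real.sin (Real.pi * ξ) * φ ξ) x *
      Real.cos ((n : ℝ) * (Real.pi * x)) =
      ∫ x in Ioo (0 : ℝ) 1, φ x * Real.sin ((n : ℝ) * (Real.pi * x)) := by
  set g := pvTransform fun ξ => Real.sin (Real.pi * ξ) * φ ξ with hgdef
  set d : ℕ → ℝ := fun n => (∫ x in Ioo (0 : ℝ) 1, g x * Real.cos ((n : ℝ) * (Real.pi * x))) -
    ∫ x in Ioo (0 : ℝ) 1, φ x * Real.sin ((n : ℝ) * (Real.pi * x)) with hd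
  have hgc : ∀ n : ℕ, IntegrableOn (fun x => g x * Real.cos ((n : ℝ) * (Real.pi * x))) (Ioo 0 1) :=
    fun n => integrableOn_mul_bounded hg (by fun_prop) (fun x => Real.abs_cos_le_one _)
  have hφs : ∀ n : ℕ, IntegrableOn (fun x => φ x * Real.sin ((n : ℝ) * (Real.pi * x))) (Ioo 0 1) :=
    fun n => integrableOn_mul_bounded hi (by fun_prop) (fun x => Real.abs_sin_le_one _)
  have hu : HolderOpen (fun ξ => Real.sin (Real.pi * ξ) * φ ξ) := holderClosed_sin.holderOpen.mul hφ
  have hui : IntegrableOn (fun ξ => Real.sin (Real.pi * ξ) * φ ξ) (Ioo 0 1) := by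
    simpa only [mul_comm] using integrableOn_mul_bounded hi
      (h := fun x => Real.sin (Real.pi * x)) (by fun_prop) (fun x => Real.abs_sin_le_one _)
  -- Testing against sin πx · sin (n+1)πx controls only differences of coefficients two degrees
  -- apart. The Riemann–Lebesgue lemma then forces the defect d, constant along each parity class,
  -- to be zero; this includes n = 0.
  have hstep : ∀ n, d (n + 2) = d n := by
    intro n
    have e1 : ∀ x, g x * (Real.sin (Real.pi * x) *
        Real.sin (((n + 1 : ℕ) : ℝ) * (Real.pi * x))) =
        1 / 2 * (g x * Real.cos ((n : ℝ) * (Real.pi * x)) -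
          g x * Real.cos (((n + 2 : ℕ) : ℝ) * (Real.pi * x))) := fun x => by
      rw [sin_mul_sin_succ]; ring
    have e2 : ∀ x, Real.sin (Real.pi * x) * φ x *
        Real.cos (((n + 1 : ℕ) : ℝ) * (Real.pi * x)) =
        1 / 2 * (φ x * Real.sin (((n + 2 : ℕ) : ℝ) * (Real.pi * x)) -
          φ x * Real.sin ((n : ℝ) * (Real.pi * x))) := fun x => by
      rw [mul_right_comm, sin_mul_cos_succ]; ring
    have key := integral_pvTransform_mul_sin_mul_sin hu hui n (by
      simp only [← hgdef, e1]
      exact ((hgc n).sub (hgc (n + 2))).const_mul _)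
    simp only [← hgdef, e1, e2] at key
    rw [integral_const_mul, integral_const_mul, integral_sub (hgc n) (hgc (n + 2)),
      integral_sub (hφs (n + 2)) (hφs n)] at key
    simp only [hd]
    linarith
  have hlim : Tendsto d atTop (𝓝 0) := by
    simpa using (tendsto_setIntegral_mul_cos hg).sub (tendsto_setIntegral_mul_sin hi)
  have hconst : ∀ k, d (n + 2 * k) = d n := by
    intro k
    induction k with
    | zero => rfl
    | succ k ih => rw [← ih, ← hstep (n + 2 * k)]; rfl
  have hlim2 : Tendsto (fun k => d (n + 2 * k)) atTop (𝓝 0) :=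
    hlim.comp (tendsto_atTop_mono (fun k => (by omega : k ≤ n + 2 * k)) tendsto_id)
  simp only [hconst] at hlim2
  exact sub_eq_zero.1 (tendsto_nhds_unique tendsto_const_nhds hlim2)

/-! ### Test functions of cos πx and completeness of the trigonometric systems. -/

/-- Twice continuously differentiable functions with compact support in `(-1, 1)`. -/
def IsTestFunction (w : ℝ → ℝ) : Prop :=
  ContDiff ℝ 2 w ∧ ∃ s R : ℝ, 0 < R ∧ -1 < s - R ∧ s + R < 1 ∧ ∀ t, R ≤ |t - s| → w t = 0

lemma IsTestFunction.exists_support {w : ℝ → ℝ} (hw : IsTestFunction w) :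
    ∃ a b : ℝ, 0 < a ∧ a ≤ b ∧ b < 1 ∧
      ∀ x ∈ Icc (0 : ℝ) 1, x ∉ Icc a b → w (Real.cos (Real.pi * x)) = 0 := by
  obtain ⟨-, s, R, hR, h1, h2, hs⟩ := hw
  have hpi := Real.pi_pos
  refine ⟨Real.arccos (s + R) / Real.pi, Real.arccos (s - R) / Real.pi,
    div_pos (Real.arccos_pos.2 h2) hpi, ?_, ?_, fun x hx hxm => hs _ ?_⟩
  · exact div_le_div_of_nonneg_right (Real.antitone_arccos (by linarith)) hpi.le
  · rw [div_lt_one hpi]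
    exact lt_of_le_of_ne (Real.arccos_le_pi _) fun h => by
      rw [Real.arccos_eq_pi] at h
      linarith
  · by_contra! hlt
    rw [abs_lt] at hlt
    have hx' : Real.arccos (Real.cos (Real.pi * x)) = Real.pi * x :=
      Real.arccos_cos (mul_nonneg hpi.le hx.1) (mul_le_of_le_one_right hpi.le hx.2)
    refine hxm ⟨?_, ?_⟩
    · rw [div_le_iff₀' hpi, ← hx']
      exact Real.antitone_arccos (by linarith)
    · rw [le_div_iff₀' hpi, ← hx']
      exact Real.antitone_arccos (by linarith)

/-- If h were positive at x, a bump in the variable t = cos πx concentrated near cos πx would give a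
positive integral. Integrability of h up to the endpoints is not needed, which matters for the
duality argument. -/
lemma le_zero_of_forall_test {h : ℝ → ℝ} (hc : ContinuousOn h (Ioo 0 1))
    (H : ∀ w, IsTestFunction w → ∫ x in Ioo (0 : ℝ) 1, h x * w (Real.cos (Real.pi * x)) = 0)
    {x : ℝ} (hx : x ∈ Ioo (0 : ℝ) 1) : h x ≤ 0 := by
  by_contra! hpos
  have hpi := Real.pi_pos
  have hxc : Real.arccos (Real.cos (Real.pi * x)) / Real.pi = x := by
    rw [Real.arccos_cos (mul_nonneg hpi.le hx.1.le) (mul_le_of_le_one_right hpi.le hx.2.le)]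
    field_simp
  set s := Real.cos (Real.pi * x) with hs
  have hs1 : s ∈ Ioo (-1 : ℝ) 1 := by
    have hsin := sin_pi_pos hx
    have := Real.sin_sq_add_cos_sq (Real.pi * x)
    exact abs_lt.1 ((sq_lt_one_iff_abs_lt_one _).1 (by rw [hs]; nlinarith))
  have hcont : ContinuousAt (fun t => h (Real.arccos t / Real.pi)) s := by
    refine ContinuousAt.comp (f := fun t => Real.arccos t / Real.pi) ?_
      (Real.continuous_arccos.div_const _).continuousAt
    rw [hxc]
    exact hc.continuousAt (isOpen_Ioo.mem_nhds hx)
  have hev : ∀ᶠ t in 𝓝 s, 0 < h (Real.arccos t / Real.pi) ∧ t ∈ Ioo (-1 : ℝ) 1 :=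
    (hcont.eventually (lt_mem_nhds (by simpa only [hxc] using hpos))).and
      (isOpen_Ioo.mem_nhds hs1)
  obtain ⟨ρ, hρ, hball⟩ := Metric.eventually_nhds_iff.1 hev
  let w : ContDiffBump s := ⟨ρ / 3, ρ / 2, by positivity, by linarith⟩
  have hout : w.rOut = ρ / 2 := rfl
  have hwtest : IsTestFunction w := by
    refine ⟨w.contDiff, s, ρ / 2, by positivity, ?_, ?_, fun t ht => w.zero_of_le_dist ?_⟩
    · exact (hball (y := s - ρ / 2) (by
        rw [Real.dist_eq, sub_sub_cancel_left, abs_neg, abs_of_pos (by positivity)]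
        linarith)).2.1
    · exact (hball (y := s + ρ / 2) (by
        rw [Real.dist_eq, add_sub_cancel_left, abs_of_pos (by positivity)]
        linarith)).2.2
    · rw [hout, Real.dist_eq]
      exact ht
  obtain ⟨a, b, ha, -, hb, hsupp⟩ := hwtest.exists_support
  have hwc : Continuous fun x : ℝ => w (Real.cos (Real.pi * x)) :=
    w.continuous.comp (by fun_prop)
  have hint := integrableOn_mul_of_support hc hwc.continuousOn ha hb hsupp
  have hpos' : ∀ y ∈ Ioo (0 : ℝ) 1, w (Real.cos (Real.pi * y)) ≠ 0 → 0 < h y := by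
    intro y hy hne
    have hd : dist (Real.cos (Real.pi * y)) s < ρ := by
      by_contra! hle
      exact hne (w.zero_of_le_dist (by rw [hout]; linarith))
    have := (hball hd).1
    rwa [Real.arccos_cos (mul_nonneg hpi.le hy.1.le) (mul_le_of_le_one_right hpi.le hy.2.le),
      mul_div_cancel_left₀ _ hpi.ne'] at this
  have hnn : 0 ≤ᵐ[volume.restrict (Ioo (0 : ℝ) 1)]
      fun x => h x * w (Real.cos (Real.pi * x)) := by
    refine (ae_restrict_iff' measurableSet_Ioo).2 (ae_of_all _ fun y hy => ?_)
    by_cases hne : w (Real.cos (Real.pi * y)) = 0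
    · simp [hne]
    · exact mul_nonneg (hpos' y hy hne).le w.nonneg
  have hgt := (setIntegral_pos_iff_support_of_nonneg_ae hnn hint).2 (by
    have hopen : IsOpen (Ioo (0 : ℝ) 1 ∩ {y | 0 < w (Real.cos (Real.pi * y))}) :=
      isOpen_Ioo.inter (isOpen_lt continuous_const hwc)
    refine (hopen.measure_pos volume ⟨x, hx, w.pos_of_mem_ball ?_⟩).trans_le
      (measure_mono fun y hy => ⟨?_, hy.1⟩)
    · exact Metric.mem_ball_self w.rOut_pos
    · exact mul_ne_zero (hpos' y hy.1 (ne_of_gt hy.2)).ne' (ne_of_gt hy.2))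
  exact hgt.ne' (H w hwtest)

/-- A continuous function on `(0, 1)` that is orthogonal to all test functions vanishes. -/
lemma eq_zero_of_forall_test {h : ℝ → ℝ} (hc : ContinuousOn h (Ioo 0 1))
    (H : ∀ w, IsTestFunction w → ∫ x in Ioo (0 : ℝ) 1, h x * w (Real.cos (Real.pi * x)) = 0)
    {x : ℝ} (hx : x ∈ Ioo (0 : ℝ) 1) : h x = 0 := by
  refine le_antisymm (le_zero_of_forall_test hc H hx) ?_
  have := le_zero_of_forall_test (h := fun x => -h x) hc.neg (fun w hw => by
    simp only [neg_mul]
    rw [integral_neg, H w hw, neg_zero]) hx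
  linarith

/-- Multiplication by cos πx replaces cos nπx by the average of its two neighbours, so the induction
on k must let n vary. Degree n = 0 has no lower neighbour and simply becomes degree 1. -/
lemma setIntegral_mul_cos_pow_eq_zero {h : ℝ → ℝ} (hi : IntegrableOn h (Ioo 0 1))
    (H : ∀ n : ℕ, ∫ x in Ioo (0 : ℝ) 1, h x * Real.cos ((n : ℝ) * (Real.pi * x)) = 0) (k n : ℕ) :
    ∫ x in Ioo (0 : ℝ) 1,
      h x * (Real.cos (Real.pi * x) ^ k * Real.cos ((n : ℝ) * (Real.pi * x))) = 0 := by
  have hint : ∀ k n : ℕ, IntegrableOn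
      (fun x => h x * (Real.cos (Real.pi * x) ^ k * Real.cos ((n : ℝ) * (Real.pi * x))))
      (Ioo 0 1) := fun k n => integrableOn_mul_bounded hi (by fun_prop) fun x => by
    rw [abs_mul, abs_pow]
    exact mul_le_one₀ (pow_le_one₀ (abs_nonneg _) (Real.abs_cos_le_one _)) (abs_nonneg _)
      (Real.abs_cos_le_one _)
  induction k generalizing n with
  | zero => simpa using H n
  | succ k ih =>
    cases n with
    | zero =>
      have := ih 1
      simp only [Nat.cast_one, one_mul, Nat.cast_zero, zero_mul, Real.cos_zero, mul_one] at this ⊢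
      simpa only [pow_succ] using this
    | succ n =>
      have e : ∀ x, h x * (Real.cos (Real.pi * x) ^ (k + 1) *
          Real.cos (((n + 1 : ℕ) : ℝ) * (Real.pi * x))) =
          1 / 2 * (h x * (Real.cos (Real.pi * x) ^ k *
            Real.cos (((n + 2 : ℕ) : ℝ) * (Real.pi * x))) +
          h x * (Real.cos (Real.pi * x) ^ k * Real.cos ((n : ℝ) * (Real.pi * x)))) := fun x => by
        rw [cos_add_two_mul]
        ring
      simp only [e]
      rw [integral_const_mul, integral_add (hint k (n + 2)) (hint k n), ih, ih]
      simp

/-- Completeness of the cosines. -/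
theorem eq_zero_of_cos_coeff_eq_zero {h : ℝ → ℝ} (hc : ContinuousOn h (Ioo 0 1))
    (hi : IntegrableOn h (Ioo 0 1))
    (H : ∀ n : ℕ, ∫ x in Ioo (0 : ℝ) 1, h x * Real.cos ((n : ℝ) * (Real.pi * x)) = 0)
    {x : ℝ} (hx : x ∈ Ioo (0 : ℝ) 1) : h x = 0 := by
  refine eq_zero_of_forall_test hc (fun w hw => ?_) hx
  have hpow : ∀ k : ℕ, IntegrableOn (fun x => h x * Real.cos (Real.pi * x) ^ k) (Ioo 0 1) :=
    fun k => integrableOn_mul_bounded hi (by fun_prop) fun x => by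
      rw [abs_pow]
      exact pow_le_one₀ (abs_nonneg _) (Real.abs_cos_le_one _)
  have hpoly : ∀ p : Polynomial ℝ,
      IntegrableOn (fun x => h x * p.eval (Real.cos (Real.pi * x))) (Ioo 0 1) ∧
      ∫ x in Ioo (0 : ℝ) 1, h x * p.eval (Real.cos (Real.pi * x)) = 0 := by
    intro p
    have e : ∀ x, h x * p.eval (Real.cos (Real.pi * x)) =
        ∑ k ∈ Finset.range (p.natDegree + 1), p.coeff k * (h x * Real.cos (Real.pi * x) ^ k) := by
      intro x
      rw [Polynomial.eval_eq_sum_range, Finset.mul_sum]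
      exact Finset.sum_congr rfl fun k _ => by ring
    simp only [e]
    refine ⟨integrable_finsetSum _ fun k _ => (hpow k).const_mul _, ?_⟩
    rw [integral_finsetSum _ fun k _ => (hpow k).const_mul _]
    refine Finset.sum_eq_zero fun k _ => ?_
    have := setIntegral_mul_cos_pow_eq_zero hi H k 0
    simp only [Nat.cast_zero, zero_mul, Real.cos_zero, mul_one] at this
    rw [integral_const_mul, this, mul_zero]
  -- Weierstrass approximation of w on [-1, 1] by polynomials in t = cos πx, against which h
  -- integrates to zero.
  have hle : ∀ ε : ℝ, 0 < ε → |∫ x in Ioo (0 : ℝ) 1, h x * w (Real.cos (Real.pi * x))| ≤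
      ε * ∫ x in Ioo (0 : ℝ) 1, |h x| := by
    intro ε hε
    obtain ⟨p, hp⟩ := exists_polynomial_near_of_continuousOn (-1) 1 w
      hw.1.continuous.continuousOn ε hε
    have hb : ∀ x, |w (Real.cos (Real.pi * x)) - p.eval (Real.cos (Real.pi * x))| ≤ ε := fun x => by
      rw [abs_sub_comm]
      exact (hp _ ⟨Real.neg_one_le_cos _, Real.cos_le_one _⟩).le
    have hcont : Continuous fun x : ℝ =>
        w (Real.cos (Real.pi * x)) - p.eval (Real.cos (Real.pi * x)) :=
      (hw.1.continuous.comp (by fun_prop)).sub (p.continuous.comp (by fun_prop))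
    have i1 : IntegrableOn (fun x => h x *
        (w (Real.cos (Real.pi * x)) - p.eval (Real.cos (Real.pi * x)))) (Ioo 0 1) :=
      Integrable.mul_bdd (c := ε) hi hcont.aestronglyMeasurable (ae_of_all _ hb)
    have e : ∫ x in Ioo (0 : ℝ) 1, h x * w (Real.cos (Real.pi * x)) =
        ∫ x in Ioo (0 : ℝ) 1, h x *
          (w (Real.cos (Real.pi * x)) - p.eval (Real.cos (Real.pi * x))) := by
      have h2 := integral_add i1 (hpoly p).1
      rw [(hpoly p).2, add_zero] at h2
      rw [← h2]
      refine integral_congr_ae (ae_of_all _ fun x => ?_)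
      simp only
      ring
    rw [e, ← integral_const_mul, ← Real.norm_eq_abs]
    refine norm_integral_le_of_norm_le (hi.norm.const_mul ε) (ae_of_all _ fun x => ?_)
    rw [norm_mul, mul_comm]
    exact mul_le_mul_of_nonneg_right (hb x) (norm_nonneg _)
  have hlim : Tendsto (fun ε : ℝ => ε * ∫ x in Ioo (0 : ℝ) 1, |h x|) (𝓝[>] 0) (𝓝 0) := by
    have : Tendsto (fun ε : ℝ => ε * ∫ x in Ioo (0 : ℝ) 1, |h x|) (𝓝 0) (𝓝 (0 * _)) :=
      tendsto_id.mul_const _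
    rw [zero_mul] at this
    exact this.mono_left nhdsWithin_le_nhds
  exact abs_nonpos_iff.1 (ge_of_tendsto hlim (eventually_mem_nhdsWithin.mono hle))

/-- Completeness of the sines. -/
theorem eq_zero_of_sin_coeff_eq_zero {h : ℝ → ℝ} (hc : ContinuousOn h (Ioo 0 1))
    (hi : IntegrableOn h (Ioo 0 1))
    (H : ∀ n : ℕ, ∫ x in Ioo (0 : ℝ) 1, h x * Real.sin ((n : ℝ) * (Real.pi * x)) = 0)
    {x : ℝ} (hx : x ∈ Ioo (0 : ℝ) 1) : h x = 0 := by
  have hsc : Continuous fun x : ℝ => Real.sin (Real.pi * x) := by fun_prop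
  have hint : ∀ n : ℕ, IntegrableOn (fun x => h x * Real.sin ((n : ℝ) * (Real.pi * x))) (Ioo 0 1) :=
    fun n => integrableOn_mul_bounded hi (by fun_prop) fun x => Real.abs_sin_le_one _
  -- The cosine coefficients of h · sin πx are combinations of sine coefficients of h, which reduces
  -- the claim to completeness of the cosines.
  have key : h x * Real.sin (Real.pi * x) = 0 := by
    refine eq_zero_of_cos_coeff_eq_zero (h := fun x => h x * Real.sin (Real.pi * x))
      (hc.mul hsc.continuousOn)
      (integrableOn_mul_bounded hi hsc fun x => Real.abs_sin_le_one _) (fun n => ?_) hx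
    cases n with
    | zero => simpa using H 1
    | succ n =>
      have e : ∀ x, h x * Real.sin (Real.pi * x) *
          Real.cos (((n + 1 : ℕ) : ℝ) * (Real.pi * x)) =
          1 / 2 * (h x * Real.sin (((n + 2 : ℕ) : ℝ) * (Real.pi * x)) -
            h x * Real.sin ((n : ℝ) * (Real.pi * x))) := fun x => by
        rw [mul_assoc, sin_mul_cos_succ]; ring
      simp only [e]
      rw [integral_const_mul, integral_sub (hint (n + 2)) (hint n), H, H]
      simp
  exact (mul_eq_zero.1 key).resolve_right (sin_pi_pos hx).ne'

/-- A function whose cosine coefficients vanish in positive degree is constant. -/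
theorem eq_mean_of_cos_coeff_eq_zero {h : ℝ → ℝ} (hc : ContinuousOn h (Ioo 0 1))
    (hi : IntegrableOn h (Ioo 0 1))
    (H : ∀ n : ℕ, ∫ x in Ioo (0 : ℝ) 1,
      h x * Real.cos (((n + 1 : ℕ) : ℝ) * (Real.pi * x)) = 0)
    {x : ℝ} (hx : x ∈ Ioo (0 : ℝ) 1) : h x = ∫ y in Ioo (0 : ℝ) 1, h y := by
  set m := ∫ y in Ioo (0 : ℝ) 1, h y with hm
  refine sub_eq_zero.1 (eq_zero_of_cos_coeff_eq_zero (h := fun x => h x - m)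
    (hc.sub continuousOn_const) (hi.sub (integrableOn_unit_const m)) (fun n => ?_) hx)
  have e : ∀ n : ℕ, ∫ x in Ioo (0 : ℝ) 1, (h x - m) * Real.cos ((n : ℝ) * (Real.pi * x)) =
      (∫ x in Ioo (0 : ℝ) 1, h x * Real.cos ((n : ℝ) * (Real.pi * x))) -
        m * ∫ x in Ioo (0 : ℝ) 1, Real.cos ((n : ℝ) * (Real.pi * x)) := fun n => by
    simp only [sub_mul]
    rw [integral_sub, integral_const_mul]
    · exact integrableOn_mul_bounded hi (by fun_prop) fun x => Real.abs_cos_le_one _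
    · exact (holderClosed_cos n).integrableOn.const_mul m
  rw [e]
  cases n with
  | zero => simp [hm]
  | succ n => rw [H, setIntegral_cos_eq_zero, mul_zero, sub_zero]

/-! ### The inversion formula T(sin² · Tf) = -f + ∫ f. -/

lemma IsTestFunction.hasCompactSupport {w : ℝ → ℝ} (hw : IsTestFunction w) :
    HasCompactSupport w := by
  obtain ⟨-, s, R, -, -, -, hs⟩ := hw
  refine HasCompactSupport.of_support_subset_isCompact (isCompact_Icc (a := s - R) (b := s + R))
    fun t ht => ?_
  by_contra hm
  refine ht (hs t ?_)
  by_contra! hlt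
  rw [abs_lt] at hlt
  exact hm ⟨by linarith, by linarith⟩

lemma IsTestFunction.exists_cosLipschitz {w : ℝ → ℝ} (hw : IsTestFunction w) :
    ∃ L, CosLipschitz L (fun x => w (Real.cos (Real.pi * x))) := by
  obtain ⟨C, hC⟩ := ContDiff.lipschitzWith_of_hasCompactSupport hw.hasCompactSupport hw.1
    (by norm_num)
  exact ⟨C, fun x _ y _ => hC.dist_le_mul _ _⟩

/-- The divided difference is an average of w' along the segment from s to t, hence Lipschitz in s
because w' is Lipschitz. This is where C² is used; it makes T(w ∘ cos) Lipschitz in cos πx. -/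
lemma IsTestFunction.exists_abs_slope_sub_le {w : ℝ → ℝ} (hw : IsTestFunction w) :
    ∃ L : ℝ, 0 ≤ L ∧ ∀ s s' t : ℝ, t ≠ s → t ≠ s' →
      |(s - t)⁻¹ * (w t - w s) - (s' - t)⁻¹ * (w t - w s')| ≤ L * |s - s'| := by
  have h2 : ContDiff ℝ (1 + 1) w := by rw [one_add_one_eq_two]; exact hw.1
  have hd : ContDiff ℝ 1 (deriv w) := (contDiff_succ_iff_deriv.1 h2).2.2
  obtain ⟨C, hC⟩ := ContDiff.lipschitzWith_of_hasCompactSupport hw.hasCompactSupport.deriv hd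
    one_ne_zero
  have hslope : ∀ s t : ℝ, t ≠ s → (s - t)⁻¹ * (w t - w s) =
      -∫ τ in (0 : ℝ)..1, deriv w (s + τ * (t - s)) := by
    intro s t hne
    have h := intervalIntegral.integral_unitInterval_deriv_eq_sub (f := w) (f' := deriv w) (z₀ := s) (z₁ := t - s)
      (hd.continuous.comp (by fun_prop)).continuousOn
      (fun τ _ => ((hw.1.differentiable (by norm_num)) _).hasDerivAt)
    simp only [smul_eq_mul, add_sub_cancel] at h
    rw [← h, ← neg_sub t s, inv_neg, neg_mul, inv_mul_cancel_left₀ (sub_ne_zero.2 hne)]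
  refine ⟨C, C.2, fun s s' t h1 h2 => ?_⟩
  have hint : ∀ s : ℝ, IntervalIntegrable (fun τ : ℝ => deriv w (s + τ * (t - s))) volume 0 1 :=
    fun s => (hd.continuous.comp (by fun_prop)).intervalIntegrable _ _
  rw [hslope s t h1, hslope s' t h2, neg_sub_neg, ← intervalIntegral.integral_sub (hint _) (hint _)]
  have := intervalIntegral.norm_integral_le_of_norm_le_const (a := 0) (b := 1)
    (f := fun τ : ℝ => deriv w (s' + τ * (t - s')) - deriv w (s + τ * (t - s)))
    (C := C * |s - s'|) (fun τ hτ => ?_)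
  · simpa using this
  · rw [uIoc_of_le zero_le_one] at hτ
    refine (hC.dist_le_mul _ _).trans (mul_le_mul_of_nonneg_left ?_ C.2)
    rw [Real.dist_eq, show s' + τ * (t - s') - (s + τ * (t - s)) = (1 - τ) * (s' - s) by ring,
      abs_mul, abs_sub_comm s' s, abs_of_nonneg (by linarith [hτ.2])]
    exact mul_le_of_le_one_left (abs_nonneg _) (by linarith [hτ.1])

lemma CosLipschitz.integrableOn_kernel {L : ℝ} {v : ℝ → ℝ} (hv : CosLipschitz L v) {x : ℝ}
    (hx : x ∈ Icc (0 : ℝ) 1) : IntegrableOn (fun ξ => cosKernel x ξ * (v ξ - v x)) (Ioo 0 1) := by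
  refine Integrable.mono' (integrableOn_unit_const L)
    ((measurable_cosKernel_right x).aestronglyMeasurable.mul
      (hv.aestronglyMeasurable.sub aestronglyMeasurable_const)) ?_
  exact (ae_restrict_iff' measurableSet_Ioo).2 (ae_of_all _ fun ξ hξ =>
    hv.abs_cosKernel_mul_le hx (Ioo_subset_Icc_self hξ))

lemma CosLipschitz.integrableOn_pvTransform {L : ℝ} {v : ℝ → ℝ} (hv : CosLipschitz L v) :
    IntegrableOn (pvTransform v) (Ioo 0 1) := by
  refine Integrable.mono' (integrableOn_unit_const L) (holderOpen_pvTransform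
    hv.holderClosed.holderOpen hv.holderClosed.integrableOn).aestronglyMeasurable ?_
  exact (ae_restrict_iff' measurableSet_Ioo).2 (ae_of_all _ fun ξ hξ =>
    hv.abs_pvTransform_le (Ioo_subset_Icc_self hξ))

lemma IsTestFunction.exists_cosLipschitz_pvTransform {w : ℝ → ℝ} (hw : IsTestFunction w) :
    ∃ L, CosLipschitz L (pvTransform fun x => w (Real.cos (Real.pi * x))) := by
  obtain ⟨M, hM⟩ := hw.exists_cosLipschitz
  obtain ⟨L, hL0, hL⟩ := hw.exists_abs_slope_sub_le
  refine ⟨L, fun x hx y hy => ?_⟩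
  unfold pvTransform
  rw [← integral_sub (hM.integrableOn_kernel hx) (hM.integrableOn_kernel hy), ← Real.norm_eq_abs]
  refine (norm_integral_le_of_norm_le (integrableOn_unit_const
    (L * |Real.cos (Real.pi * x) - Real.cos (Real.pi * y)|)) ?_).trans (by simp)
  filter_upwards [ae_unit_ne x, ae_unit_ne y, ae_restrict_mem measurableSet_Ioo] with ξ h1 h2 hξ
  exact hL _ _ _ (sub_ne_zero.1 (cos_sub_cos_ne hx (Ioo_subset_Icc_self hξ) h1)).symm
    (sub_ne_zero.1 (cos_sub_cos_ne hy (Ioo_subset_Icc_self hξ) h2)).symm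

lemma IsTestFunction.exists_cosLipschitz_sin_sq_mul {w : ℝ → ℝ} (hw : IsTestFunction w) :
    ∃ L, CosLipschitz L (fun x => Real.sin (Real.pi * x) * (Real.sin (Real.pi * x) *
      pvTransform (fun x => w (Real.cos (Real.pi * x))) x)) := by
  obtain ⟨M, hM⟩ := hw.exists_cosLipschitz
  obtain ⟨L, hL⟩ := hw.exists_cosLipschitz_pvTransform
  obtain ⟨S, hS⟩ := exists_cosLipschitz_sin_mul_sin 0
  simp only [zero_add, Nat.cast_one, one_mul] at hS
  have := hS.mul hL (A := 1) (B := M) (fun x _ => by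
    rw [abs_mul]
    exact mul_le_one₀ (Real.abs_sin_le_one _) (abs_nonneg _) (Real.abs_sin_le_one _))
    (fun x hx => hM.abs_pvTransform_le hx)
  simp only [mul_assoc] at this
  exact ⟨_, this⟩

/-- Inversion of the transform for test functions. -/
lemma IsTestFunction.pvTransform_sin_sq_mul {w : ℝ → ℝ} (hw : IsTestFunction w) {x : ℝ}
    (hx : x ∈ Ioo (0 : ℝ) 1) :
    pvTransform (fun ξ => Real.sin (Real.pi * ξ) * (Real.sin (Real.pi * ξ) *
      pvTransform (fun x => w (Real.cos (Real.pi * x))) ξ)) x =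
      -w (Real.cos (Real.pi * x)) + ∫ y in Ioo (0 : ℝ) 1, w (Real.cos (Real.pi * y)) := by
  obtain ⟨M, hM⟩ := hw.exists_cosLipschitz
  obtain ⟨L, hL⟩ := hw.exists_cosLipschitz_pvTransform
  obtain ⟨N, hN⟩ := hw.exists_cosLipschitz_sin_sq_mul
  set v := fun x => w (Real.cos (Real.pi * x)) with hv
  have hvi := hM.holderClosed.integrableOn
  have hφ := holderClosed_sin.mul hL.holderClosed
  set g := pvTransform (fun ξ => Real.sin (Real.pi * ξ) * (Real.sin (Real.pi * ξ) *
      pvTransform v ξ)) with hg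
  have hgi : IntegrableOn g (Ioo 0 1) := hN.integrableOn_pvTransform
  have hgc : ContinuousOn g (Ioo 0 1) :=
    (holderOpen_pvTransform hN.holderClosed.holderOpen hN.holderClosed.integrableOn).continuousOn
  have hcos := integral_pvTransform_sin_mul_mul_cos hφ.holderOpen hφ.integrableOn hgi
  have h0 : ∫ y in Ioo (0 : ℝ) 1, g y = 0 := by simpa [← hg] using hcos 0
  -- Going from cosine to sine coefficients and back, the coefficients of g in positive degree are
  -- minus those of v. Hence g + v is constant, equal to the mean of v since g has mean 0.
  have hconst := eq_mean_of_cos_coeff_eq_zero (h := fun y => g y + v y)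
    (hgc.add (hM.holderClosed.continuousOn.mono Ioo_subset_Icc_self)) (hgi.add hvi)
    (fun n => by
      simp only [add_mul]
      rw [integral_add (integrableOn_mul_bounded hgi (by fun_prop) fun x => Real.abs_cos_le_one _)
        (integrableOn_mul_bounded hvi (by fun_prop) fun x => Real.abs_cos_le_one _), hcos,
        integral_sin_mul_pvTransform_mul_sin hM.holderClosed.holderOpen hvi hφ.integrableOn]
      ring) hx
  rw [integral_add hgi hvi, h0] at hconst
  linarith

lemma HolderClosed.exists_holderIneq {f : ℝ → ℝ} (hf : HolderClosed f) :
    ∃ C r : ℝ, 0 ≤ C ∧ 0 < r ∧ HolderIneq C r f (Icc 0 1) := by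
  obtain ⟨C, r, hC, hr, -, h⟩ := holderClosed_iff.1 hf
  exact ⟨C, r, hC, hr, h⟩

lemma abs_setIntegral_le_of_kernel_bound {k : ℝ → ℝ} {D r x : ℝ} (hr : 0 < r) (hD : 0 ≤ D)
    (hx : x ∈ Icc (0 : ℝ) 1) (hk : ∀ ξ ∈ Ioo (0 : ℝ) 1, |k ξ| ≤ D * |x - ξ| ^ (r - 1)) :
    |∫ ξ in Ioo (0 : ℝ) 1, k ξ| ≤ D * (2 / r) := by
  rw [← Real.norm_eq_abs]
  refine (norm_integral_le_of_norm_le ((integrableOn_abs_sub_rpow hr hx).const_mul D)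
    ((ae_restrict_iff' measurableSet_Ioo).2 (ae_of_all _ hk))).trans ?_
  rw [integral_const_mul]
  exact mul_le_mul_of_nonneg_left (setIntegral_abs_sub_rpow_le hr hx) hD

lemma abs_mul_le_of_abs_le_inv {k d C r t : ℝ} (hC : 0 ≤ C) (hk : |k| ≤ |t|⁻¹)
    (hd : |d| ≤ C * |t| ^ r) : |k * d| ≤ C * |t| ^ (r - 1) := by
  rw [abs_mul]
  calc |k| * |d| ≤ |t|⁻¹ * (C * |t| ^ r) :=
        mul_le_mul hk hd (abs_nonneg _) (inv_nonneg.2 (abs_nonneg _))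
    _ = C * (|t|⁻¹ * |t| ^ r) := by ring
    _ ≤ _ := mul_le_mul_of_nonneg_left (inv_abs_mul_rpow_le _ _) hC

/-- The factor sin πx absorbs the endpoint degeneration of the kernel, so the integrand is at most C
|x - ξ| ^ (r - 1), with integral bounded uniformly in x. -/
lemma HolderClosed.exists_abs_sin_mul_pvTransform_le {f : ℝ → ℝ} (hf : HolderClosed f) :
    ∃ M : ℝ, ∀ x ∈ Ioo (0 : ℝ) 1, |Real.sin (Real.pi * x) * pvTransform f x| ≤ M := by
  obtain ⟨C, r, hC, hr, h⟩ := hf.exists_holderIneq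
  refine ⟨C * (2 / r), fun x hx => ?_⟩
  have hx' := Ioo_subset_Icc_self hx
  rw [pvTransform, ← integral_const_mul]
  refine abs_setIntegral_le_of_kernel_bound hr hC hx' fun ξ hξ => ?_
  have hξ' := Ioo_subset_Icc_self hξ
  rw [← mul_assoc]
  refine abs_mul_le_of_abs_le_inv hC ?_ (abs_sub_comm (f x) (f ξ) ▸ h x hx' ξ hξ')
  rw [abs_mul, abs_of_nonneg (sin_pi_nonneg hx')]
  exact sin_left_mul_abs_cosKernel_le hx' hξ'

lemma HolderOpen.integrableOn_of_bounded {φ : ℝ → ℝ} (hφ : HolderOpen φ) {M : ℝ}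
    (hM : ∀ x ∈ Ioo (0 : ℝ) 1, |φ x| ≤ M) : IntegrableOn φ (Ioo 0 1) :=
  Integrable.mono' (integrableOn_unit_const M) hφ.aestronglyMeasurable
    ((ae_restrict_iff' measurableSet_Ioo).2 (ae_of_all _ hM))

lemma integrableOn_sin_mul {φ : ℝ → ℝ} (hi : IntegrableOn φ (Ioo 0 1)) :
    IntegrableOn (fun x => Real.sin (Real.pi * x) * φ x) (Ioo 0 1) := by
  simpa only [mul_comm] using integrableOn_mul_bounded hi
    (h := fun x => Real.sin (Real.pi * x)) (by fun_prop) (fun x => Real.abs_sin_le_one _)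

lemma HolderClosed.holderOpen_pvTransform {f : ℝ → ℝ} (hf : HolderClosed f) :
    HolderOpen (pvTransform f) :=
  _root_.holderOpen_pvTransform hf.holderOpen hf.integrableOn

/-- Inversion of the transform for Hölder continuous functions. -/
theorem HolderClosed.pvTransform_sin_sq_mul {f : ℝ → ℝ} (hf : HolderClosed f) {x : ℝ}
    (hx : x ∈ Ioo (0 : ℝ) 1) :
    pvTransform (fun ξ => Real.sin (Real.pi * ξ) * (Real.sin (Real.pi * ξ) * pvTransform f ξ)) x =
      -f x + ∫ y in Ioo (0 : ℝ) 1, f y := by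
  obtain ⟨M, hM⟩ := hf.exists_abs_sin_mul_pvTransform_le
  have hφ : HolderOpen (fun x => Real.sin (Real.pi * x) * pvTransform f x) :=
    holderClosed_sin.holderOpen.mul hf.holderOpen_pvTransform
  have hφi := hφ.integrableOn_of_bounded hM
  have hu := holderClosed_sin.holderOpen.mul hφ
  have hui := integrableOn_sin_mul hφi
  set u := fun ξ => Real.sin (Real.pi * ξ) * (Real.sin (Real.pi * ξ) * pvTransform f ξ) with hudef
  set m := ∫ y in Ioo (0 : ℝ) 1, f y with hm
  have hF := (_root_.holderOpen_pvTransform hu hui).continuousOn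
  have hfc : ContinuousOn f (Ioo 0 1) := hf.continuousOn.mono Ioo_subset_Icc_self
  suffices h : pvTransform u x + f x - m = 0 by linarith
  -- The coefficient argument would require T(sin² · Tf) to be integrable up to the endpoints.
  -- Testing against compactly supported v avoids this: two transpositions give ∫ T(sin² · Tf) v = ∫
  -- f · T(sin² · Tv), and the formula is already known for v.
  refine eq_zero_of_forall_test (h := fun x => pvTransform u x + f x - m)
    ((hF.add hfc).sub continuousOn_const) (fun w hw => ?_) hx
  obtain ⟨A, hA⟩ := hw.exists_cosLipschitz
  obtain ⟨B, hB⟩ := hw.exists_cosLipschitz_pvTransform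
  obtain ⟨N, hN⟩ := hw.exists_cosLipschitz_sin_sq_mul
  obtain ⟨a, b, ha, hab, hb, hsupp⟩ := hw.exists_support
  have hinv := fun {x : ℝ} (hx : x ∈ Ioo (0 : ℝ) 1) => hw.pvTransform_sin_sq_mul hx
  set v := fun x => w (Real.cos (Real.pi * x)) with hv
  have e1 := integral_pvTransform_mul_of_support hu hui hA ha hab hb hsupp
  have hswap : ∀ x, u x * pvTransform v x = pvTransform f x *
      (Real.sin (Real.pi * x) * (Real.sin (Real.pi * x) * pvTransform v x)) := fun x => by
    simp only [hudef]; ring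
  -- The second transposition tests Tf against sin² · Tv, which vanishes at the endpoints without
  -- compact support. The product is integrable because it equals (sin² · Tf) · Tv, an integrable
  -- function times a bounded one.
  have e2 := integral_pvTransform_mul hf.holderOpen hf.integrableOn hN (by simp) (by simp) (by
    simp only [← hswap]
    refine Integrable.mul_bdd (c := A) hui hB.aestronglyMeasurable ?_
    exact (ae_restrict_iff' measurableSet_Ioo).2 (ae_of_all _ fun x hx =>
      hA.abs_pvTransform_le (Ioo_subset_Icc_self hx)))
  have hfv : IntegrableOn (fun x => f x * v x) (Ioo 0 1) :=
    (hf.mul hA.holderClosed).integrableOn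
  have hFv : IntegrableOn (fun x => pvTransform u x * v x) (Ioo 0 1) :=
    integrableOn_mul_of_support hF hA.holderClosed.continuousOn ha hb hsupp
  have hvi := hA.holderClosed.integrableOn
  have e3 : ∫ x in Ioo (0 : ℝ) 1, f x * pvTransform (fun ξ => Real.sin (Real.pi * ξ) *
      (Real.sin (Real.pi * ξ) * pvTransform v ξ)) x =
      (∫ y in Ioo (0 : ℝ) 1, v y) * m - ∫ x in Ioo (0 : ℝ) 1, f x * v x := by
    rw [hm, ← integral_const_mul, ← integral_sub (hf.integrableOn.const_mul _) hfv]
    refine setIntegral_unit_congr fun x hx => ?_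
    rw [hinv hx]
    simp only [hv]
    ring
  simp only [hswap] at e1
  rw [e2, e3] at e1
  have e4 : ∀ x, (pvTransform u x + f x - m) * w (Real.cos (Real.pi * x)) =
      (pvTransform u x * v x + f x * v x) - m * v x := fun x => by simp only [hv]; ring
  simp only [e4]
  have hsum : IntegrableOn (fun x => pvTransform u x * v x + f x * v x) (Ioo 0 1) := hFv.add hfv
  rw [integral_sub hsum (hvi.const_mul m), integral_add hFv hfv, integral_const_mul, e1]
  ring

/-! ### Endpoint behaviour of T(sin · f). -/

lemma integrableOn_log_bound (M : ℝ) :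
    IntegrableOn (fun x : ℝ => M * (1 + |Real.log x| + |Real.log (1 - x)|)) (Ioo 0 1) := by
  have h1 : IntervalIntegrable Real.log volume 0 1 := intervalIntegral.intervalIntegrable_log'
  have h2 : IntervalIntegrable (fun x => Real.log (1 - x)) volume 0 1 := by
    have := (h1.comp_sub_left 1).symm
    simpa using this
  rw [intervalIntegrable_iff_integrableOn_Ioo_of_le zero_le_one] at h1 h2
  exact (((integrableOn_unit_const 1).add h1.norm).add h2.norm).const_mul M

lemma HolderOpen.integrableOn_of_log_bounded {φ : ℝ → ℝ} (hφ : HolderOpen φ) {M : ℝ}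
    (hM : ∀ x ∈ Ioo (0 : ℝ) 1, |φ x| ≤ M * (1 + |Real.log x| + |Real.log (1 - x)|)) :
    IntegrableOn φ (Ioo 0 1) :=
  Integrable.mono' (integrableOn_log_bound M) hφ.aestronglyMeasurable
    ((ae_restrict_iff' measurableSet_Ioo).2 (ae_of_all _ hM))

/-- The transform of `sin πx`. -/
lemma pvTransform_sin {x : ℝ} (hx : x ∈ Ioo (0 : ℝ) 1) :
    pvTransform (fun ξ => Real.sin (Real.pi * ξ)) x = 2 * (Real.pi⁻¹ *
      (Real.log (Real.sin (Real.pi * (1 - x) / 2)) - Real.log (Real.sin (Real.pi * x / 2)))) := by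
  have h := integral_half_cot (p := 0) (q := 1) (c := x) (fun ξ hξ => by
    rw [uIcc_of_le zero_le_one] at hξ
    exact sin_half_ne_zero (by linarith [hξ.1, hx.1]) (by linarith [hξ.2, hx.2]))
  rw [zero_add, show Real.pi * (1 + x) / 2 = Real.pi - Real.pi * (1 - x) / 2 by ring,
    Real.sin_pi_sub] at h
  rw [← h.2, intervalIntegral.integral_of_le zero_le_one, integral_Ioc_eq_integral_Ioo,
    ← integral_const_mul, pvTransform]
  refine integral_congr_ae ?_
  filter_upwards [ae_unit_ne x, ae_restrict_mem measurableSet_Ioo] with ξ hne hξ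
  -- The two kernel identities combine to K(x, ξ)(sin πξ - sin πx) = cot (π(ξ + x)/2), which has no
  -- singularity at ξ = x.
  have h1 := kernel_cot_sub hx hξ hne
  have h2 := kernel_cot_add hx hξ hne
  linarith

lemma abs_log_sin_half_le {x : ℝ} (hx : x ∈ Ioo (0 : ℝ) 1) :
    |Real.log (Real.sin (Real.pi * x / 2))| ≤ |Real.log x| := by
  have h1 : x ≤ Real.sin (Real.pi * x / 2) := by
    have h := abs_le_sin_half (t := x) (abs_le.2 ⟨by linarith [hx.1], hx.2.le⟩)
    have h0 : 0 ≤ Real.sin (Real.pi * x / 2) := Real.sin_nonneg_of_nonneg_of_le_pi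
      (by have := hx.1; positivity) (by nlinarith [Real.pi_pos, hx.2])
    rwa [abs_of_pos hx.1, abs_of_nonneg h0] at h
  have h2 := Real.log_le_log hx.1 h1
  have h3 : Real.log (Real.sin (Real.pi * x / 2)) ≤ 0 :=
    Real.log_nonpos (hx.1.le.trans h1) (Real.sin_le_one _)
  rw [abs_of_nonpos h3, abs_of_nonpos (h2.trans h3)]
  linarith

lemma one_sub_mem {x : ℝ} (hx : x ∈ Ioo (0 : ℝ) 1) : 1 - x ∈ Ioo (0 : ℝ) 1 :=
  ⟨by linarith [hx.2], by linarith [hx.1]⟩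

lemma abs_pvTransform_sin_le {x : ℝ} (hx : x ∈ Ioo (0 : ℝ) 1) :
    |pvTransform (fun ξ => Real.sin (Real.pi * ξ)) x| ≤ |Real.log x| + |Real.log (1 - x)| := by
  have hpi : 2 * Real.pi⁻¹ ≤ 1 := by
    rw [← div_eq_mul_inv, div_le_one Real.pi_pos]
    exact Real.two_le_pi
  rw [pvTransform_sin hx, ← mul_assoc, abs_mul, abs_of_nonneg (by positivity)]
  refine (mul_le_of_le_one_left (abs_nonneg _) hpi).trans ((abs_sub _ _).trans ?_)
  have h1 := abs_log_sin_half_le hx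
  have h2 := abs_log_sin_half_le (one_sub_mem hx)
  linarith

lemma HolderClosed.sin_mul {f : ℝ → ℝ} (hf : HolderClosed f) :
    HolderClosed (fun ξ => Real.sin (Real.pi * ξ) * f ξ) := holderClosed_sin.mul hf

/-- Up to a bounded error, `T (sin πx · f)` is `f · T (sin πx)`. -/
lemma HolderClosed.exists_abs_pvTransform_sin_mul_sub_le {f : ℝ → ℝ} (hf : HolderClosed f) :
    ∃ M : ℝ, 0 ≤ M ∧ ∀ x ∈ Ioo (0 : ℝ) 1,
      |pvTransform (fun ξ => Real.sin (Real.pi * ξ) * f ξ) x -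
        f x * pvTransform (fun ξ => Real.sin (Real.pi * ξ)) x| ≤ M := by
  obtain ⟨C, r, hC, hr, h⟩ := hf.exists_holderIneq
  refine ⟨C * (2 / r), by positivity, fun x hx => ?_⟩
  have hx' := Ioo_subset_Icc_self hx
  rw [pvTransform, pvTransform, ← integral_const_mul, ← integral_sub
    (integrableOn_pvTransform hf.sin_mul.holderOpen hf.sin_mul.integrableOn hx)
    ((integrableOn_pvTransform holderClosed_sin.holderOpen holderClosed_sin.integrableOn
      hx).const_mul _)]
  refine abs_setIntegral_le_of_kernel_bound hr hC hx' fun ξ hξ => ?_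
  have hξ' := Ioo_subset_Icc_self hξ
  -- After regrouping, the sine at ξ multiplies the kernel and only the increment of f remains, so
  -- the endpoint degeneration disappears.
  rw [show cosKernel x ξ * (Real.sin (Real.pi * ξ) * f ξ - Real.sin (Real.pi * x) * f x) -
      f x * (cosKernel x ξ * (Real.sin (Real.pi * ξ) - Real.sin (Real.pi * x))) =
      Real.sin (Real.pi * ξ) * cosKernel x ξ * (f ξ - f x) by ring]
  refine abs_mul_le_of_abs_le_inv hC ?_ (abs_sub_comm (f x) (f ξ) ▸ h x hx' ξ hξ')
  rw [abs_mul, abs_of_nonneg (sin_pi_nonneg hξ')]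
  exact sin_right_mul_abs_cosKernel_le hx' hξ'

lemma HolderClosed.exists_bound {f : ℝ → ℝ} (hf : HolderClosed f) :
    ∃ B : ℝ, 0 ≤ B ∧ ∀ x ∈ Icc (0 : ℝ) 1, |f x| ≤ B := by
  obtain ⟨B, hB⟩ := isCompact_Icc.exists_bound_of_continuousOn hf.continuousOn
  exact ⟨|B|, abs_nonneg _, fun x hx => (hB x hx).trans (le_abs_self _)⟩

lemma HolderClosed.exists_log_bound {f : ℝ → ℝ} (hf : HolderClosed f) :
    ∃ M : ℝ, 0 ≤ M ∧ ∀ x ∈ Ioo (0 : ℝ) 1,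
      |pvTransform (fun ξ => Real.sin (Real.pi * ξ) * f ξ) x| ≤
        M * (1 + |Real.log x| + |Real.log (1 - x)|) := by
  obtain ⟨M, hM0, hM⟩ := hf.exists_abs_pvTransform_sin_mul_sub_le
  obtain ⟨B, hB0, hB⟩ := hf.exists_bound
  refine ⟨M + B, by positivity, fun x hx => ?_⟩
  have h1 := hM x hx
  have h2 : |f x * pvTransform (fun ξ => Real.sin (Real.pi * ξ)) x| ≤
      B * (|Real.log x| + |Real.log (1 - x)|) := by
    rw [abs_mul]
    exact mul_le_mul (hB x (Ioo_subset_Icc_self hx)) (abs_pvTransform_sin_le hx) (abs_nonneg _) hB0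
  have h3 := abs_add_le (pvTransform (fun ξ => Real.sin (Real.pi * ξ) * f ξ) x -
    f x * pvTransform (fun ξ => Real.sin (Real.pi * ξ)) x)
    (f x * pvTransform (fun ξ => Real.sin (Real.pi * ξ)) x)
  rw [sub_add_cancel] at h3
  have h4 : 0 ≤ M * (|Real.log x| + |Real.log (1 - x)|) := by positivity
  nlinarith

/-- If `f` vanishes at the endpoints, then `T (sin πx · f)` is bounded. -/
lemma HolderClosed.exists_bound_of_endpoints {f : ℝ → ℝ} (hf : HolderClosed f) (h0 : f 0 = 0)
    (h1 : f 1 = 0) : ∃ M : ℝ, ∀ x ∈ Ioo (0 : ℝ) 1,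
      |pvTransform (fun ξ => Real.sin (Real.pi * ξ) * f ξ) x| ≤ M := by
  obtain ⟨M, hM0, hM⟩ := hf.exists_abs_pvTransform_sin_mul_sub_le
  obtain ⟨C, r, hC, hr, h⟩ := hf.exists_holderIneq
  refine ⟨M + (C * (1 / r) + C * (1 / r)), fun x hx => ?_⟩
  have hx' := Ioo_subset_Icc_self hx
  -- The Hölder decay of f at each endpoint outweighs the logarithm of T(sin) there. Each bound on
  -- |f| is used on all of (0, 1), so no localisation is needed.
  have hlog : ∀ t ∈ Ioo (0 : ℝ) 1, t ^ r * |Real.log t| ≤ 1 / r := fun t ht => by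
    have := (Real.abs_log_mul_self_rpow_lt t r ht.1 ht.2.le hr).le
    rwa [abs_mul, abs_of_nonneg (Real.rpow_nonneg ht.1.le r), mul_comm] at this
  have a0 : |f x| ≤ C * x ^ r := by
    have := h x hx' 0 (by simp)
    rwa [h0, sub_zero, sub_zero, abs_of_pos hx.1] at this
  have a1 : |f x| ≤ C * (1 - x) ^ r := by
    have := h x hx' 1 (by simp)
    rwa [h1, sub_zero, abs_sub_comm, abs_of_pos (one_sub_mem hx).1] at this
  have b0 : |f x| * |Real.log x| ≤ C * (1 / r) := by
    refine (mul_le_mul_of_nonneg_right a0 (abs_nonneg _)).trans ?_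
    rw [mul_assoc]
    exact mul_le_mul_of_nonneg_left (hlog x hx) hC
  have b1 : |f x| * |Real.log (1 - x)| ≤ C * (1 / r) := by
    refine (mul_le_mul_of_nonneg_right a1 (abs_nonneg _)).trans ?_
    rw [mul_assoc]
    exact mul_le_mul_of_nonneg_left (hlog _ (one_sub_mem hx)) hC
  have h2 : |f x * pvTransform (fun ξ => Real.sin (Real.pi * ξ)) x| ≤
      C * (1 / r) + C * (1 / r) := by
    rw [abs_mul]
    refine (mul_le_mul_of_nonneg_left (abs_pvTransform_sin_le hx) (abs_nonneg _)).trans ?_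
    linarith [mul_add |f x| |Real.log x| |Real.log (1 - x)|]
  have h3 := abs_add_le (pvTransform (fun ξ => Real.sin (Real.pi * ξ) * f ξ) x -
    f x * pvTransform (fun ξ => Real.sin (Real.pi * ξ)) x)
    (f x * pvTransform (fun ξ => Real.sin (Real.pi * ξ)) x)
  rw [sub_add_cancel] at h3
  linarith [hM x hx]

lemma eq_zero_of_tendsto_of_mul_bounded {l : Filter ℝ} [l.NeBot] {f k : ℝ → ℝ} {c B : ℝ}
    (hf : Tendsto f l (𝓝 c)) (hk : Tendsto (fun x => |k x|) l atTop)
    (hB : ∀ᶠ x in l, |f x * k x| ≤ B) : c = 0 := by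
  have h1 : Tendsto (fun x => B / |k x|) l (𝓝 0) := hk.const_div_atTop B
  have h2 : Tendsto f l (𝓝 0) := by
    refine squeeze_zero_norm' ?_ h1
    filter_upwards [hB, hk.eventually_gt_atTop 0] with x hx hpos
    rw [le_div_iff₀ hpos, Real.norm_eq_abs, ← abs_mul]
    exact hx
  exact tendsto_nhds_unique hf h2

lemma tendsto_log_sin_half_zero :
    Tendsto (fun x => Real.log (Real.sin (Real.pi * x / 2))) (𝓝[>] 0) atBot := by
  refine Real.tendsto_log_nhdsGT_zero.comp (tendsto_nhdsWithin_iff.2 ⟨?_, ?_⟩)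
  · have : Continuous fun x : ℝ => Real.sin (Real.pi * x / 2) := by fun_prop
    have h := this.tendsto 0
    simp only [mul_zero, zero_div, Real.sin_zero] at h
    exact h.mono_left nhdsWithin_le_nhds
  · filter_upwards [Ioo_mem_nhdsGT one_pos] with x hx
    exact Real.sin_pos_of_pos_of_lt_pi (by have := hx.1; positivity)
      (by nlinarith [Real.pi_pos, hx.2])

lemma tendsto_log_sin_half_one :
    Tendsto (fun x => Real.log (Real.sin (Real.pi * (1 - x) / 2))) (𝓝[>] 0) (𝓝 0) := by
  have : ContinuousAt (fun x : ℝ => Real.log (Real.sin (Real.pi * (1 - x) / 2))) 0 :=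
    ContinuousAt.log (by fun_prop) (by simp)
  have h := this.tendsto
  simp only [sub_zero, mul_one, Real.sin_pi_div_two, Real.log_one] at h
  exact h.mono_left nhdsWithin_le_nhds

lemma tendsto_abs_pvTransform_sin_zero :
    Tendsto (fun x => |pvTransform (fun ξ => Real.sin (Real.pi * ξ)) x|) (𝓝[>] 0) atTop := by
  have h : Tendsto (fun x => 2 * (Real.pi⁻¹ * (Real.log (Real.sin (Real.pi * (1 - x) / 2)) +
      -Real.log (Real.sin (Real.pi * x / 2))))) (𝓝[>] 0) atTop :=
    ((tendsto_log_sin_half_one.add_atTop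
      (tendsto_neg_atBot_atTop.comp tendsto_log_sin_half_zero)).const_mul_atTop
      (inv_pos.2 Real.pi_pos)).const_mul_atTop two_pos
  refine (tendsto_abs_atTop_atTop.comp h).congr' ?_
  filter_upwards [Ioo_mem_nhdsGT one_pos] with x hx
  rw [pvTransform_sin hx, Function.comp, ← sub_eq_add_neg]

lemma tendsto_one_sub_nhdsLT : Tendsto (fun x : ℝ => 1 - x) (𝓝[>] 0) (𝓝[<] 1) := by
  refine tendsto_nhdsWithin_iff.2 ⟨?_, ?_⟩
  · have h : Tendsto (fun x : ℝ => 1 - x) (𝓝 0) (𝓝 (1 - 0)) := tendsto_const_nhds.sub tendsto_id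
    rw [sub_zero] at h
    exact h.mono_left nhdsWithin_le_nhds
  · filter_upwards [self_mem_nhdsWithin] with x hx
    have : (0 : ℝ) < x := hx
    exact (by linarith : 1 - x < 1)

/-- If `T (sin πx · f)` is bounded, then `f` vanishes at the endpoints. -/
lemma HolderClosed.endpoints_eq_zero {f : ℝ → ℝ} (hf : HolderClosed f) {B : ℝ}
    (hB : ∀ x ∈ Ioo (0 : ℝ) 1, |pvTransform (fun ξ => Real.sin (Real.pi * ξ) * f ξ) x| ≤ B) :
    f 0 = 0 ∧ f 1 = 0 := by
  obtain ⟨M, -, hM⟩ := hf.exists_abs_pvTransform_sin_mul_sub_le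
  have hbd : ∀ x ∈ Ioo (0 : ℝ) 1,
      |f x * pvTransform (fun ξ => Real.sin (Real.pi * ξ)) x| ≤ B + M := fun x hx => by
    have := abs_sub (pvTransform (fun ξ => Real.sin (Real.pi * ξ) * f ξ) x)
      (pvTransform (fun ξ => Real.sin (Real.pi * ξ) * f ξ) x -
        f x * pvTransform (fun ξ => Real.sin (Real.pi * ξ)) x)
    rw [sub_sub_cancel] at this
    linarith [hM x hx, hB x hx]
  have hI : ∀ᶠ x : ℝ in 𝓝[>] 0, x ∈ Ioo (0 : ℝ) 1 := Ioo_mem_nhdsGT one_pos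
  constructor
  · refine eq_zero_of_tendsto_of_mul_bounded (l := 𝓝[>] 0) (f := f) (B := B + M) ?_
      tendsto_abs_pvTransform_sin_zero (hI.mono hbd)
    have h := hf.continuousOn 0 (by simp)
    exact h.mono_left (nhdsWithin_le_of_mem
      (mem_of_superset (Ioo_mem_nhdsGT one_pos) Ioo_subset_Icc_self))
  · refine eq_zero_of_tendsto_of_mul_bounded (l := 𝓝[>] 0) (f := fun x => f (1 - x)) (B := B + M)
      (k := fun x => pvTransform (fun ξ => Real.sin (Real.pi * ξ)) (1 - x)) ?_ ?_
      (hI.mono fun x hx => hbd _ (one_sub_mem hx))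
    · have h := hf.continuousOn 1 (by simp)
      refine (h.mono_left (nhdsWithin_le_of_mem
        (mem_of_superset (Ioo_mem_nhdsLT one_pos) Ioo_subset_Icc_self))).comp
        tendsto_one_sub_nhdsLT
    -- T(sin) is odd under x ↦ 1 - x, so its blow-up at 1 mirrors the one at 0.
    · refine tendsto_abs_pvTransform_sin_zero.congr' ?_
      filter_upwards [hI] with x hx
      rw [pvTransform_sin hx, pvTransform_sin (one_sub_mem hx), sub_sub_cancel, ← neg_sub (Real.log
        (Real.sin (Real.pi * (1 - x) / 2))), mul_neg, mul_neg, abs_neg]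

/-! ### Inversion for β = -1 and translation of the equation into the transform. -/

/-- Inversion for the kernel with `β = -1`. -/
theorem HolderClosed.sin_mul_pvTransform_pvTransform {f : ℝ → ℝ} (hf : HolderClosed f) {x : ℝ}
    (hx : x ∈ Ioo (0 : ℝ) 1) :
    Real.sin (Real.pi * x) *
      pvTransform (pvTransform fun ξ => Real.sin (Real.pi * ξ) * f ξ) x = -f x := by
  obtain ⟨M, -, hM⟩ := hf.exists_log_bound
  have hinv := hf.sin_mul.pvTransform_sin_sq_mul hx
  have hg := hf.sin_mul.holderOpen_pvTransform
  have hgi := hg.integrableOn_of_log_bounded hM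
  have hcoef := integral_pvTransform_sin_mul_mul_cos hf.holderOpen hf.integrableOn hgi
  set g := pvTransform fun ξ => Real.sin (Real.pi * ξ) * f ξ with hgdef
  have m0 : ∫ y in Ioo (0 : ℝ) 1, g y = 0 := by simpa using hcoef 0
  have m1 : ∫ y in Ioo (0 : ℝ) 1, g y * Real.cos (Real.pi * y) =
      ∫ y in Ioo (0 : ℝ) 1, Real.sin (Real.pi * y) * f y := by
    simpa [mul_comm] using hcoef 1
  have hcos := cosLipschitz_cos_pi.holderClosed.holderOpen
  have hgc : HolderOpen fun ξ => g ξ * Real.cos (Real.pi * ξ) := hg.mul hcos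
  have hgci : IntegrableOn (fun ξ => g ξ * Real.cos (Real.pi * ξ)) (Ioo 0 1) :=
    integrableOn_mul_bounded hgi (by fun_prop) fun x => Real.abs_cos_le_one _
  have hgcc : HolderOpen fun ξ => g ξ * Real.cos (Real.pi * ξ) * Real.cos (Real.pi * ξ) :=
    hgc.mul hcos
  have hgcci : IntegrableOn
      (fun ξ => g ξ * Real.cos (Real.pi * ξ) * Real.cos (Real.pi * ξ)) (Ioo 0 1) :=
    integrableOn_mul_bounded hgci (by fun_prop) fun x => Real.abs_cos_le_one _
  -- Write sin² = 1 - cos² and pull both cosines out of the transform. The corrections are the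
  -- moments ∫ g = 0 and ∫ g cos = ∫ sin · f; the latter cancels the mean in the inversion formula
  -- for sin · f, leaving sin² · Tg = -sin · f.
  have e : ∀ ξ, Real.sin (Real.pi * ξ) * (Real.sin (Real.pi * ξ) * g ξ) =
      g ξ - g ξ * Real.cos (Real.pi * ξ) * Real.cos (Real.pi * ξ) := fun ξ => by
    linear_combination g ξ * Real.sin_sq_add_cos_sq (Real.pi * ξ)
  simp only [e] at hinv
  rw [pvTransform_sub hg hgi hgcc hgcci hx, pvTransform_mul_cos hgc hgci hx,
    pvTransform_mul_cos hg hgi hx, m0, m1] at hinv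
  have hs := (sin_pi_pos hx).ne'
  refine mul_left_cancel₀ hs ?_
  linear_combination hinv + pvTransform g x * Real.sin_sq_add_cos_sq (Real.pi * x)

lemma HasPrincipalValue.congr {g h : ℝ → ℝ} {x L : ℝ} (hg : HasPrincipalValue g x L)
    (e : ∀ ξ ∈ Ioo (0 : ℝ) 1, ξ ≠ x → g ξ = h ξ) : HasPrincipalValue h x L := by
  have he : ∀ ε : ℝ, 0 < ε → EqOn g h (Ioo 0 1 \ Ioo (x - ε) (x + ε)) := fun ε hε ξ hξ =>
    e ξ hξ.1 (by rintro rfl; exact hξ.2 ⟨by linarith, by linarith⟩)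
  refine ⟨fun ε hε => (hg.1 ε hε).congr_fun (he ε hε) (measurableSet_truncated x ε),
    hg.2.congr' ?_⟩
  filter_upwards [self_mem_nhdsWithin] with ε hε
  exact setIntegral_congr_fun (measurableSet_truncated x ε) (he ε hε)

lemma HasPrincipalValue.const_mul {g : ℝ → ℝ} {x L : ℝ} (hg : HasPrincipalValue g x L) (c : ℝ) :
    HasPrincipalValue (fun ξ => c * g ξ) x (c * L) := by
  refine ⟨fun ε hε => (hg.1 ε hε).const_mul c, ?_⟩
  simp only [integral_const_mul]
  exact hg.2.const_mul c

lemma HasPrincipalValue.unique {g : ℝ → ℝ} {x L L' : ℝ} (h : HasPrincipalValue g x L)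
    (h' : HasPrincipalValue g x L') : L = L' :=
  tendsto_nhds_unique h.2 h'.2

lemma hasPrincipalValue_kernelS_one {φ : ℝ → ℝ} (hφ : HolderOpen φ) (hi : IntegrableOn φ (Ioo 0 1))
    {x : ℝ} (hx : x ∈ Ioo (0 : ℝ) 1) : HasPrincipalValue (fun ξ => kernelS 1 x ξ * φ ξ) x
      (pvTransform (fun ξ => Real.sin (Real.pi * ξ) * φ ξ) x) := by
  refine (hasPrincipalValue_cosKernel_mul (holderClosed_sin.holderOpen.mul hφ)
    (integrableOn_sin_mul hi) hx).congr fun ξ hξ hne => ?_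
  have := kernel_cot_add hx hξ hne
  rw [kernelS]
  linear_combination -(1 / 2) * φ ξ * this

lemma hasPrincipalValue_kernelS_neg_one {φ : ℝ → ℝ} (hφ : HolderOpen φ)
    (hi : IntegrableOn φ (Ioo 0 1)) {x : ℝ} (hx : x ∈ Ioo (0 : ℝ) 1) :
    HasPrincipalValue (fun ξ => kernelS (-1) x ξ * φ ξ) x
      (Real.sin (Real.pi * x) * pvTransform φ x) := by
  refine ((hasPrincipalValue_cosKernel_mul hφ hi hx).const_mul _).congr fun ξ hξ hne => ?_
  have := kernel_cot_sub hx hξ hne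
  rw [kernelS]
  linear_combination -(1 / 2) * φ ξ * this

lemma satisfiesCharacteristicEq_one_iff {f φ : ℝ → ℝ} (hφ : HolderOpen φ)
    (hi : IntegrableOn φ (Ioo 0 1)) : SatisfiesCharacteristicEq 1 f φ ↔
      ∀ x ∈ Ioo (0 : ℝ) 1, pvTransform (fun ξ => Real.sin (Real.pi * ξ) * φ ξ) x = f x := by
  refine forall₂_congr fun x hx => ?_
  have h := hasPrincipalValue_kernelS_one hφ hi hx
  exact ⟨fun h' => h.unique h', fun e => e ▸ h⟩

lemma satisfiesCharacteristicEq_neg_one_iff {f φ : ℝ → ℝ} (hφ : HolderOpen φ)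
    (hi : IntegrableOn φ (Ioo 0 1)) : SatisfiesCharacteristicEq (-1) f φ ↔
      ∀ x ∈ Ioo (0 : ℝ) 1, Real.sin (Real.pi * x) * pvTransform φ x = f x := by
  refine forall₂_congr fun x hx => ?_
  have h := hasPrincipalValue_kernelS_neg_one hφ hi hx
  exact ⟨fun h' => h.unique h', fun e => e ▸ h⟩

/-- The kernel of the inverse for β is twice `kernelS (-β)`, so the inverse for each of the two
values is minus the operator of the other equation. -/
lemma HolderClosed.isHilbertInverse_one {f : ℝ → ℝ} (hf : HolderClosed f) :
    IsHilbertInverse 1 f (fun x => -(Real.sin (Real.pi * x) * pvTransform f x)) := by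
  intro x hx
  refine ⟨2 * (Real.sin (Real.pi * x) * pvTransform f x),
    ((hasPrincipalValue_kernelS_neg_one hf.holderOpen hf.integrableOn hx).const_mul 2).congr
      fun ξ _ _ => ?_, by ring⟩
  rw [kernelS]
  ring

lemma HolderClosed.isHilbertInverse_neg_one {f : ℝ → ℝ} (hf : HolderClosed f) :
    IsHilbertInverse (-1) f
      (fun x => -pvTransform (fun ξ => Real.sin (Real.pi * ξ) * f ξ) x) := by
  intro x hx
  refine ⟨2 * pvTransform (fun ξ => Real.sin (Real.pi * ξ) * f ξ) x,
    ((hasPrincipalValue_kernelS_one hf.holderOpen hf.integrableOn hx).const_mul 2).congr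
      fun ξ _ _ => ?_, by ring⟩
  rw [kernelS]
  ring

/-! ### Solutions: existence, uniqueness and solvability conditions. -/

lemma HolderOpen.neg {φ : ℝ → ℝ} (h : HolderOpen φ) : HolderOpen (fun x => -φ x) := by
  simpa using (holderClosed_const (-1)).holderOpen.mul h

lemma pvTransform_neg (u : ℝ → ℝ) (x : ℝ) :
    pvTransform (fun ξ => -u ξ) x = -pvTransform u x := by
  simpa using pvTransform_const_mul (-1) u x

lemma IsBoundedSolution.integrableOn {β : ℝ} {f φ : ℝ → ℝ} (h : IsBoundedSolution β f φ) :
    IntegrableOn φ (Ioo 0 1) :=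
  h.1.integrableOn_of_bounded h.2.1.choose_spec

lemma IsAlmostBoundedSolution.integrableOn {β : ℝ} {f φ : ℝ → ℝ}
    (h : IsAlmostBoundedSolution β f φ) : IntegrableOn φ (Ioo 0 1) :=
  h.1.integrableOn_of_log_bounded h.2.1.choose_spec

lemma IsBoundedSolution.isAlmostBoundedSolution {β : ℝ} {f φ : ℝ → ℝ}
    (h : IsBoundedSolution β f φ) : IsAlmostBoundedSolution β f φ := by
  obtain ⟨h1, ⟨M, hM⟩, h2⟩ := h
  refine ⟨h1, ⟨M, fun x hx => (hM x hx).trans (le_mul_of_one_le_right ?_ ?_)⟩, h2⟩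
  · exact (abs_nonneg _).trans (hM x hx)
  · linarith [abs_nonneg (Real.log x), abs_nonneg (Real.log (1 - x))]

/-- For `β = 1`, the sine coefficients of a bounded solution are the cosine coefficients of `f`. -/
lemma IsBoundedSolution.sin_coeff {f φ : ℝ → ℝ} (hf : HolderClosed f)
    (h : IsBoundedSolution 1 f φ) (n : ℕ) :
    ∫ x in Ioo (0 : ℝ) 1, φ x * Real.sin ((n : ℝ) * (Real.pi * x)) =
      ∫ x in Ioo (0 : ℝ) 1, f x * Real.cos ((n : ℝ) * (Real.pi * x)) := by
  have hi := h.integrableOn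
  have hs := (satisfiesCharacteristicEq_one_iff h.1 hi).1 h.2.2
  rw [← integral_pvTransform_sin_mul_mul_cos h.1 hi
    (hf.integrableOn.congr_fun (fun x hx => (hs x hx).symm) measurableSet_Ioo)]
  exact setIntegral_unit_congr fun x hx => by rw [hs x hx]

lemma HolderClosed.isBoundedSolution_one {f : ℝ → ℝ} (hf : HolderClosed f)
    (h0 : ∫ x in Ioo (0 : ℝ) 1, f x = 0) :
    IsBoundedSolution 1 f (fun x => -(Real.sin (Real.pi * x) * pvTransform f x)) := by
  obtain ⟨M, hM⟩ := hf.exists_abs_sin_mul_pvTransform_le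
  have hφ : HolderOpen (fun x => -(Real.sin (Real.pi * x) * pvTransform f x)) :=
    (holderClosed_sin.holderOpen.mul hf.holderOpen_pvTransform).neg
  have hM' : ∀ x ∈ Ioo (0 : ℝ) 1, |-(Real.sin (Real.pi * x) * pvTransform f x)| ≤ M :=
    fun x hx => by rw [abs_neg]; exact hM x hx
  refine ⟨hφ, ⟨M, hM'⟩, (satisfiesCharacteristicEq_one_iff hφ
    (hφ.integrableOn_of_bounded hM')).2 fun x hx => ?_⟩
  simp only [mul_neg]
  rw [pvTransform_neg, hf.pvTransform_sin_sq_mul hx, h0]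
  ring

lemma IsBoundedSolution.eqOn_of_one {f φ ψ : ℝ → ℝ} (hf : HolderClosed f)
    (hφ : IsBoundedSolution 1 f φ) (hψ : IsBoundedSolution 1 f ψ) : EqOn ψ φ (Ioo 0 1) := by
  intro x hx
  refine sub_eq_zero.1 (eq_zero_of_sin_coeff_eq_zero (h := fun x => ψ x - φ x)
    (hψ.1.continuousOn.sub hφ.1.continuousOn) (hψ.integrableOn.sub hφ.integrableOn)
    (fun n => ?_) hx)
  simp only [sub_mul]
  rw [integral_sub, hψ.sin_coeff hf, hφ.sin_coeff hf, sub_self]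
  · exact integrableOn_mul_bounded hψ.integrableOn (by fun_prop) fun x => Real.abs_sin_le_one _
  · exact integrableOn_mul_bounded hφ.integrableOn (by fun_prop) fun x => Real.abs_sin_le_one _

/-- For `β = -1`, the cosine coefficients of a solution are minus the sine coefficients of `f`. -/
lemma IsAlmostBoundedSolution.cos_coeff {f φ : ℝ → ℝ} (hf : HolderClosed f)
    (h : IsAlmostBoundedSolution (-1) f φ) (n : ℕ) :
    ∫ x in Ioo (0 : ℝ) 1, φ x * Real.cos (((n + 1 : ℕ) : ℝ) * (Real.pi * x)) =
      -∫ x in Ioo (0 : ℝ) 1, f x * Real.sin (((n + 1 : ℕ) : ℝ) * (Real.pi * x)) := by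
  have hi := h.integrableOn
  have hs := (satisfiesCharacteristicEq_neg_one_iff h.1 hi).1 h.2.2
  have := integral_sin_mul_pvTransform_mul_sin h.1 hi
    (hf.integrableOn.congr_fun (fun x hx => (hs x hx).symm) measurableSet_Ioo) n
  rw [← neg_eq_iff_eq_neg, ← this]
  exact setIntegral_unit_congr fun x hx => by rw [hs x hx]

lemma IsAlmostBoundedSolution.exists_eq_add_const {f φ ψ : ℝ → ℝ} (hf : HolderClosed f)
    (hφ : IsAlmostBoundedSolution (-1) f φ) (hψ : IsAlmostBoundedSolution (-1) f ψ) :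
    ∃ C : ℝ, ∀ x ∈ Ioo (0 : ℝ) 1, ψ x = φ x + C := by
  refine ⟨∫ y in Ioo (0 : ℝ) 1, (ψ y - φ y), fun x hx => ?_⟩
  have := eq_mean_of_cos_coeff_eq_zero (h := fun x => ψ x - φ x)
    (hψ.1.continuousOn.sub hφ.1.continuousOn) (hψ.integrableOn.sub hφ.integrableOn)
    (fun n => by
      simp only [sub_mul]
      rw [integral_sub, hψ.cos_coeff hf, hφ.cos_coeff hf, sub_self]
      · exact integrableOn_mul_bounded hψ.integrableOn (by fun_prop) fun x => Real.abs_cos_le_one _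
      · exact integrableOn_mul_bounded hφ.integrableOn (by fun_prop) fun x =>
          Real.abs_cos_le_one _) hx
  linarith

lemma HolderClosed.isAlmostBoundedSolution_neg_one {f : ℝ → ℝ} (hf : HolderClosed f) :
    IsAlmostBoundedSolution (-1) f
      (fun x => -pvTransform (fun ξ => Real.sin (Real.pi * ξ) * f ξ) x) := by
  obtain ⟨M, -, hM⟩ := hf.exists_log_bound
  have hφ := hf.sin_mul.holderOpen_pvTransform.neg
  have hM' : ∀ x ∈ Ioo (0 : ℝ) 1, |-pvTransform (fun ξ => Real.sin (Real.pi * ξ) * f ξ) x| ≤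
      M * (1 + |Real.log x| + |Real.log (1 - x)|) := fun x hx => by
    rw [abs_neg]; exact hM x hx
  refine ⟨hφ, ⟨M, hM'⟩, (satisfiesCharacteristicEq_neg_one_iff hφ
    (hφ.integrableOn_of_log_bounded hM')).2 fun x hx => ?_⟩
  rw [pvTransform_neg, mul_neg, hf.sin_mul_pvTransform_pvTransform hx, neg_neg]

lemma SatisfiesCharacteristicEq.add_const {f φ ψ : ℝ → ℝ} (hφ : HolderOpen φ)
    (hi : IntegrableOn φ (Ioo 0 1)) (h : SatisfiesCharacteristicEq (-1) f φ) {C : ℝ}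
    (e : ∀ x ∈ Ioo (0 : ℝ) 1, ψ x = φ x + C) :
    HolderOpen ψ ∧ SatisfiesCharacteristicEq (-1) f ψ := by
  have hψ : HolderOpen ψ := (hφ.add (holderClosed_const C).holderOpen).congr e
  have hψi : IntegrableOn ψ (Ioo 0 1) :=
    (hi.add (integrableOn_unit_const C)).congr_fun (fun x hx => (e x hx).symm) measurableSet_Ioo
  refine ⟨hψ, (satisfiesCharacteristicEq_neg_one_iff hψ hψi).2 fun x hx => ?_⟩
  rw [pvTransform_congr e hx, pvTransform_add hφ hi (holderClosed_const C).holderOpen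
    (integrableOn_unit_const C) hx, pvTransform_const, add_zero]
  exact (satisfiesCharacteristicEq_neg_one_iff hφ hi).1 h x hx

lemma IsAlmostBoundedSolution.add_const {f φ ψ : ℝ → ℝ}
    (h : IsAlmostBoundedSolution (-1) f φ) {C : ℝ} (e : ∀ x ∈ Ioo (0 : ℝ) 1, ψ x = φ x + C) :
    IsAlmostBoundedSolution (-1) f ψ := by
  have hi := h.integrableOn
  obtain ⟨h1, ⟨M, hM⟩, h2⟩ := h
  obtain ⟨h3, h4⟩ := h2.add_const h1 hi e
  refine ⟨h3, ⟨M + |C|, fun x hx => ?_⟩, h4⟩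
  rw [e x hx]
  refine (abs_add_le _ _).trans ?_
  have h5 : |C| ≤ |C| * (1 + |Real.log x| + |Real.log (1 - x)|) :=
    le_mul_of_one_le_right (abs_nonneg _)
      (by linarith [abs_nonneg (Real.log x), abs_nonneg (Real.log (1 - x))])
  rw [add_mul]
  exact add_le_add (hM x hx) h5

lemma IsBoundedSolution.add_const {f φ ψ : ℝ → ℝ} (h : IsBoundedSolution (-1) f φ) {C : ℝ}
    (e : ∀ x ∈ Ioo (0 : ℝ) 1, ψ x = φ x + C) : IsBoundedSolution (-1) f ψ := by
  have hi := h.integrableOn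
  obtain ⟨h1, ⟨M, hM⟩, h2⟩ := h
  obtain ⟨h3, h4⟩ := h2.add_const h1 hi e
  refine ⟨h3, ⟨M + |C|, fun x hx => ?_⟩, h4⟩
  rw [e x hx]
  exact (abs_add_le _ _).trans (add_le_add (hM x hx) le_rfl)

lemma HolderClosed.isBoundedSolution_neg_one {f : ℝ → ℝ} (hf : HolderClosed f) (h0 : f 0 = 0)
    (h1 : f 1 = 0) : IsBoundedSolution (-1) f
      (fun x => -pvTransform (fun ξ => Real.sin (Real.pi * ξ) * f ξ) x) := by
  obtain ⟨M, hM⟩ := hf.exists_bound_of_endpoints h0 h1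
  have h := hf.isAlmostBoundedSolution_neg_one
  exact ⟨h.1, ⟨M, fun x hx => by rw [abs_neg]; exact hM x hx⟩, h.2.2⟩

theorem mainTheorem8 (f : ℝ → ℝ) (hf : HolderClosed f) :
    -- the case `β = 1`
    (((∃ φ : ℝ → ℝ, IsBoundedSolution 1 f φ) ↔ ∫ ξ in (0 : ℝ)..1, f ξ = 0) ∧
      ((∫ ξ in (0 : ℝ)..1, f ξ = 0) →
        ∃ φ : ℝ → ℝ, IsHilbertInverse 1 f φ ∧ IsBoundedSolution 1 f φ ∧
          ∀ ψ : ℝ → ℝ, IsBoundedSolution 1 f ψ → EqOn ψ φ (Ioo 0 1))) ∧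
    -- the case `β = -1`
    (∃ φ : ℝ → ℝ, IsHilbertInverse (-1) f φ ∧
      (∀ ψ : ℝ → ℝ, IsAlmostBoundedSolution (-1) f ψ ↔
        ∃ C : ℝ, ∀ x ∈ Ioo (0 : ℝ) 1, ψ x = φ x + C) ∧
      ((∃ ψ : ℝ → ℝ, IsBoundedSolution (-1) f ψ) ↔ f 0 = 0 ∧ f 1 = 0) ∧
      (f 0 = 0 → f 1 = 0 → ∀ ψ : ℝ → ℝ, IsBoundedSolution (-1) f ψ ↔
        ∃ C : ℝ, ∀ x ∈ Ioo (0 : ℝ) 1, ψ x = φ x + C)) := by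
  have hint : ∫ ξ in (0 : ℝ)..1, f ξ = ∫ ξ in Ioo (0 : ℝ) 1, f ξ := by
    rw [intervalIntegral.integral_of_le zero_le_one, integral_Ioc_eq_integral_Ioo]
  have hab := hf.isAlmostBoundedSolution_neg_one
  rw [hint]
  refine ⟨⟨⟨?_, fun h0 => ⟨_, hf.isBoundedSolution_one h0⟩⟩, fun h0 =>
    ⟨_, hf.isHilbertInverse_one, hf.isBoundedSolution_one h0,
      fun ψ hψ => (hf.isBoundedSolution_one h0).eqOn_of_one hf hψ⟩⟩,
    _, hf.isHilbertInverse_neg_one, fun ψ => ⟨fun hψ => hab.exists_eq_add_const hf hψ,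
      fun ⟨C, hC⟩ => hab.add_const hC⟩, ⟨?_, fun h => ⟨_, hf.isBoundedSolution_neg_one h.1 h.2⟩⟩,
    fun h0 h1 ψ => ⟨fun hψ => hab.exists_eq_add_const hf hψ.isAlmostBoundedSolution,
      fun ⟨C, hC⟩ => (hf.isBoundedSolution_neg_one h0 h1).add_const hC⟩⟩
  · rintro ⟨φ, hφ⟩
    -- In degree 0 the sine coefficient is trivially zero and the cosine coefficient is ∫ f.
    simpa using (hφ.sin_coeff hf 0).symm
  · rintro ⟨ψ, hψ⟩
    obtain ⟨C, hC⟩ := hab.exists_eq_add_const hf hψ.isAlmostBoundedSolution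
    obtain ⟨M, hM⟩ := hψ.2.1
    refine hf.endpoints_eq_zero (B := M + |C|) fun x hx => ?_
    -- A bounded solution differs from -T(sin · f) by a constant, so T(sin · f) is itself bounded,
    -- which forces f to vanish at both endpoints.
    have e : pvTransform (fun ξ => Real.sin (Real.pi * ξ) * f ξ) x = C - ψ x := by
      have := hC x hx
      linarith
    rw [e]
    exact (abs_sub _ _).trans (by linarith [hM x hx])
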